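/- Let $d\ge 3$, $D=\binom{d+1}{2}$ and $W=\mathbb R^{d+1}$, and identify $\bigwedge^k W$ with $\mathbb R^{\binom{d+1}{k}}$ through the standard basis. Let $Gr(k,W)$ be the Grassmannian of $k$-dimensional subspaces of $W$ in its Plücker embedding; its points are given by nonzero decomposable vectors $v_1\wedge\dots\wedge v_k$ up to scaling. For $q\in\bigwedge^2W$ and $r\in\bigwedge^{d-1}W$ put $q\cdot r=\sum_{i_1<i_2}(-1)^{i_1+i_2}q_{i_1i_2}\,r_{j_1\dots j_{d-1}}$, where $\{j_1<\dots<j_{d-1}\}=[d+1]\setminus\{i_1,i_2\}$. Let $G=(V,E)$ be a finite graph, possibly with parallel edges but without loops, whose vertex set is partitioned into a set $B$ of bodies and a set $R$ of rods (either may be empty). For $F\subseteq E$ let $V(F)$ be the set of vertices incident to an edge of $F$, let $R(F)=V(F)\cap R$, and let $$f(F)=D(|V(F)|-1)-|R(F)|.$$ The count matroid $\mathcal M_f(G)$ is the matroid on $E$ in which $I\subseteq E$ is independent if and only if $|F|\le f(F)$ for every nonempty $F\subseteq I$. A rod-configuration is a map $\mathbf r:R\to Gr(d-1,W)$, $v\mapsto[r_v]$,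 with $\mathbf r(u)\ne\mathbf r(v)$ whenever $u\neq v$. Given $\mathbf r$, a bar-configuration is a map $\mathbf q:E\to Gr(2,W)$, $e\mapsto[q_e]$, such that $q_e\cdot r_v=0$ whenever $e\in E$ is incident to $v\in R$. The body-rod-bar matroid $\mathcal{BR}(G,\mathbf q,\mathbf r)$ is the linear matroid on $E$ in which an edge $e=uv$ is represented by the vector of $(\mathbb R^{D})^{V}$ that has $q_e$ in the block of $u$, $-q_e$ in the block of $v$, and $0$ elsewhere. A property holds for almost all members of a space of configurations if it holds outside a relatively Zariski closed subset whose complement is dense in the space (for the Euclidean topology). Theorem. For almost all rod-configurations $\mathbf r$, and for almost all bar-configurations $\mathbf q$ compatible with $\mathbf r$, one has $\mathcal{BR}(G,\mathbf q,\mathbf r)=\mathcal M_f(G)$. Equivalently, $I\subseteq E$ is independent in $\mathcal{BR}(G,\mathbf q,\mathbf r)$ if and only if $|F|\le D|V(F)|-D-|R(F)|$ for every nonempty $F\subseteq I$. -/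

import Mathlib

namespace BodyRodBar

/-! ### Matroids -/

theorem linearIndepOn_augment {α M : Type*} [Finite α] [AddCommGroup M] [Module ℝ M]
    (x : α → M) {I J : Set α} (hI : LinearIndepOn ℝ x I) (hJ : LinearIndepOn ℝ x J)
    (hlt : I.ncard < J.ncard) : ∃ e ∈ J, e ∉ I ∧ LinearIndepOn ℝ x (insert e I) := by
  by_contra! hcon
  have hsub : x '' J ⊆ Submodule.span ℝ (x '' I) := by
    rintro _ ⟨e, he, rfl⟩
    by_cases heI : e ∈ I
    · exact Submodule.subset_span ⟨e, heI, rfl⟩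
    · by_contra hns
      exact hcon e he heI ((linearIndepOn_insert heI).2 ⟨hI, hns⟩)
  have hle : Submodule.span ℝ (x '' J) ≤ Submodule.span ℝ (x '' I) :=
    Submodule.span_le.2 hsub
  have : FiniteDimensional ℝ (Submodule.span ℝ (x '' I)) :=
    FiniteDimensional.span_of_finite ℝ (Set.toFinite _)
  have hr := Submodule.finrank_mono hle
  have key : ∀ K : Set α, LinearIndepOn ℝ x K →
      Module.finrank ℝ (Submodule.span ℝ (x '' K)) = K.ncard := by
    intro K hK
    have : Fintype K := Fintype.ofFinite K
    have h := finrank_span_eq_card (R := ℝ) (b := fun e : K => x e) hK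
    rw [← Nat.card_eq_fintype_card, Nat.card_coe_set_eq] at h
    rw [← h, Set.image_eq_range]
  rw [key I hI, key J hJ] at hr
  omega

/-- The linear matroid on a finite set `α` in which `e` is represented by the vector `x e`:
a set is independent when the corresponding subfamily is linearly independent over `ℝ`. -/
noncomputable def linearMatroid {α M : Type*} [Finite α] [AddCommGroup M] [Module ℝ M]
    (x : α → M) : Matroid α :=
  (IndepMatroid.ofFinite (E := Set.univ) Set.finite_univ (fun I => LinearIndepOn ℝ x I)
    (linearIndepOn_empty ℝ x)
    (fun _ _ hJ hIJ => hJ.mono hIJ)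
    (fun _ _ hI hJ hlt => linearIndepOn_augment x hI hJ hlt)
    (fun _ _ => Set.subset_univ _)).matroid

theorem induced_augment {α : Type*} [Finite α] {μ : Set α → ℤ} (hmono : Monotone μ)
    (hsub : ∀ X Y, μ (X ∪ Y) + μ (X ∩ Y) ≤ μ X + μ Y) {I J : Set α}
    (hI : ∀ F ⊆ I, F.Nonempty → (F.ncard : ℤ) ≤ μ F)
    (hJ : ∀ F ⊆ J, F.Nonempty → (F.ncard : ℤ) ≤ μ F) (hlt : I.ncard < J.ncard) :
    ∃ e ∈ J, e ∉ I ∧ ∀ F ⊆ insert e I, F.Nonempty → (F.ncard : ℤ) ≤ μ F := by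
  classical
  by_contra! hcon
  -- the union of two tight subsets of `I` with a common element is tight
  have hunion : ∀ X Y : Set α, X ⊆ I → Y ⊆ I → (X ∩ Y).Nonempty →
      μ X = X.ncard → μ Y = Y.ncard → μ (X ∪ Y) = (X ∪ Y).ncard := by
    intro X Y hX hY hXY htX htY
    have h1 := hsub X Y
    have h2 := hI _ (Set.inter_subset_left.trans hX) hXY
    have h3 := hI _ (Set.union_subset hX hY) (hXY.mono (fun a ha => Or.inl ha.1))
    have h4 := Set.ncard_union_add_ncard_inter X Y
    zify at h4
    omega
  -- every element of `J \ I` is spanned by a nonempty tight subset of `I`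
  have htight : ∀ e ∈ J, e ∉ I → ∃ T ⊆ I, T.Nonempty ∧ μ T = T.ncard ∧
      μ (insert e T) = μ T := by
    intro e heJ heI
    obtain ⟨F, hF, hne, hlt'⟩ := hcon e heJ heI
    have heF : e ∈ F := by
      by_contra heF
      exact absurd (hI F (fun a ha => (hF ha).resolve_left
        (fun h => heF (h ▸ ha))) hne) (not_le.2 hlt')
    set T := F \ {e} with hT
    have hTI : T ⊆ I := fun a ha => (hF ha.1).resolve_left ha.2
    have hins : insert e T = F := by
      rw [hT, Set.insert_sdiff_singleton, Set.insert_eq_of_mem heF]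
    have hcard : T.ncard + 1 = F.ncard := Set.ncard_sdiff_singleton_add_one heF
    have hTne : T.Nonempty := by
      by_contra h
      rw [Set.not_nonempty_iff_eq_empty] at h
      rw [h] at hins
      have := hJ F (by rw [← hins]; simpa using heJ) hne
      omega
    have h1 := hI T hTI hTne
    have h2 : μ T ≤ μ F := hmono Set.sdiff_subset
    refine ⟨T, hTI, hTne, ?_, ?_⟩
    · omega
    · rw [hins]; omega
  -- `span T` collects what a tight set absorbs
  have habs : ∀ (T : Set α), ∀ S : Finset α, (∀ e ∈ S, μ (insert e T) = μ T) →
      μ (T ∪ S) = μ T := by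
    intro T S
    induction S using Finset.induction_on with
    | empty => intro _; simp
    | insert a S _ ih =>
      intro h
      have hS := ih (fun e he => h e (Finset.mem_insert_of_mem he))
      have ha := h a (Finset.mem_insert_self a S)
      have h1 := hsub (T ∪ S) (insert a T)
      have h2 : μ T ≤ μ ((T ∪ S) ∩ insert a T) :=
        hmono (fun b hb => ⟨Or.inl hb, Or.inr hb⟩)
      have h3 : (T ∪ ↑(insert a S) : Set α) = (T ∪ S) ∪ insert a T := by
        ext b; simp; tauto
      have h4 : μ T ≤ μ (T ∪ ↑(insert a S)) := hmono Set.subset_union_left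
      rw [h3] at h4 ⊢
      omega
  have hfin : ∀ X : Set α, X.Finite := fun X => Set.toFinite X
  -- the maximal nonempty tight subsets of `I`
  let 𝒯 : Set (Set α) := {T | Maximal (fun T => T ⊆ I ∧ T.Nonempty ∧ μ T = T.ncard) T}
  have hmax : ∀ T, T ∈ 𝒯 ↔ Maximal (fun T => T ⊆ I ∧ T.Nonempty ∧ μ T = T.ncard) T :=
    fun _ => Iff.rfl
  have h𝒯fin : 𝒯.Finite := Set.toFinite 𝒯
  have hdisj : ∀ T₁ ∈ 𝒯, ∀ T₂ ∈ 𝒯, T₁ ≠ T₂ → Disjoint T₁ T₂ := by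
    intro T₁ h₁ T₂ h₂ hne
    rw [hmax] at h₁ h₂
    rw [Set.disjoint_iff_inter_eq_empty]
    by_contra h
    have hn := Set.nonempty_iff_ne_empty.2 h
    have hu := hunion T₁ T₂ h₁.prop.1 h₂.prop.1 hn h₁.prop.2.2 h₂.prop.2.2
    have hp : (T₁ ∪ T₂) ⊆ I ∧ (T₁ ∪ T₂).Nonempty ∧ μ (T₁ ∪ T₂) = (T₁ ∪ T₂).ncard :=
      ⟨Set.union_subset h₁.prop.1 h₂.prop.1, h₁.prop.2.1.inl, hu⟩
    apply hne
    exact (h₁.eq_of_subset hp Set.subset_union_left).trans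
      (h₂.eq_of_subset hp Set.subset_union_right).symm
  let Jt : Set α → Set α := fun T => {e ∈ J | μ (insert e T) = μ T}
  have hJt : ∀ T ∈ 𝒯, (Jt T).ncard ≤ T.ncard := by
    intro T hT
    rcases (Jt T).eq_empty_or_nonempty with h0 | hne
    · simp [h0]
    have h1 := hJ (Jt T) (fun e he => he.1) hne
    have h2 := habs T (hfin (Jt T)).toFinset (by
      intro e he
      exact ((Set.Finite.mem_toFinset _).1 he).2)
    rw [Set.Finite.coe_toFinset] at h2
    have h3 : μ (Jt T) ≤ μ (T ∪ Jt T) := hmono Set.subset_union_right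
    have h4 := ((hmax T).1 hT).prop.2.2
    omega
  let U : Set α := ⋃ T ∈ 𝒯, T
  have hcover : J ⊆ (⋃ T ∈ h𝒯fin.toFinset, Jt T) ∪ (I \ U) := by
    intro e he
    by_cases heI : e ∈ I
    · by_cases heU : e ∈ U
      · left
        simp only [U, Set.mem_iUnion] at heU
        obtain ⟨T, hT, heT⟩ := heU
        simp only [Set.mem_iUnion]
        exact ⟨T, (Set.Finite.mem_toFinset _).2 hT, he, by rw [Set.insert_eq_of_mem heT]⟩
      · exact Or.inr ⟨heI, heU⟩
    · left
      obtain ⟨T, hTI, hTne, hTt, hTe⟩ := htight e he heI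
      obtain ⟨M, hTM, hM⟩ := (Set.toFinite
        {T : Set α | T ⊆ I ∧ T.Nonempty ∧ μ T = T.ncard}).exists_le_maximal
          (show T ∈ {T : Set α | T ⊆ I ∧ T.Nonempty ∧ μ T = T.ncard} from ⟨hTI, hTne, hTt⟩)
      simp only [Set.mem_iUnion]
      refine ⟨M, (Set.Finite.mem_toFinset _).2 hM, he, ?_⟩
      have h1 := hsub (insert e T) M
      have h2 : insert e T ∪ M = insert e M := by
        rw [Set.insert_union, Set.union_eq_self_of_subset_left hTM]
      have h3 : μ T ≤ μ (insert e T ∩ M) := hmono (fun b hb => ⟨Or.inr hb, hTM hb⟩)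
      have h4 : μ M ≤ μ (insert e M) := hmono (Set.subset_insert e M)
      rw [h2] at h1
      omega
  have hUI : U ⊆ I := by
    intro e he
    simp only [U, Set.mem_iUnion] at he
    obtain ⟨T, hT, heT⟩ := he
    exact ((hmax T).1 hT).prop.1 heT
  have hUcard : U.ncard = ∑ T ∈ h𝒯fin.toFinset, T.ncard := by
    have hU : U = ↑(h𝒯fin.toFinset.biUnion fun T => (hfin T).toFinset) := by
      ext e; simp [U]
    rw [hU, Set.ncard_coe_finset, Finset.card_biUnion]
    · exact Finset.sum_congr rfl (fun T _ => (Set.ncard_eq_toFinset_card T (hfin T)).symm)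
    · intro T₁ h₁ T₂ h₂ hne
      refine Set.Finite.disjoint_toFinset.2 ?_
      exact hdisj _ ((Set.Finite.mem_toFinset _).1 h₁) _
        ((Set.Finite.mem_toFinset _).1 h₂) hne
  have hA : (⋃ T ∈ h𝒯fin.toFinset, Jt T).ncard ≤ ∑ T ∈ h𝒯fin.toFinset, (Jt T).ncard :=
    Finset.set_ncard_biUnion_le _ _
  have hB : ∑ T ∈ h𝒯fin.toFinset, (Jt T).ncard ≤ ∑ T ∈ h𝒯fin.toFinset, T.ncard :=
    Finset.sum_le_sum (fun T hT => hJt T ((Set.Finite.mem_toFinset _).1 hT))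
  have hC := Set.ncard_le_ncard hcover (hfin _)
  have hD := Set.ncard_union_le (⋃ T ∈ h𝒯fin.toFinset, Jt T) (I \ U)
  have hE := Set.ncard_sdiff_add_ncard_of_subset hUI (hfin I)
  omega

/-- The matroid induced by an integer-valued monotone submodular set function `μ` on a finite set:
`I` is independent when `|F| ≤ μ F` for every nonempty `F ⊆ I`. -/
noncomputable def inducedMatroid {α : Type*} [Finite α] (μ : Set α → ℤ) (hmono : Monotone μ)
    (hsub : ∀ X Y, μ (X ∪ Y) + μ (X ∩ Y) ≤ μ X + μ Y) : Matroid α :=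
  (IndepMatroid.ofFinite (E := Set.univ) Set.finite_univ
    (fun I => ∀ F ⊆ I, F.Nonempty → (F.ncard : ℤ) ≤ μ F)
    (by
      intro F hF hne
      exact absurd (Set.subset_empty_iff.1 hF) hne.ne_empty)
    (fun _ _ hJ hIJ F hF => hJ F (hF.trans hIJ))
    (fun _ _ hI hJ hlt => induced_augment hmono hsub hI hJ hlt)
    (fun _ _ => Set.subset_univ _)).matroid

/-! ### Count matroids of multigraphs -/

section Count

variable {V E : Type*} (G : Graph V E)

/-- `V(F)`: the vertices that are incident to some edge of `F`. -/
def spanned (F : Set G.edgeSet) : Set V := {v | ∃ e ∈ F, G.Inc e v}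

/-- `f(F) = D (|V(F)| - 1) - |R(F)|` with `D = (d+1 choose 2)`, where `R(F)` is the set of
vertices of `R` spanned by `F`. -/
noncomputable def countFun (d : ℕ) (R : Set V) (F : Set G.edgeSet) : ℤ :=
  ((d + 1).choose 2 : ℤ) * (((spanned G F).ncard : ℤ) - 1) - ((spanned G F ∩ R).ncard : ℤ)

theorem spanned_finite [Finite G.edgeSet] (F : Set G.edgeSet) : (spanned G F).Finite := by
  have h : spanned G F = ⋃ e ∈ F, {v | G.Inc e v} := by
    ext v; simp [spanned]
  rw [h]
  refine (Set.toFinite F).biUnion (fun e _ => ?_)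
  obtain ⟨x, y, hxy⟩ := G.exists_isLink_of_mem_edgeSet e.2
  exact (Set.toFinite {x, y}).subset (fun v hv => hv.eq_or_eq_of_isLink hxy)

theorem countFun_eq [Finite G.edgeSet] {d : ℕ} (R : Set V) (F : Set G.edgeSet) :
    countFun G d R F = ((d + 1).choose 2 : ℤ) * ((spanned G F \ R).ncard : ℤ) +
      (((d + 1).choose 2 : ℤ) - 1) * ((spanned G F ∩ R).ncard : ℤ) - ((d + 1).choose 2 : ℤ) := by
  have h := Set.ncard_inter_add_ncard_sdiff_eq_ncard (spanned G F) R (spanned_finite G F)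
  rw [countFun, ← h]
  push_cast
  ring

theorem spanned_mono {X Y : Set G.edgeSet} (h : X ⊆ Y) : spanned G X ⊆ spanned G Y :=
  fun _ ⟨e, he, hv⟩ => ⟨e, h he, hv⟩

theorem spanned_union (X Y : Set G.edgeSet) :
    spanned G (X ∪ Y) = spanned G X ∪ spanned G Y := by
  ext v
  constructor
  · rintro ⟨e, he | he, hv⟩
    · exact Or.inl ⟨e, he, hv⟩
    · exact Or.inr ⟨e, he, hv⟩
  · rintro (⟨e, he, hv⟩ | ⟨e, he, hv⟩)
    · exact ⟨e, Or.inl he, hv⟩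
    · exact ⟨e, Or.inr he, hv⟩

theorem choose_pos_of {d : ℕ} (hd : 3 ≤ d) : (1 : ℤ) ≤ ((d + 1).choose 2 : ℤ) := by
  exact_mod_cast Nat.choose_pos (by omega)

theorem countFun_mono [Finite G.edgeSet] {d : ℕ} (hd : 3 ≤ d) (R : Set V) :
    Monotone (countFun G d R) := by
  intro X Y h
  have hD := choose_pos_of hd
  have hs := spanned_mono G h
  have h1 : ((spanned G X \ R).ncard : ℤ) ≤ (spanned G Y \ R).ncard := by
    exact_mod_cast Set.ncard_le_ncard (Set.sdiff_subset_sdiff_left hs)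
      ((spanned_finite G Y).subset Set.sdiff_subset)
  have h2 : ((spanned G X ∩ R).ncard : ℤ) ≤ (spanned G Y ∩ R).ncard := by
    exact_mod_cast Set.ncard_le_ncard (Set.inter_subset_inter_left R hs)
      ((spanned_finite G Y).subset Set.inter_subset_left)
  rw [countFun_eq, countFun_eq]
  have h3 := mul_le_mul_of_nonneg_left h1 (by omega : (0 : ℤ) ≤ ((d + 1).choose 2 : ℤ))
  have h4 := mul_le_mul_of_nonneg_left h2 (by omega : (0 : ℤ) ≤ ((d + 1).choose 2 : ℤ) - 1)
  omega

theorem countFun_submodular [Finite G.edgeSet] {d : ℕ} (hd : 3 ≤ d) (R : Set V)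
    (X Y : Set G.edgeSet) :
    countFun G d R (X ∪ Y) + countFun G d R (X ∩ Y) ≤ countFun G d R X + countFun G d R Y := by
  have hD := choose_pos_of hd
  have hi : spanned G (X ∩ Y) ⊆ spanned G X ∩ spanned G Y :=
    fun v hv => ⟨spanned_mono G Set.inter_subset_left hv, spanned_mono G Set.inter_subset_right hv⟩
  have hf := spanned_finite G
  have key : ∀ A B C U : Set V, A.Finite → B.Finite → U = A ∪ B → C ⊆ A ∩ B →
      (U.ncard : ℤ) + C.ncard ≤ A.ncard + B.ncard := by
    intro A B C U hA hB hU hC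
    have h1 := Set.ncard_union_add_ncard_inter A B hA hB
    have h2 := Set.ncard_le_ncard hC (hA.subset Set.inter_subset_left)
    rw [hU]
    omega
  have h1 := key (spanned G X \ R) (spanned G Y \ R) (spanned G (X ∩ Y) \ R)
    (spanned G (X ∪ Y) \ R) ((hf X).subset Set.sdiff_subset) ((hf Y).subset Set.sdiff_subset)
    (by rw [spanned_union, Set.union_sdiff_distrib])
    (fun v hv => ⟨⟨(hi hv.1).1, hv.2⟩, ⟨(hi hv.1).2, hv.2⟩⟩)
  have h2 := key (spanned G X ∩ R) (spanned G Y ∩ R) (spanned G (X ∩ Y) ∩ R)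
    (spanned G (X ∪ Y) ∩ R) ((hf X).subset Set.inter_subset_left)
    ((hf Y).subset Set.inter_subset_left)
    (by rw [spanned_union, Set.union_inter_distrib_right])
    (fun v hv => ⟨⟨(hi hv.1).1, hv.2⟩, ⟨(hi hv.1).2, hv.2⟩⟩)
  have h3 := mul_le_mul_of_nonneg_left h1 (by omega : (0 : ℤ) ≤ ((d + 1).choose 2 : ℤ))
  have h4 := mul_le_mul_of_nonneg_left h2 (by omega : (0 : ℤ) ≤ ((d + 1).choose 2 : ℤ) - 1)
  simp only [mul_add] at h3 h4
  simp only [countFun_eq]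
  omega

/-- The count matroid `M_f(G, {B, R})`: the matroid on the edge set of `G` induced by `f`. -/
noncomputable def countMatroid [Finite G.edgeSet] {d : ℕ} (hd : 3 ≤ d) (R : Set V) :
    Matroid G.edgeSet :=
  inducedMatroid (countFun G d R) (countFun_mono G hd R) (countFun_submodular G hd R)

end Count

/-! ### Plücker coordinates, with `W = ℝ^(d+1)` -/

/-- The exterior power `⋀ᵏ W`, identified with real coordinate space through the standard basis
`e_{i₁} ∧ ⋯ ∧ e_{iₖ}`, `i₁ < ⋯ < iₖ`. -/
abbrev Ext (d k : ℕ) : Type := Set.powersetCard (Fin (d + 1)) k → ℝ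

/-- `v₁ ∧ ⋯ ∧ vₖ` in coordinates: the `k × k` minors of the matrix with rows `vᵢ`. -/
noncomputable def wedge {d k : ℕ} (v : Fin k → Fin (d + 1) → ℝ) : Ext d k :=
  fun s => (Matrix.of fun i j => v i (Set.powersetCard.ofFinEmbEquiv.symm s j)).det

/-- The Grassmannian `Gr(k, W)` in its Plücker embedding, given by its homogeneous coordinate
vectors: the nonzero decomposable elements of `⋀ᵏ W`. -/
def Gr (d k : ℕ) : Set (Ext d k) :=
  {p | p ≠ 0 ∧ ∃ v : Fin k → Fin (d + 1) → ℝ, p = wedge v}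

/-- The product `⟨q, r⟩ = ∑_{i₁ < i₂} (-1)^{i₁+i₂} q_{i₁ i₂} r_{j₁ ⋯ j_{d-1}}` of `⋀² W` and
`⋀^{d-1} W`, where `j₁ < ⋯ < j_{d-1}` is the complement of `i₁ < i₂`.
(Indices here start from `0`, which does not change the parity of `i₁ + i₂`.) -/
noncomputable def pairing {d : ℕ} (q : Ext d 2) (r : Ext d (d - 1)) : ℝ :=
  ∑ s : Set.powersetCard (Fin (d + 1)) 2,
    (-1) ^ (∑ i ∈ (s : Finset (Fin (d + 1))), (i : ℕ)) * q s *
      r ⟨(s : Finset (Fin (d + 1)))ᶜ, by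
        have h : (s : Finset (Fin (d + 1))).card = 2 := s.2
        change (s : Finset (Fin (d + 1)))ᶜ.card = d - 1
        rw [Finset.card_compl, h, Fintype.card_fin]
        omega⟩

/-! ### Almost all configurations -/

/-- `P` holds for almost all members of a set `C` of configurations (families of coordinate
vectors): it holds outside a (relatively) Zariski closed subset of `C`, the zero set in `C` of a
polynomial in the coordinates, whose complement is dense in `C`. Since a real variety is the zero
set of a single polynomial, one polynomial is enough. -/
def AlmostAll {ι κ : Type*} (C : Set (ι → κ → ℝ)) (P : (ι → κ → ℝ) → Prop) : Prop :=
  ∃ p : MvPolynomial (ι × κ) ℝ,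
    C ⊆ closure {x ∈ C | MvPolynomial.eval (fun a => x a.1 a.2) p ≠ 0} ∧
    ∀ x ∈ C, MvPolynomial.eval (fun a => x a.1 a.2) p ≠ 0 → P x

/-! ### Body-rod-bar frameworks -/

section Framework

variable {V E : Type*} (G : Graph V E)

/-- The rod-configurations `r : R → Gr(d-1, W)`; the rods are pairwise distinct, that is, no two
of their coordinate vectors are proportional. -/
def rodConfigurations (d : ℕ) (R : Set V) : Set (R → Ext d (d - 1)) :=
  {r | (∀ v, r v ∈ Gr d (d - 1)) ∧ ∀ u v, u ≠ v → ∀ c : ℝ, r u ≠ c • r v}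

/-- The bar-configurations `q : E → Gr(2, W)` satisfying the incidence condition: the bar of an
edge meets the rod of each end of the edge that lies in `R`. -/
def barConfigurations {d : ℕ} {R : Set V} (r : R → Ext d (d - 1)) :
    Set (G.edgeSet → Ext d 2) :=
  {q | (∀ e, q e ∈ Gr d 2) ∧ ∀ (e : G.edgeSet) (v : R), G.Inc e v → pairing (q e) (r v) = 0}

/-- One end of an edge (the choice of which only affects signs). -/
noncomputable def tail (e : G.edgeSet) : V := (G.exists_isLink_of_mem_edgeSet e.2).choose

/-- The other end of an edge. -/
noncomputable def head (e : G.edgeSet) : V := (G.exists_isLink_of_mem_edgeSet e.2).choose_spec.choose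

/-- The vector `(0, …, 0, q_e, 0, …, 0, -q_e, 0, …, 0)` of an edge `e = uv`, with `q_e` in the
block of `u` and `-q_e` in the block of `v`: the coefficient vector of the equation
`q_e · (m(u) - m(v)) = 0` for infinitesimal motions `m`. -/
noncomputable def edgeVector {d : ℕ} (q : G.edgeSet → Ext d 2) (e : G.edgeSet) : V → Ext d 2 :=
  open Classical in Pi.single (tail G e) (q e) - Pi.single (head G e) (q e)

/-- The body-rod-bar matroid `BR(G, q, r)`. The rods enter only through the incidence condition
that is imposed on `q`. -/
noncomputable def bodyRodBarMatroid [Finite G.edgeSet] {d : ℕ} (q : G.edgeSet → Ext d 2) :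
    Matroid G.edgeSet :=
  linearMatroid (edgeVector G q)

end Framework

end BodyRodBar

/-! A rod `v` gives an alternating form on `W`, encoded as a vector `φ v` of `ℝ^D`; a body gets the
zero form. The radical of the form is the rod itself as a subspace (all of `W` for a body), and a
bar is compatible with `v` when it is orthogonal to `φ v`.

Independent sets are sparse: the rows of `F` are orthogonal to the common motions, to the rotation
`φ v` about each rod of `V(F)`, and to all motions of the vertices outside `V(F)`. These are
independent of each other, so the bound is a dimension count (`card_le_of_linearIndepOn_edgeRow`).

Sparse sets are independent: independence is the nonvanishing of a Gram determinant, and the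
configurations are images, or limits of images, of vector spaces under polynomial maps. So one
witness for each sparse set suffices. By Rado's theorem (`exists_linearIndepOn_of_card_le_finrank`)
a witness exists once the rows available to the edges of each sparse `F` span a space `S` with `dim
S ≥ |F|` (`card_le_finrank_of_rodsGeneric`).

To bound `dim S`, take a motion `m` orthogonal to `S`. For an edge `uv` the difference `m u - m v`
is a combination of `φ u` and `φ v` (`exists_eq_add_of_form_eq_zero`), so the edge behaves as a
rigid body hinged to the rods at its ends. Split `F` into blocks of edges that move together in all
such motions. Then `S` contains every family of vectors on the vertices of one block that is
orthogonal to the rods and sums to zero. By sparsity these families form a space of dimension at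
least the size of the block. It remains to see that the spaces of different blocks are independent,
that is, that there is no nonzero flow (`IsFlow.eq_zero`).

Consider the support of a nonzero flow. Different blocks share no body. If exactly two blocks of the
support meet at a rod, a motion of a configuration with that rod slightly changed separates them in
a direction that contradicts the flow conditions. Otherwise every rod has at least three incidences
and every block at least two, and a dimension count yields a nonzero flow with strictly smaller
support. The required motions exist at rods where the dimensions of all motion spaces are locally
constant (`exists_rodsGeneric`). -/

namespace BodyRodBar

open Finset Matrix

/-! ### Balanced families of vectors on an incidence structure -/

section Flow

variable {κ : Type*} [Fintype κ]

/-- The orthogonal complement of a vector for the dot product. -/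
def perp (φ : κ → ℝ) : Submodule ℝ (κ → ℝ) where
  carrier := {q | q ⬝ᵥ φ = 0}
  add_mem' := fun {a b} ha hb => by
    simp only [Set.mem_ofPred_eq] at *
    rw [add_dotProduct, ha, hb, add_zero]
  zero_mem' := zero_dotProduct φ
  smul_mem' := fun c a ha => by
    simp only [Set.mem_ofPred_eq] at *
    rw [smul_dotProduct, ha, smul_zero]

theorem mem_perp {φ q : κ → ℝ} : q ∈ perp φ ↔ q ⬝ᵥ φ = 0 := Iff.rfl

theorem finrank_perp_zero : Module.finrank ℝ (perp (0 : κ → ℝ)) = Fintype.card κ := by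
  have : perp (0 : κ → ℝ) = ⊤ := by
    ext q
    simp [mem_perp]
  rw [this, finrank_top, Module.finrank_fintype_fun_eq_card]

theorem finrank_perp {φ : κ → ℝ} (h : φ ≠ 0) :
    Module.finrank ℝ (perp φ) + 1 = Fintype.card κ := by
  let f : (κ → ℝ) →ₗ[ℝ] ℝ :=
    { toFun := fun q => q ⬝ᵥ φ
      map_add' := fun a b => add_dotProduct a b φ
      map_smul' := fun c a => smul_dotProduct c a φ }
  have hk : LinearMap.ker f = perp φ := by
    ext q
    exact Iff.rfl
  have hs : LinearMap.range f = ⊤ := by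
    rw [LinearMap.range_eq_top]
    refine f.surjective (fun h0 => h ?_)
    have : f φ = 0 := by rw [h0]; rfl
    exact dotProduct_self_eq_zero.1 this
  have := f.finrank_range_add_finrank_ker
  rw [hk, hs, finrank_top, Module.finrank_self, Module.finrank_fintype_fun_eq_card] at this
  omega

variable {N V : Type*}

/-- Extension by zero of a family of vectors indexed by a set of incident pairs. -/
noncomputable def extendFamily [DecidableEq N] [DecidableEq V] (S : Finset (N × V)) (φ : V → κ → ℝ) :
    ((p : S) → perp (φ p.1.2)) →ₗ[ℝ] (N → V → κ → ℝ) where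
  toFun a i v := if h : (i, v) ∈ S then (a ⟨(i, v), h⟩ : κ → ℝ) else 0
  map_add' a b := by
    funext i v
    by_cases h : (i, v) ∈ S <;> simp [h]
  map_smul' c a := by
    funext i v
    by_cases h : (i, v) ∈ S <;> simp [h]

theorem extendFamily_orth [DecidableEq N] [DecidableEq V] (S : Finset (N × V)) (φ : V → κ → ℝ)
    (a : (p : S) → perp (φ p.1.2)) (i : N) (v : V) : extendFamily S φ a i v ∈ perp (φ v) := by
  by_cases h : (i, v) ∈ S
  · simp only [extendFamily, LinearMap.coe_mk, AddHom.coe_mk, h, dite_true]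
    exact (a ⟨(i, v), h⟩).2
  · simp only [extendFamily, LinearMap.coe_mk, AddHom.coe_mk, h, dite_false]
    exact Submodule.zero_mem _

variable [Fintype N] [Fintype V]

/-- A family of vectors on the incident pairs, orthogonal to the rods and with vanishing sums at
all vertices and all blocks. -/
structure IsFlow (inc : N → V → Prop) (φ : V → κ → ℝ) (y : N → V → κ → ℝ) : Prop where
  supp : ∀ i v, ¬ inc i v → y i v = 0
  orth : ∀ i v, y i v ⬝ᵥ φ v = 0
  col : ∀ v, ∑ i, y i v = 0
  row : ∀ i, ∑ v, y i v = 0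

/-- The values of `c` on the blocks at `w` agree up to multiples of `φ w`, which the flow does not
see. So `c` may be replaced by a constant, and the column sum of the flow is zero. -/
theorem IsFlow.dotProduct_col {inc : N → V → Prop} {φ : V → κ → ℝ} {y : N → V → κ → ℝ}
    (hy : IsFlow inc φ y) {c : N → κ → ℝ} {w : V}
    (hc : ∀ l l', inc l w → inc l' w → ∃ a : ℝ, c l - c l' = a • φ w) :
    ∑ i, y i w ⬝ᵥ c i = 0 := by
  by_cases h : ∃ l, inc l w
  · obtain ⟨l, hl⟩ := h
    have : ∀ i, y i w ⬝ᵥ c i = y i w ⬝ᵥ c l := by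
      intro i
      by_cases hi : inc i w
      · obtain ⟨a, ha⟩ := hc i l hi hl
        rw [← sub_eq_zero, ← dotProduct_sub, ha, dotProduct_smul, hy.orth, smul_zero]
      · rw [hy.supp i w hi, zero_dotProduct, zero_dotProduct]
    rw [Finset.sum_congr rfl (fun i _ => this i), ← sum_dotProduct, hy.col, zero_dotProduct]
  · push Not at h
    exact Finset.sum_eq_zero (fun i _ => by rw [hy.supp i w (h i), zero_dotProduct])

/-- Virtual work: the row sums make the total over all columns vanish, and every column except `v`
vanishes on its own. No condition on `c` at `v` is needed, so `c` may be a motion for a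
configuration in which the rod `v` was changed. -/
theorem IsFlow.dotProduct_vertex {inc : N → V → Prop} {φ : V → κ → ℝ} {y : N → V → κ → ℝ}
    (hy : IsFlow inc φ y) {c : N → κ → ℝ} {v : V}
    (hc : ∀ w, w ≠ v → ∀ l l', inc l w → inc l' w → ∃ a : ℝ, c l - c l' = a • φ w) :
    ∑ i, y i v ⬝ᵥ c i = 0 := by
  have h1 : ∑ w, ∑ i, y i w ⬝ᵥ c i = 0 := by
    rw [Finset.sum_comm]
    refine Finset.sum_eq_zero (fun i _ => ?_)
    rw [← sum_dotProduct, hy.row, zero_dotProduct]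
  rw [← h1]
  exact (Finset.sum_eq_single v (fun w _ hw => hy.dotProduct_col (hc w hw))
    (fun h => absurd (Finset.mem_univ v) h)).symm

theorem two_le_card_of_sum_eq_zero {ι M : Type*} [Fintype ι] [AddCommGroup M] [DecidableEq M]
    {f : ι → M} (h : ∑ i, f i = 0) {i : ι} (hi : f i ≠ 0) :
    2 ≤ (univ.filter (fun i => f i ≠ 0)).card := by
  classical
  have hmem : i ∈ univ.filter (fun i => f i ≠ 0) := by simpa using hi
  by_contra hlt
  have h1 : (univ.filter (fun i => f i ≠ 0)).card = 1 := by
    have := Finset.card_pos.2 ⟨i, hmem⟩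
    omega
  obtain ⟨j, hj⟩ := Finset.card_eq_one.1 h1
  rw [hj, mem_singleton] at hmem
  rw [← Finset.sum_filter_ne_zero, hj, sum_singleton, ← hmem] at h
  exact hi h

/-- If an incidence set meets every vertex of it at least three times and every block of it at
least twice, it supports a nonzero flow which vanishes at a prescribed pair. -/
theorem exists_flow_of_card [DecidableEq N] [DecidableEq V] (hD : 4 ≤ Fintype.card κ)
    (φ : V → κ → ℝ) (S : Finset (N × V)) (hφ : ∀ p ∈ S, φ p.2 ≠ 0) {p₀ : N × V} (hp₀ : p₀ ∈ S)
    (h3 : ∀ v ∈ S.image Prod.snd, 3 ≤ (S.filter (fun p => p.2 = v)).card)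
    (h2 : ∀ i ∈ S.image Prod.fst, 2 ≤ (S.filter (fun p => p.1 = i)).card) :
    ∃ y : N → V → κ → ℝ, y ≠ 0 ∧ IsFlow (fun i v => (i, v) ∈ S) φ y ∧ y p₀.1 p₀.2 = 0 := by
  set D := Fintype.card κ with hDdef
  have hR : 3 * (S.image Prod.snd).card ≤ S.card := by
    rw [Finset.card_eq_sum_card_image Prod.snd S, mul_comm, ← smul_eq_mul]
    exact Finset.card_nsmul_le_sum _ _ _ h3
  have hN : 2 * (S.image Prod.fst).card ≤ S.card := by
    rw [Finset.card_eq_sum_card_image Prod.fst S, mul_comm, ← smul_eq_mul]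
    exact Finset.card_nsmul_le_sum _ _ _ h2
  let X := extendFamily S φ
  have hX : ∀ a i v, X a i v ∈ perp (φ v) := extendFamily_orth S φ
  -- One row condition is redundant, since all columns sum to zero. Dropping it saves `D` equations,
  -- which pays for the `D - 1` equations that force the value at `p₀` to vanish.
  let N' := (S.image Prod.fst).erase p₀.1
  -- A column sum stays in `perp (φ v)`, so its vanishing costs only `D - 1` equations.
  let colMap : ((p : S) → perp (φ p.1.2)) →ₗ[ℝ]
      ((v : S.image Prod.snd) → perp (φ v)) := LinearMap.pi fun v =>
    LinearMap.codRestrict (perp (φ v)) (∑ i, (LinearMap.proj v.1 ∘ₗ LinearMap.proj i) ∘ₗ X)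
      (fun a => by
        rw [LinearMap.sum_apply]
        exact Submodule.sum_mem _ (fun i _ => hX a i v))
  let rowMap : ((p : S) → perp (φ p.1.2)) →ₗ[ℝ] (N' → κ → ℝ) := LinearMap.pi fun i =>
    ∑ v, (LinearMap.proj v ∘ₗ LinearMap.proj i.1) ∘ₗ X
  let T := colMap.prod (rowMap.prod (LinearMap.proj (R := ℝ) (φ := fun p : S => perp (φ p.1.2))
    ⟨p₀, hp₀⟩))
  have hperp : ∀ p ∈ S, Module.finrank ℝ (perp (φ p.2)) = D - 1 := by
    intro p hp
    have := finrank_perp (hφ p hp)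
    omega
  have hsrc : Module.finrank ℝ ((p : S) → perp (φ p.1.2)) = S.card * (D - 1) := by
    rw [Module.finrank_pi_fintype, Finset.sum_congr rfl (fun p _ => hperp p.1 p.2)]
    simp
  have htgt : Module.finrank ℝ (((v : S.image Prod.snd) → perp (φ v)) × (N' → κ → ℝ) ×
      perp (φ p₀.2)) = (S.image Prod.snd).card * (D - 1) + (((S.image Prod.fst).card - 1) * D +
      (D - 1)) := by
    rw [Module.finrank_prod, Module.finrank_prod, Module.finrank_pi_fintype,
      Module.finrank_pi_fintype, hperp p₀ hp₀]
    congr 1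
    · rw [Finset.sum_congr rfl (g := fun _ => D - 1)]
      · simp
      · rintro ⟨v, hv⟩ _
        obtain ⟨p, hp, rfl⟩ := Finset.mem_image.1 hv
        exact hperp p hp
    · congr 1
      simp only [Module.finrank_fintype_fun_eq_card, Finset.sum_const, Finset.card_univ,
        Fintype.card_coe, smul_eq_mul, N']
      rw [Finset.card_erase_of_mem (Finset.mem_image_of_mem _ hp₀)]
  have hlt : Module.finrank ℝ (((v : S.image Prod.snd) → perp (φ v)) × (N' → κ → ℝ) ×
      perp (φ p₀.2)) < Module.finrank ℝ ((p : S) → perp (φ p.1.2)) := by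
    rw [hsrc, htgt]
    have hn1 : 1 ≤ (S.image Prod.fst).card :=
      Finset.card_pos.2 ⟨_, Finset.mem_image_of_mem _ hp₀⟩
    obtain ⟨n, hn⟩ := Nat.exists_eq_add_of_le hn1
    obtain ⟨D', hD'⟩ := Nat.exists_eq_add_of_le hD
    rw [hn] at hN ⊢
    rw [hD']
    have e1 : 4 + D' - 1 = 3 + D' := by omega
    have e2 : 1 + n - 1 = n := by omega
    rw [e1, e2]
    have i1 := Nat.mul_le_mul_right (3 + D') hR
    have i2 := Nat.mul_le_mul_right (4 + D') hN
    -- With `s = |S|`, there are at most `s(D-1)/3 + sD/2 - 1` equations for `s(D-1)` unknowns; `D ≥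
    -- 4` makes the former smaller.
    nlinarith [Nat.zero_le (D' * S.card)]
  obtain ⟨a, ha, ha0⟩ := (Submodule.ne_bot_iff _).1 (T.ker_ne_bot_of_finrank_lt hlt)
  have hTa : T a = 0 := ha
  have hcol : ∀ v, ∑ i, X a i v = 0 := by
    intro v
    by_cases hv : v ∈ S.image Prod.snd
    · have h := congrArg (fun z => ((z.1 ⟨v, hv⟩ : perp (φ v)) : κ → ℝ)) hTa
      simpa [T, colMap, LinearMap.sum_apply] using h
    · refine Finset.sum_eq_zero (fun i _ => ?_)
      have : (i, v) ∉ S := fun h => hv (Finset.mem_image_of_mem Prod.snd h)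
      simp [X, extendFamily, this]
  have hrow' : ∀ i, i ≠ p₀.1 → ∑ v, X a i v = 0 := by
    intro i hi
    by_cases hv : i ∈ S.image Prod.fst
    · have h := congrArg (fun z => z.2.1 ⟨i, Finset.mem_erase.2 ⟨hi, hv⟩⟩) hTa
      simpa [T, rowMap, LinearMap.sum_apply] using h
    · refine Finset.sum_eq_zero (fun v _ => ?_)
      have : (i, v) ∉ S := fun h => hv (Finset.mem_image_of_mem Prod.fst h)
      simp [X, extendFamily, this]
  refine ⟨X a, ?_, ⟨?_, fun i v => hX a i v, hcol, ?_⟩, ?_⟩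
  · intro h0
    apply ha0
    funext p
    have := congrFun (congrFun h0 p.1.1) p.1.2
    apply Subtype.ext
    simpa [X, extendFamily] using this
  · intro i v h
    simp only [X, extendFamily, LinearMap.coe_mk, AddHom.coe_mk, h, dite_false]
  · intro i
    by_cases hi : i = p₀.1
    · have htot : ∑ i, ∑ v, X a i v = 0 := by
        rw [Finset.sum_comm]
        exact Finset.sum_eq_zero (fun v _ => hcol v)
      rw [Finset.sum_eq_single i (fun j _ hj => hrow' j (fun h => hj (h.trans hi.symm)))
        (fun h => absurd (Finset.mem_univ i) h)] at htot
      exact htot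
    · exact hrow' i hi
  · have h := congrArg (fun z => (z.2.2 : κ → ℝ)) hTa
    simpa [T, X, extendFamily, hp₀] using h

/-- Under a genericity condition on the rods at which distinct blocks meet, there is no nonzero
flow. -/
theorem IsFlow.eq_zero (hD : 4 ≤ Fintype.card κ) {inc : N → V → Prop} {φ : V → κ → ℝ}
    (hbody : ∀ v i j, φ v = 0 → inc i v → inc j v → i = j)
    (hrod : ∀ v i j, φ v ≠ 0 → i ≠ j → inc i v → inc j v → ∀ q : κ → ℝ, q ≠ 0 →
      ∃ c : N → κ → ℝ, q ⬝ᵥ (c i - c j) ≠ 0 ∧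
        ∀ w, w ≠ v → ∀ l l', inc l w → inc l' w → ∃ a : ℝ, c l - c l' = a • φ w)
    {y : N → V → κ → ℝ} (hy : IsFlow inc φ y) : y = 0 := by
  classical
  let supp : (N → V → κ → ℝ) → Finset (N × V) := fun y => univ.filter (fun p => y p.1 p.2 ≠ 0)
  have hsupp : ∀ y p, p ∈ supp y ↔ y p.1 p.2 ≠ 0 := fun y p => by simp [supp]
  -- Induction on the size of the support: a nonzero flow will produce a smaller nonzero one.
  induction hn : (supp y).card using Nat.strong_induction_on generalizing y with
  | _ n ih =>
  by_contra hy0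
  have hinc : ∀ i v, y i v ≠ 0 → inc i v := fun i v h => by
    by_contra hc
    exact h (hy.supp i v hc)
  have hcard : ∀ v, ((supp y).filter (fun p => p.2 = v)).card =
      (univ.filter (fun i => y i v ≠ 0)).card := by
    intro v
    refine (Finset.card_bij (fun i _ => (i, v)) ?_ ?_ ?_).symm
    · intro i hi
      simpa [supp] using hi
    · intro i _ j _ h
      exact congrArg Prod.fst h
    · rintro ⟨i, w⟩ hp
      simp only [mem_filter, hsupp] at hp
      obtain ⟨h1, rfl⟩ := hp
      exact ⟨i, by simpa using h1, rfl⟩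
  have hcard' : ∀ i, ((supp y).filter (fun p => p.1 = i)).card =
      (univ.filter (fun v => y i v ≠ 0)).card := by
    intro i
    refine (Finset.card_bij (fun v _ => (i, v)) ?_ ?_ ?_).symm
    · intro v hv
      simpa [supp] using hv
    · intro v _ w _ h
      exact congrArg Prod.snd h
    · rintro ⟨j, w⟩ hp
      simp only [mem_filter, hsupp] at hp
      obtain ⟨h1, rfl⟩ := hp
      exact ⟨w, by simpa using h1, rfl⟩
  have hne : (supp y).Nonempty := by
    by_contra h
    rw [Finset.not_nonempty_iff_eq_empty] at h
    refine hy0 (funext fun i => funext fun v => ?_)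
    by_contra h'
    have : (i, v) ∈ supp y := (hsupp y (i, v)).2 h'
    rw [h] at this
    simp at this
  obtain ⟨p₀, hp₀⟩ := hne
  -- At a body only one block is incident, so the column sum is its single entry, which must vanish.
  have hφ : ∀ p ∈ supp y, φ p.2 ≠ 0 := by
    rintro ⟨i, v⟩ hp h0
    have hp' := (hsupp _ _).1 hp
    have := hy.col v
    rw [Finset.sum_eq_single i (fun j _ hj => by
      by_contra h
      exact hj (hbody v j i h0 (hinc j v h) (hinc i v hp')))
      (fun h => absurd (Finset.mem_univ i) h)] at this
    exact hp' this
  have h3 : ∀ v ∈ (supp y).image Prod.snd, 3 ≤ ((supp y).filter (fun p => p.2 = v)).card := by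
    intro v hv
    obtain ⟨⟨i₀, v'⟩, hp, rfl⟩ := Finset.mem_image.1 hv
    have h2 : 2 ≤ (univ.filter (fun i => y i v' ≠ 0)).card :=
      two_le_card_of_sum_eq_zero (hy.col v') ((hsupp _ _).1 hp)
    change 3 ≤ ((supp y).filter (fun p => p.2 = v')).card
    rw [hcard]
    -- With exactly two nonzero entries `q` and `-q` at the rod, virtual work gives `q ⬝ᵥ (c i - c
    -- j) = 0` for every admissible `c`, against `hrod`.
    by_contra hlt
    obtain ⟨i, j, hij, hS⟩ := Finset.card_eq_two.1
      (show (univ.filter (fun i => y i v' ≠ 0)).card = 2 by omega)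
    have hi : y i v' ≠ 0 := by
      have : i ∈ univ.filter (fun i => y i v' ≠ 0) := by rw [hS]; simp
      simpa using this
    have hj : y j v' ≠ 0 := by
      have : j ∈ univ.filter (fun i => y i v' ≠ 0) := by rw [hS]; simp
      simpa using this
    have hzero : ∀ l, l ≠ i → l ≠ j → y l v' = 0 := by
      intro l hli hlj
      by_contra h
      have : l ∈ univ.filter (fun i => y i v' ≠ 0) := by simpa using h
      rw [hS] at this
      simp [hli, hlj] at this
    obtain ⟨c, hc1, hc2⟩ := hrod v' i j (hφ _ hp) hij (hinc _ _ hi) (hinc _ _ hj) (y i v') hi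
    have hsum := hy.dotProduct_vertex hc2
    have hcol := hy.col v'
    rw [Finset.sum_eq_add i j hij (fun l _ hl => hzero l hl.1 hl.2) (by simp) (by simp)] at hcol
    rw [Finset.sum_eq_add i j hij (fun l _ hl => by rw [hzero l hl.1 hl.2, zero_dotProduct])
      (by simp) (by simp), eq_neg_of_add_eq_zero_right hcol, neg_dotProduct,
      ← sub_eq_add_neg, ← dotProduct_sub] at hsum
    exact hc1 hsum
  have h2 : ∀ i ∈ (supp y).image Prod.fst, 2 ≤ ((supp y).filter (fun p => p.1 = i)).card := by
    intro i hi
    obtain ⟨⟨i', v'⟩, hp, rfl⟩ := Finset.mem_image.1 hi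
    rw [hcard']
    exact two_le_card_of_sum_eq_zero (hy.row i') ((hsupp _ _).1 hp)
  -- The new flow lives on the support of `y` and vanishes at `p₀`, so its support is strictly
  -- smaller.
  obtain ⟨z, hz0, hz, hzp⟩ := exists_flow_of_card hD φ (supp y) hφ hp₀ h3 h2
  have hzy : IsFlow inc φ z := ⟨fun i v h => hz.supp i v (fun h' => h (hinc i v
    ((hsupp _ _).1 h'))), hz.orth, hz.col, hz.row⟩
  have hss : supp z ⊂ supp y := by
    refine (Finset.ssubset_iff_of_subset ?_).2 ⟨p₀, hp₀, fun h => (hsupp _ _).1 h hzp⟩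
    intro p hp
    by_contra h
    exact (hsupp _ _).1 hp (hz.supp p.1 p.2 h)
  exact hz0 (ih _ (hn ▸ Finset.card_lt_card hss) hzy rfl)

end Flow

/-! ### A lower bound for the rank of the edge space -/

section Rank

variable {κ N V E : Type*} [Fintype κ] [Fintype V]

/-- If an incidence structure has no nonzero flow, then the dimensions of the spaces of balanced
families in its blocks add up. -/
theorem sum_finrank_perp_le [Fintype N] {inc : N → V → Prop} {φ : V → κ → ℝ}
    (hflow : ∀ y : N → V → κ → ℝ, IsFlow inc φ y → y = 0) (S : Submodule ℝ (V → κ → ℝ))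
    (hS : ∀ i (z : V → κ → ℝ), (∀ v, ¬ inc i v → z v = 0) → (∀ v, z v ⬝ᵥ φ v = 0) →
      ∑ v, z v = 0 → z ∈ S) [∀ i, DecidablePred (inc i)] :
    ∑ i, ∑ v with inc i v, Module.finrank ℝ (perp (φ v)) ≤
      Module.finrank ℝ S + Fintype.card N * Fintype.card κ := by
  classical
  let I : Finset (N × V) := univ.filter (fun p => inc p.1 p.2)
  have hI : ∀ i v, (i, v) ∈ I ↔ inc i v := fun i v => by simp [I]
  let X := extendFamily I φ
  have hX : ∀ a i v, X a i v ∈ perp (φ v) := extendFamily_orth I φ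
  have hX0 : ∀ a i v, ¬ inc i v → X a i v = 0 := fun a i v h => by
    have : (i, v) ∉ I := fun h' => h ((hI i v).1 h')
    simp [X, extendFamily, this]
  let row : ((p : I) → perp (φ p.1.2)) →ₗ[ℝ] (N → κ → ℝ) := LinearMap.pi fun i =>
    ∑ v, (LinearMap.proj v ∘ₗ LinearMap.proj i) ∘ₗ X
  have hrow : ∀ a i, row a i = ∑ v, X a i v := fun a i => by
    simp [row, LinearMap.sum_apply]
  let col : ((p : I) → perp (φ p.1.2)) →ₗ[ℝ] (V → κ → ℝ) :=
    ∑ i, (LinearMap.proj i) ∘ₗ X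
  have hcol : ∀ a v, col a v = ∑ i, X a i v := fun a v => by
    simp [col, LinearMap.sum_apply]
  have hker : ∀ a ∈ LinearMap.ker row, col a ∈ S := by
    intro a ha
    have : col a = ∑ i, X a i := by simp [col, LinearMap.sum_apply]
    rw [this]
    refine Submodule.sum_mem _ (fun i _ => hS i _ (fun v => hX0 a i v) (fun v => hX a i v) ?_)
    rw [← hrow, LinearMap.mem_ker.1 ha]
    rfl
  let f : LinearMap.ker row →ₗ[ℝ] S :=
    LinearMap.codRestrict S (col.domRestrict _) (fun a => hker a a.2)
  -- A family whose row and column sums all vanish is a flow, hence zero.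
  have hf : Function.Injective f := by
    rintro ⟨a, ha⟩ ⟨b, hb⟩ h0
    have hab : row (a - b) = 0 := by
      rw [map_sub, LinearMap.mem_ker.1 ha, LinearMap.mem_ker.1 hb, sub_zero]
    have hc : col (a - b) = 0 := by
      rw [map_sub]
      exact sub_eq_zero.2 (congrArg Subtype.val h0)
    have hXa : X (a - b) = 0 := hflow _ ⟨fun i v => hX0 _ i v, fun i v => hX _ i v,
      fun v => by rw [← hcol, hc]; rfl, fun i => by rw [← hrow, hab]; rfl⟩
    apply Subtype.ext
    change a = b
    rw [← sub_eq_zero]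
    funext p
    have := congrFun (congrFun hXa p.1.1) p.1.2
    apply Subtype.ext
    simpa [X, extendFamily] using this
  have h1 := LinearMap.finrank_le_finrank_of_injective hf
  have h2 := row.finrank_range_add_finrank_ker
  have h3 : Module.finrank ℝ (LinearMap.range row) ≤ Fintype.card N * Fintype.card κ := by
    refine (Submodule.finrank_le _).trans (le_of_eq ?_)
    rw [Module.finrank_pi_fintype]
    simp
  have h4 : Module.finrank ℝ ((p : I) → perp (φ p.1.2)) =
      ∑ i, ∑ v with inc i v, Module.finrank ℝ (perp (φ v)) := by
    rw [Module.finrank_pi_fintype, Finset.univ_eq_attach,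
      Finset.sum_attach I (fun p => Module.finrank ℝ (perp (φ p.2))), Finset.sum_filter,
      Fintype.sum_prod_type]
    exact Finset.sum_congr rfl (fun i _ => by rw [Finset.sum_filter])
  omega

/-! ### Edges as rigid bodies hinged at their ends. -/

variable (t h : E → V)

/-- The vertices of an edge set, for edges with given ends. -/
def endSet (F : Set E) : Set V := {v | ∃ e ∈ F, v = t e ∨ v = h e}

/-- The motions of the edges of `F`, regarded as rigid bodies any two of which may only rotate
about `φ v` relative to each other when they share the vertex `v`. -/
def edgeMotions (F : Set E) (φ : V → κ → ℝ) : Submodule ℝ (E → κ → ℝ) where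
  carrier := {c | ∀ v, ∀ e ∈ F, ∀ e' ∈ F, (v = t e ∨ v = h e) → (v = t e' ∨ v = h e') →
    ∃ a : ℝ, c e - c e' = a • φ v}
  add_mem' := by
    intro c c' hc hc' v e he e' he' hv hv'
    obtain ⟨a, ha⟩ := hc v e he e' he' hv hv'
    obtain ⟨a', ha'⟩ := hc' v e he e' he' hv hv'
    refine ⟨a + a', ?_⟩
    rw [add_smul, ← ha, ← ha', Pi.add_apply, Pi.add_apply]
    abel
  zero_mem' := fun v e _ e' _ _ _ => ⟨0, by simp⟩
  smul_mem' := by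
    intro x c hc v e he e' he' hv hv'
    obtain ⟨a, ha⟩ := hc v e he e' he' hv hv'
    exact ⟨x * a, by rw [mul_smul, ← ha, Pi.smul_apply, Pi.smul_apply, smul_sub]⟩

/-- Two edges move together in all motions. -/
def MoveTogether (F : Set E) (φ : V → κ → ℝ) (e e' : E) : Prop :=
  ∀ c ∈ edgeMotions t h F φ, c e = c e'

/-- Edges that share a rod and do not move together can be separated in any prescribed direction
after a change of that rod. -/
def RodsGeneric (F : Set E) (φ : V → κ → ℝ) : Prop :=
  ∀ v, φ v ≠ 0 → ∀ e ∈ F, ∀ e' ∈ F, (v = t e ∨ v = h e) → (v = t e' ∨ v = h e') →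
    ¬ MoveTogether t h F φ e e' → ∀ q : κ → ℝ, q ≠ 0 → ∃ c : E → κ → ℝ,
      q ⬝ᵥ (c e - c e') ≠ 0 ∧
      (∀ f ∈ F, ∀ f' ∈ F, MoveTogether t h F φ f f' → c f = c f') ∧
      ∀ w, w ≠ v → ∀ f ∈ F, ∀ f' ∈ F, (w = t f ∨ w = h f) → (w = t f' ∨ w = h f') →
        ∃ a : ℝ, c f - c f' = a • φ w

/-- A functional on a space of families of coordinate vectors is given by dot products. -/
theorem exists_dotProduct_eq (f : (V → κ → ℝ) →ₗ[ℝ] ℝ) :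
    ∃ m : V → κ → ℝ, ∀ x, f x = ∑ v, x v ⬝ᵥ m v := by
  classical
  refine ⟨fun v s => f (Pi.single v (Pi.single s 1)), fun x => ?_⟩
  have hx : x = ∑ v, ∑ s, x v s • Pi.single v (Pi.single s (1 : ℝ)) := by
    funext v s
    simp only [Finset.sum_apply, Pi.smul_apply, Pi.single_apply, smul_eq_mul]
    rw [Finset.sum_eq_single v, Finset.sum_eq_single s]
    · simp
    · intro s' _ hs'
      simp [Ne.symm hs']
    · simp
    · intro w _ hw
      refine Finset.sum_eq_zero (fun s' _ => ?_)
      simp [Ne.symm hw]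
    · simp
  conv_lhs => rw [hx]
  simp only [map_sum, map_smul, smul_eq_mul, dotProduct]

/-- The rank of the edge space of a sparse edge set, for rods in generic position. -/
theorem card_le_finrank_of_rodsGeneric [Finite E] (hD : 4 ≤ Fintype.card κ) (F : Set E)
    (φ : V → κ → ℝ) (S : Submodule ℝ (V → κ → ℝ))
    (hS : ∀ m : V → κ → ℝ, (∀ x ∈ S, ∑ v, x v ⬝ᵥ m v = 0) → ∀ e ∈ F,
      ∃ a b : ℝ, m (t e) - m (h e) = a • φ (t e) + b • φ (h e))
    (hgen : RodsGeneric t h F φ)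
    (hsparse : ∀ F' ⊆ F, F'.Nonempty → F'.ncard + Fintype.card κ +
      (endSet t h F' ∩ {v | φ v ≠ 0}).ncard ≤ Fintype.card κ * (endSet t h F').ncard) :
    F.ncard ≤ Module.finrank ℝ S := by
  classical
  have := Fintype.ofFinite E
  -- The blocks are the classes of edges that move together in every motion.
  let s : Setoid F := ⟨fun e e' => MoveTogether t h F φ e e', fun _ _ _ => rfl,
    fun h c hc => (h c hc).symm, fun h h' c hc => (h c hc).trans (h' c hc)⟩
  let N := Quotient s
  have : Fintype N := Fintype.ofFinite N
  let inc : N → V → Prop := fun i v => ∃ e : F, (⟦e⟧ : N) = i ∧ (v = t e ∨ v = h e)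
  have hcl : ∀ e e' : F, (⟦e⟧ : N) = ⟦e'⟧ ↔ MoveTogether t h F φ e e' := fun e e' => Quotient.eq
  have hflow : ∀ y : N → V → κ → ℝ, IsFlow inc φ y → y = 0 := by
    intro y hy
    refine hy.eq_zero hD ?_ ?_
    · rintro v i j hv ⟨e, rfl, he⟩ ⟨e', rfl, he'⟩
      rw [hcl]
      intro c hc
      obtain ⟨a, ha⟩ := hc v e e.2 e' e'.2 he he'
      rw [hv, smul_zero, sub_eq_zero] at ha
      exact ha
    · rintro v i j hv hij ⟨e, rfl, he⟩ ⟨e', rfl, he'⟩ q hq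
      obtain ⟨c, hc1, hc2, hc3⟩ := hgen v hv e e.2 e' e'.2 he he'
        (fun hm => hij ((hcl e e').2 hm)) q hq
      -- The separating motion is constant on blocks, so evaluating it at a representative gives a
      -- well-defined motion of blocks.
      have hout : ∀ f : F, c (Quotient.mk s f).out = c f := fun f =>
        hc2 _ (Quotient.mk s f).out.2 _ f.2 ((hcl _ _).1 (Quotient.out_eq (Quotient.mk s f)))
      refine ⟨fun i : Quotient s => c i.out, ?_, ?_⟩
      · simp only [hout]
        exact hc1
      · rintro w hw _ _ ⟨f, rfl, hf⟩ ⟨f', rfl, hf'⟩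
        simp only [hout]
        exact hc3 w hw f f.2 f' f'.2 hf hf'
  have hmem : ∀ i (z : V → κ → ℝ), (∀ v, ¬ inc i v → z v = 0) → (∀ v, z v ⬝ᵥ φ v = 0) →
      ∑ v, z v = 0 → z ∈ S := by
    intro i z hz1 hz2 hz3
    by_contra hzS
    -- If `z` were outside `S`, a functional vanishing on `S` but not at `z` would be given by a
    -- motion `m` of the vertices.
    obtain ⟨f, hfz, hfS⟩ := Submodule.exists_le_ker_of_notMem hzS
    obtain ⟨m, hm⟩ := exists_dotProduct_eq f
    have hmS := hS m (fun x hx => by rw [← hm]; exact hfS hx)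
    choose! a b hab using hmS
    -- By `hab` this also equals `m (h e) + b e • φ (h e)`: a single motion of `e` that differs from
    -- `m` at each end by a multiple of the rod form there.
    let c : E → κ → ℝ := fun e => m (t e) - a e • φ (t e)
    have hct : ∀ e ∈ F, ∀ v, (v = t e ∨ v = h e) → ∃ x : ℝ, m v = c e + x • φ v := by
      rintro e he v (rfl | rfl)
      · exact ⟨a e, by simp [c]⟩
      · refine ⟨- b e, ?_⟩
        have := hab e he
        simp only [c]
        rw [sub_eq_iff_eq_add.1 this]
        module
    have hc : c ∈ edgeMotions t h F φ := by
      intro v e he e' he' hv hv'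
      obtain ⟨x, hx⟩ := hct e he v hv
      obtain ⟨x', hx'⟩ := hct e' he' v hv'
      refine ⟨x' - x, ?_⟩
      rw [hx] at hx'
      rw [sub_smul, sub_eq_sub_iff_add_eq_add, hx', add_comm]
    obtain ⟨e₀, rfl⟩ := Quotient.exists_rep i
    apply hfz
    rw [hm]
    -- On the block all `c e` equal `c e₀`, and the rod multiples are orthogonal to `z`; then `∑ v,
    -- z v = 0` kills the pairing.
    have : ∀ v, z v ⬝ᵥ m v = z v ⬝ᵥ c e₀ := by
      intro v
      by_cases hv : inc ⟦e₀⟧ v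
      · obtain ⟨e, he, hev⟩ := hv
        obtain ⟨x, hx⟩ := hct e e.2 v hev
        rw [hx, (hcl e e₀).1 he c hc, dotProduct_add, dotProduct_smul, hz2, smul_zero, add_zero]
      · rw [hz1 v hv, zero_dotProduct, zero_dotProduct]
    rw [Finset.sum_congr rfl (fun v _ => this v), ← sum_dotProduct, hz3, zero_dotProduct]
  have hmain := sum_finrank_perp_le hflow S hmem
  let P : N → Set E := fun i => {e | ∃ he : e ∈ F, (⟦⟨e, he⟩⟧ : N) = i}
  have hends : ∀ i, endSet t h (P i) = {v | inc i v} := by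
    intro i
    ext v
    constructor
    · rintro ⟨e, ⟨he, hi⟩, hv⟩
      exact ⟨⟨e, he⟩, hi, hv⟩
    · rintro ⟨e, hi, hv⟩
      exact ⟨e, ⟨e.2, hi⟩, hv⟩
  have hblock : ∀ i, (P i).ncard + Fintype.card κ ≤
      ∑ v with inc i v, Module.finrank ℝ (perp (φ v)) := by
    intro i
    have hne : (P i).Nonempty := by
      obtain ⟨e, rfl⟩ := Quotient.exists_rep i
      exact ⟨e, e.2, rfl⟩
    have h1 := hsparse (P i) (fun e he => he.1) hne
    rw [hends] at h1
    have h2 : ∑ v with inc i v, (Module.finrank ℝ (perp (φ v)) + if φ v ≠ 0 then 1 else 0) =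
        ∑ v with inc i v, Fintype.card κ := by
      refine Finset.sum_congr rfl (fun v _ => ?_)
      by_cases hv : φ v = 0
      · rw [hv, finrank_perp_zero]
        simp
      · rw [if_pos hv, finrank_perp hv]
    rw [Finset.sum_add_distrib, Finset.sum_const, ← Finset.card_filter, Finset.filter_filter,
      smul_eq_mul] at h2
    have h3 : ({v | inc i v} ∩ {v | φ v ≠ 0} : Set V).ncard =
        (univ.filter (fun v => inc i v ∧ φ v ≠ 0)).card := by
      rw [← Set.ncard_coe_finset]
      congr 1
      ext v
      simp
    have h4 : ({v | inc i v} : Set V).ncard = (univ.filter (fun v => inc i v)).card := by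
      rw [← Set.ncard_coe_finset]
      congr 1
      ext v
      simp
    rw [h3, h4, mul_comm (Fintype.card κ)] at h1
    omega
  have hcard : F.ncard = ∑ i, (P i).ncard := by
    rw [← Nat.card_coe_set_eq, Nat.card_eq_fintype_card, ← Finset.card_univ,
      Finset.card_eq_sum_card_fiberwise (f := fun e : F => (⟦e⟧ : N)) (t := univ) (by simp)]
    refine Finset.sum_congr rfl (fun i _ => ?_)
    rw [← Set.ncard_coe_finset, ← Set.ncard_image_of_injective _ Subtype.val_injective]
    congr 1
    ext e
    simp [P]
  have hsum := Finset.sum_le_sum (fun i (_ : i ∈ univ) => hblock i)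
  rw [Finset.sum_add_distrib, ← hcard, Finset.sum_const, Finset.card_univ, smul_eq_mul] at hsum
  omega

end Rank

/-! ### Independent representatives -/

section Rado

variable {E M : Type*} [AddCommGroup M] [Module ℝ M] [FiniteDimensional ℝ M]

/-- Rado's condition relative to a base space `N`, which grows in the induction. If a proper
nonempty `F` attains equality, its representatives are chosen first and the remaining elements are
treated modulo their span. Otherwise every proper nonempty subset has slack one, so any `x ∈ Z e`
outside `N` may be added to `N`. -/
theorem exists_representatives_sup [DecidableEq E] (Z : E → Set M) (I : Finset E)
    (N : Submodule ℝ M)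
    (h : ∀ F ⊆ I, F.card + Module.finrank ℝ N ≤
      Module.finrank ℝ (N ⊔ Submodule.span ℝ (⋃ e ∈ F, Z e) : Submodule ℝ M)) :
    ∃ z : E → M, (∀ e ∈ I, z e ∈ Z e) ∧ I.card + Module.finrank ℝ N ≤
      Module.finrank ℝ (N ⊔ Submodule.span ℝ (z '' I) : Submodule ℝ M) := by
  induction hn : I.card using Nat.strong_induction_on generalizing I N with
  | _ n ih =>
  subst hn
  rcases I.eq_empty_or_nonempty with rfl | ⟨e, he⟩
  · exact ⟨fun _ => 0, by simp, by
      rw [Finset.card_empty, zero_add]; exact Submodule.finrank_mono le_sup_left⟩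
  by_cases htight : ∃ F ⊂ I, F.Nonempty ∧
      Module.finrank ℝ (N ⊔ Submodule.span ℝ (⋃ e ∈ F, Z e) : Submodule ℝ M) ≤
        F.card + Module.finrank ℝ N
  · obtain ⟨F, hFI, hF, hFt⟩ := htight
    obtain ⟨z₁, hz₁, hr₁⟩ := ih F.card (Finset.card_lt_card hFI) F N
      (fun F' hF' => h F' (hF'.trans hFI.1)) rfl
    have hsub : Submodule.span ℝ (z₁ '' F) ≤ Submodule.span ℝ (⋃ e ∈ F, Z e) := by
      refine Submodule.span_mono ?_
      rintro _ ⟨e, he, rfl⟩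
      exact Set.mem_biUnion he (hz₁ e he)
    -- Tightness makes the representatives of `F` span everything that `F` can span modulo `N`, so
    -- the condition passes to `I \ F`.
    have heq : N ⊔ Submodule.span ℝ (z₁ '' F) = N ⊔ Submodule.span ℝ (⋃ e ∈ F, Z e) :=
      Submodule.eq_of_le_of_finrank_le (sup_le_sup_left hsub N) (hFt.trans hr₁)
    have hcard : (I \ F).card + F.card = I.card := Finset.card_sdiff_add_card_eq_card hFI.1
    have hFpos := Finset.card_pos.2 hF
    obtain ⟨z₂, hz₂, hr₂⟩ := ih (I \ F).card (by omega) (I \ F)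
      (N ⊔ Submodule.span ℝ (z₁ '' F)) (by
        intro F' hF'
        have hdis : Disjoint F F' := by
          rw [Finset.disjoint_left]
          intro a ha ha'
          exact (Finset.mem_sdiff.1 (hF' ha')).2 ha
        have h1 := h (F ∪ F') (Finset.union_subset hFI.1 (hF'.trans Finset.sdiff_subset))
        rw [Finset.card_union_of_disjoint hdis, Finset.set_biUnion_union, Submodule.span_union,
          ← sup_assoc] at h1
        rw [heq]
        omega) rfl
    refine ⟨fun e => if e ∈ F then z₁ e else z₂ e, ?_, ?_⟩
    · intro e he
      by_cases heF : e ∈ F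
      · simp only [heF, if_true]
        exact hz₁ e heF
      · simp only [heF, if_false]
        exact hz₂ e (Finset.mem_sdiff.2 ⟨he, heF⟩)
    · have himg : (fun e => if e ∈ F then z₁ e else z₂ e) '' I =
          z₁ '' F ∪ z₂ '' ((I \ F : Finset E) : Set E) := by
        rw [← Finset.union_sdiff_of_subset hFI.1, Finset.coe_union, Set.image_union]
        congr 1
        · exact Set.image_congr (fun e he => if_pos he)
        · rw [Finset.union_sdiff_of_subset hFI.1]
          exact Set.image_congr (fun e he => if_neg (Finset.mem_sdiff.1 he).2)
      rw [himg, Submodule.span_union, ← sup_assoc]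
      omega
  · push Not at htight
    have h1 := h {e} (Finset.singleton_subset_iff.2 he)
    obtain ⟨x, hx, hxN⟩ : ∃ x ∈ Z e, x ∉ N := by
      by_contra! hc
      rw [Finset.set_biUnion_singleton, sup_eq_left.2 (Submodule.span_le.2 hc),
        Finset.card_singleton] at h1
      omega
    have hlt : Module.finrank ℝ N < Module.finrank ℝ (N ⊔ Submodule.span ℝ {x} : Submodule ℝ M) :=
      Submodule.finrank_lt_finrank_of_lt (lt_of_le_of_ne le_sup_left (fun heq =>
        hxN (heq ▸ Submodule.mem_sup_right (Submodule.mem_span_singleton_self x))))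
    have hle : Module.finrank ℝ (N ⊔ Submodule.span ℝ {x} : Submodule ℝ M) ≤
        Module.finrank ℝ N + 1 := by
      refine (Submodule.finrank_add_le_finrank_add_finrank _ _).trans ?_
      have := finrank_span_le_card (R := ℝ) ({x} : Set M)
      simp only [Set.toFinset_singleton, Finset.card_singleton] at this
      omega
    have hcard := Finset.card_erase_add_one he
    obtain ⟨z, hz, hr⟩ := ih (I.erase e).card (by omega) (I.erase e)
      (N ⊔ Submodule.span ℝ {x}) (by
        intro F hF
        rcases F.eq_empty_or_nonempty with rfl | hFne
        · rw [Finset.card_empty, zero_add]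
          exact Submodule.finrank_mono le_sup_left
        have h2 := htight F (lt_of_le_of_lt hF (Finset.erase_ssubset he)) hFne
        have h3 : Module.finrank ℝ (N ⊔ Submodule.span ℝ (⋃ e ∈ F, Z e) : Submodule ℝ M) ≤
            Module.finrank ℝ (N ⊔ Submodule.span ℝ {x} ⊔ Submodule.span ℝ (⋃ e ∈ F, Z e) :
              Submodule ℝ M) :=
          Submodule.finrank_mono (sup_le_sup_right le_sup_left _)
        omega) rfl
    refine ⟨Function.update z e x, ?_, ?_⟩
    · intro e' he'
      by_cases h' : e' = e
      · subst h'
        simpa using hx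
      · rw [Function.update_of_ne h']
        exact hz e' (Finset.mem_erase.2 ⟨h', he'⟩)
    · have himg : Function.update z e x '' I = {x} ∪ z '' ((I.erase e : Finset E) : Set E) := by
        rw [← Finset.insert_erase he, Finset.coe_insert, Set.image_insert_eq,
          Function.update_self, Set.insert_eq, Finset.erase_insert_eq_erase, Finset.erase_idem]
        congr 1
        exact Set.image_congr (fun e' he' => Function.update_of_ne
          (Finset.ne_of_mem_erase (Finset.mem_coe.1 he')) _ _)
      rw [himg, Submodule.span_union, ← sup_assoc]
      omega

/-- Rado's theorem for spanned subspaces: a family of sets of vectors has linearly independent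
representatives when each subfamily spans a space of at least its own size. -/
theorem exists_linearIndepOn_of_card_le_finrank [Finite E] (Z : E → Set M) (I : Set E)
    (h : ∀ F ⊆ I, F.ncard ≤ Module.finrank ℝ (Submodule.span ℝ (⋃ e ∈ F, Z e))) :
    ∃ z : E → M, (∀ e ∈ I, z e ∈ Z e) ∧ LinearIndepOn ℝ z I := by
  classical
  obtain ⟨z, hz, hr⟩ := exists_representatives_sup Z (Set.toFinite I).toFinset ⊥ (by
    intro F hF
    have h1 := h F (fun e he => (Set.Finite.mem_toFinset _).1 (hF he))
    rw [Set.ncard_coe_finset] at h1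
    rw [finrank_bot, add_zero, bot_sup_eq]
    exact h1)
  refine ⟨z, fun e he => hz e ((Set.Finite.mem_toFinset _).2 he), ?_⟩
  have : Fintype I := Fintype.ofFinite I
  rw [bot_sup_eq, finrank_bot, add_zero, Set.Finite.coe_toFinset,
    ← Set.ncard_eq_toFinset_card] at hr
  rw [LinearIndepOn, linearIndependent_iff_card_le_finrank_span, Set.finrank, ← Set.image_eq_range,
    ← Nat.card_eq_fintype_card, Nat.card_coe_set_eq]
  exact hr

end Rado

/-! ### Rods in generic position -/

section Generic

open Topology

/-- Rank is lower semicontinuous on continuous linear maps, and the kernel dimension is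
complementary to it. -/
theorem eventually_finrank_ker_le {P A B : Type*} [TopologicalSpace P]
    [NormedAddCommGroup A] [NormedSpace ℝ A] [FiniteDimensional ℝ A]
    [NormedAddCommGroup B] [NormedSpace ℝ B] [FiniteDimensional ℝ B]
    (L : P → A →ₗ[ℝ] B) (hL : ∀ a, Continuous fun p => L p a) (p : P) :
    ∀ᶠ p' in 𝓝 p, Module.finrank ℝ (LinearMap.ker (L p')) ≤
      Module.finrank ℝ (LinearMap.ker (L p)) := by
  have hc : Continuous fun p => LinearMap.toContinuousLinearMap (L p) :=
    continuous_clm_apply.2 hL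
  have ho := (isOpen_setOfPred_nat_le_rank (𝕜 := ℝ) (E := A) (F := B)
    (Module.finrank ℝ (LinearMap.range (L p)))).preimage hc
  have hmem : p ∈ (fun p => LinearMap.toContinuousLinearMap (L p)) ⁻¹'
      {f : A →L[ℝ] B | (Module.finrank ℝ (LinearMap.range (L p)) : Cardinal) ≤
        (f : A →ₗ[ℝ] B).rank} := by
    exact (Module.finrank_eq_rank ℝ (LinearMap.range (L p))).le
  filter_upwards [ho.mem_nhds hmem] with p' hp'
  have h1 : Module.finrank ℝ (LinearMap.range (L p)) ≤
      Module.finrank ℝ (LinearMap.range (L p')) := by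
    have h2 : (Module.finrank ℝ (LinearMap.range (L p)) : Cardinal) ≤ (L p').rank := hp'
    rw [LinearMap.rank, ← Module.finrank_eq_rank] at h2
    exact_mod_cast h2
  have h3 := (L p).finrank_range_add_finrank_ker
  have h4 := (L p').finrank_range_add_finrank_ker
  omega

/-- Finitely many upper semicontinuous natural-valued functions are locally constant somewhere in
each nonempty open set. -/
theorem exists_eventually_eq {P J : Type*} [TopologicalSpace P] [Finite J] {O : Set P}
    (hO : IsOpen O) (hne : O.Nonempty) (d : J → P → ℕ)
    (hd : ∀ j, ∀ p ∈ O, ∀ᶠ p' in 𝓝 p, d j p' ≤ d j p) :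
    ∃ p ∈ O, ∀ᶠ p' in 𝓝 p, p' ∈ O ∧ ∀ j, d j p' = d j p := by
  have := Fintype.ofFinite J
  let s : P → ℕ := fun p => ∑ j, d j p
  obtain ⟨p, hp, hmin⟩ : ∃ p ∈ O, ∀ p' ∈ O, s p ≤ s p' :=
    ⟨Function.argminOn s O hne, Function.argminOn_mem s O hne,
      fun p' hp' => Function.argminOn_le s O hp'⟩
  refine ⟨p, hp, ?_⟩
  filter_upwards [hO.mem_nhds hp, Filter.eventually_all.2 (fun j => hd j p hp)] with p' hp' hle
  refine ⟨hp', fun j => ?_⟩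
  have h1 := hmin p' hp'
  exact ((Finset.sum_eq_sum_iff_of_le (fun j _ => hle j)).1
    (le_antisymm (Finset.sum_le_sum fun j _ => hle j) h1)) j (Finset.mem_univ j)

variable {κ V E : Type*} (t h : E → V)

/-- The motions for which two given edges move together. -/
def jointMotions (F : Set E) (φ : V → κ → ℝ) (e e' : E) : Submodule ℝ (E → κ → ℝ) :=
  edgeMotions t h F φ ⊓ LinearMap.ker
    (LinearMap.proj (R := ℝ) (φ := fun _ : E => κ → ℝ) e - LinearMap.proj e')

theorem mem_jointMotions {F : Set E} {φ : V → κ → ℝ} {e e' : E} {c : E → κ → ℝ} :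
    c ∈ jointMotions t h F φ e e' ↔ c ∈ edgeMotions t h F φ ∧ c e = c e' := by
  simp [jointMotions, sub_eq_zero]

/-- The `2 × 2` minors remove the unknown multiplier, so that the equations of a motion depend
continuously on the rods. -/
theorem exists_smul_eq_iff {φ x : κ → ℝ} (hφ : φ ≠ 0) :
    (∃ a : ℝ, x = a • φ) ↔ ∀ s s', φ s * x s' - φ s' * x s = 0 := by
  constructor
  · rintro ⟨a, rfl⟩ s s'
    simp only [Pi.smul_apply, smul_eq_mul]
    ring
  · intro hx
    obtain ⟨s, hs⟩ := Function.ne_iff.1 hφ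
    refine ⟨x s / φ s, funext fun s' => ?_⟩
    have := hx s s'
    have hs' : φ s ≠ 0 := hs
    rw [Pi.smul_apply, smul_eq_mul]
    field_simp
    linarith

open Classical in
/-- The equations that define the motions with two given edges moving together. -/
noncomputable def motionEquations (R : Set V) (F : Set E) (φ : V → κ → ℝ) (e₀ e₁ : E) :
    (E → κ → ℝ) →ₗ[ℝ] ((V × E × E → κ × κ → ℝ) × (κ → ℝ)) where
  toFun c := (fun p s => if p.2.1 ∈ F ∧ p.2.2 ∈ F ∧ (p.1 = t p.2.1 ∨ p.1 = h p.2.1) ∧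
      (p.1 = t p.2.2 ∨ p.1 = h p.2.2) then
    (if p.1 ∈ R then φ p.1 s.1 * (c p.2.1 s.2 - c p.2.2 s.2) -
      φ p.1 s.2 * (c p.2.1 s.1 - c p.2.2 s.1) else c p.2.1 s.1 - c p.2.2 s.1) else 0,
    c e₀ - c e₁)
  map_add' c c' := by
    ext p s
    · simp only [Pi.add_apply, Prod.mk_add_mk]
      split_ifs <;> ring
    · simp only [Pi.add_apply, Prod.mk_add_mk, Pi.sub_apply]
      ring
  map_smul' x c := by
    ext p s
    · simp only [Pi.smul_apply, Prod.smul_mk, RingHom.id_apply, smul_eq_mul]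
      split_ifs <;> ring
    · simp only [Pi.smul_apply, Prod.smul_mk, RingHom.id_apply, smul_eq_mul, Pi.sub_apply]
      ring

theorem ker_motionEquations {R : Set V} {F : Set E} {φ : V → κ → ℝ} (hR : ∀ v ∈ R, φ v ≠ 0)
    (hB : ∀ v, v ∉ R → φ v = 0) (e₀ e₁ : E) :
    LinearMap.ker (motionEquations t h R F φ e₀ e₁) = jointMotions t h F φ e₀ e₁ := by
  ext c
  rw [LinearMap.mem_ker, mem_jointMotions]
  simp only [motionEquations, LinearMap.coe_mk, AddHom.coe_mk, Prod.mk_eq_zero, sub_eq_zero]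
  refine and_congr_left (fun _ => ?_)
  constructor
  · intro hc v e he e' he' hv hv'
    have h1 := fun s => congrFun (congrFun hc (v, e, e')) s
    simp only [he, he', hv, hv', and_self, if_true, Pi.zero_apply] at h1
    by_cases hvR : v ∈ R
    · rw [exists_smul_eq_iff (hR v hvR)]
      intro s s'
      simpa [hvR] using h1 (s, s')
    · refine ⟨0, funext fun s => ?_⟩
      simpa [hvR] using h1 (s, s)
  · intro hc
    funext ⟨v, e, e'⟩ ⟨s, s'⟩
    simp only [Pi.zero_apply]
    split_ifs with hcond hvR
    · obtain ⟨he, he', hv, hv'⟩ := hcond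
      exact (exists_smul_eq_iff (hR v hvR)).1 (hc v e he e' he' hv hv') s s'
    · obtain ⟨he, he', hv, hv'⟩ := hcond
      obtain ⟨a, ha⟩ := hc v e he e' he' hv hv'
      rw [hB v hvR, smul_zero] at ha
      exact congrFun ha s
    · rfl

variable [Fintype κ] [Fintype E]

/-- For `e' = e` the joint motions are all motions. A relation between edges is thereby controlled
by two dimensions, and persists wherever these are locally constant. -/
theorem moveTogether_iff_finrank {F : Set E} {φ : V → κ → ℝ} {e e' : E} :
    MoveTogether t h F φ e e' ↔ Module.finrank ℝ (jointMotions t h F φ e e') =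
      Module.finrank ℝ (jointMotions t h F φ e e) := by
  have hle : jointMotions t h F φ e e' ≤ jointMotions t h F φ e e := fun c hc =>
    (mem_jointMotions t h).2 ⟨((mem_jointMotions t h).1 hc).1, rfl⟩
  constructor
  · intro hm
    have : jointMotions t h F φ e e' = jointMotions t h F φ e e := by
      refine le_antisymm hle (fun c hc => ?_)
      have h1 := ((mem_jointMotions t h).1 hc).1
      exact (mem_jointMotions t h).2 ⟨h1, hm c h1⟩
    rw [this]
  · intro hr c hc
    have heq := Submodule.eq_of_le_of_finrank_le hle hr.ge
    have : c ∈ jointMotions t h F φ e e' := heq ▸ (mem_jointMotions t h).2 ⟨hc, rfl⟩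
    exact ((mem_jointMotions t h).1 this).2

variable [Fintype V]

/-- In each nonempty open set of rod positions there is a generic one. -/
theorem exists_rodsGeneric {H : Type*} [TopologicalSpace H] (R : Set V) (g : V → H → κ → ℝ)
    (hg : ∀ v, Continuous (g v)) (hB : ∀ v, v ∉ R → ∀ x, g v x = 0)
    (hspan : ∀ v ∈ R, ∀ x, ∀ q : κ → ℝ, q ≠ 0 → ∃ᶠ x' in 𝓝 x, q ⬝ᵥ g v x' ≠ 0)
    {O : Set (V → H)} (hO : IsOpen O) (hne : O.Nonempty)
    (hR : ∀ p ∈ O, ∀ v ∈ R, g v (p v) ≠ 0) :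
    ∃ p ∈ O, ∀ F : Set E, RodsGeneric t h F (fun v => g v (p v)) := by
  classical
  -- There are finitely many triples `(F, e, e')`, so one point serves for all edge sets at once.
  obtain ⟨p, hp, hconst⟩ := exists_eventually_eq (J := Set E × E × E) hO hne
    (fun j p => Module.finrank ℝ (jointMotions t h j.1 (fun v => g v (p v)) j.2.1 j.2.2)) (by
      rintro ⟨F, e, e'⟩ p hp
      have hev := eventually_finrank_ker_le
        (fun p : V → H => motionEquations t h R F (fun v => g v (p v)) e e') (by
          intro c
          simp only [motionEquations, LinearMap.coe_mk, AddHom.coe_mk]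
          refine Continuous.prodMk (continuous_pi fun i => continuous_pi fun s => ?_)
            continuous_const
          have hcont : ∀ v s, Continuous fun p : V → H => g v (p v) s := fun v s =>
            (continuous_apply s).comp ((hg v).comp (continuous_apply v))
          split_ifs
          · exact ((hcont _ _).mul continuous_const).sub ((hcont _ _).mul continuous_const)
          · exact continuous_const
          · exact continuous_const) p
      filter_upwards [hev, hO.mem_nhds hp] with p' hp' hp'O
      rw [ker_motionEquations t h (hR p' hp'O) (fun v hv => hB v hv _),
        ker_motionEquations t h (hR p hp) (fun v hv => hB v hv _)] at hp'
      exact hp')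
  refine ⟨p, hp, ?_⟩
  intro F v hv e he e' he' hve hve' hnot q hq
  have hvR : v ∈ R := by
    by_contra hc
    exact hv (hB v hc _)
  have hupd : Filter.Tendsto (fun x => Function.update p v x) (𝓝 (p v)) (𝓝 p) := by
    have : Continuous fun x => Function.update p v x := continuous_const.update v continuous_id
    simpa using this.tendsto (p v)
  -- Only the rod `v` is moved: close enough to keep all dimensions, yet so that its form is no
  -- longer orthogonal to `q`.
  obtain ⟨x, hqx, hxO, hx⟩ := ((hspan v hvR (p v) q hq).and_eventually
    (hupd.eventually hconst)).exists
  set p' := Function.update p v x with hp'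
  have hmt : ∀ f f', MoveTogether t h F (fun v => g v (p' v)) f f' ↔
      MoveTogether t h F (fun v => g v (p v)) f f' := by
    intro f f'
    rw [moveTogether_iff_finrank, moveTogether_iff_finrank, hx (F, f, f'), hx (F, f, f)]
  rw [← hmt] at hnot
  simp only [MoveTogether, not_forall] at hnot
  obtain ⟨c, hc, hcne⟩ := hnot
  refine ⟨c, ?_, fun f _ f' _ hff' => (hmt f f').2 hff' c hc, ?_⟩
  -- The motion `c` belongs to the changed rods, so `c e - c e'` is a multiple of the new form at
  -- `v`; the multiple is nonzero because `c` separates `e` and `e'`.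
  · obtain ⟨a, (ha : c e - c e' = a • g v (p' v))⟩ := hc v e he e' he' hve hve'
    have hpv : p' v = x := by simp [hp']
    rw [ha, hpv, dotProduct_smul, smul_eq_mul]
    refine mul_ne_zero (fun h0 => hcne ?_) hqx
    rw [h0, zero_smul, sub_eq_zero] at ha
    exact ha
  · intro w hw f hf f' hf' hwf hwf'
    obtain ⟨a, (ha : c f - c f' = a • g w (p' w))⟩ := hc w f hf f' hf' hwf hwf'
    have hpw : p' w = p w := Function.update_of_ne hw _ _
    exact ⟨a, show c f - c f' = a • g w (p w) by rw [ha, hpw]⟩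

end Generic

/-! ### The alternating form of a rod -/

section Exterior

/-- A sum over ordered pairs as a sum over two-element sets. -/
theorem sum_powersetCard_two {N : ℕ} (T : Fin N → Fin N → ℝ) (hT : ∀ i, T i i = 0) :
    ∑ s : Set.powersetCard (Fin N) 2, (T (Set.powersetCard.ofFinEmbEquiv.symm s 0)
      (Set.powersetCard.ofFinEmbEquiv.symm s 1) + T (Set.powersetCard.ofFinEmbEquiv.symm s 1)
      (Set.powersetCard.ofFinEmbEquiv.symm s 0)) = ∑ i, ∑ j, T i j := by
  have h1 : ∑ i, ∑ j, T i j = ∑ p : Fin N × Fin N with p.1 < p.2, (T p.1 p.2 + T p.2 p.1) := by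
    rw [← Fintype.sum_prod_type', Finset.sum_add_distrib,
      ← Finset.sum_filter_add_sum_filter_not univ (fun p : Fin N × Fin N => p.1 < p.2)]
    congr 1
    rw [← Finset.sum_filter_add_sum_filter_not (univ.filter fun p : Fin N × Fin N => ¬ p.1 < p.2)
      (fun p => p.1 = p.2), Finset.sum_eq_zero, zero_add]
    · refine Finset.sum_nbij' Prod.swap Prod.swap ?_ ?_ ?_ ?_ ?_
      · intro p
        simp only [mem_filter, mem_univ, true_and, Prod.fst_swap, Prod.snd_swap]
        omega
      · intro p
        simp only [mem_filter, mem_univ, true_and, Prod.fst_swap, Prod.snd_swap]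
        omega
      · simp
      · simp
      · simp
    · rintro ⟨i, j⟩ hp
      simp only [mem_filter, mem_univ, true_and] at hp
      obtain ⟨-, rfl⟩ := hp
      exact hT i
  rw [h1]
  refine Finset.sum_bij' (fun s _ => (Set.powersetCard.ofFinEmbEquiv.symm s 0,
    Set.powersetCard.ofFinEmbEquiv.symm s 1))
    (fun p hp => ⟨{p.1, p.2}, Finset.card_pair (Finset.mem_filter.1 hp).2.ne⟩) ?_ ?_ ?_ ?_ ?_
  · intro s _
    simp
  · simp
  · intro s _
    apply Subtype.ext
    apply Finset.eq_of_subset_of_card_le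
    · intro i hi
      simp only [Finset.mem_insert, Finset.mem_singleton] at hi
      rcases hi with rfl | rfl <;> exact Finset.orderEmbOfFin_mem _ _ _
    · rw [s.2, Finset.card_pair]
      exact fun h => absurd ((Set.powersetCard.ofFinEmbEquiv.symm s).injective h) (by simp)
  · rintro ⟨i, j⟩ hp
    have hij : i < j := (Finset.mem_filter.1 hp).2
    have := Finset.orderEmbOfFin_unique (s := {i, j}) (Finset.card_pair hij.ne) (f := ![i, j])
      (by intro x; fin_cases x <;> simp) (by
        intro x y hxy
        fin_cases x <;> fin_cases y <;> simp_all)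
    ext
    · exact (congrArg Fin.val (congrFun this 0)).symm
    · exact (congrArg Fin.val (congrFun this 1)).symm
  · intro s _
    rfl

variable {d : ℕ}

/-- The bivector `a ∧ b` as a bilinear function of `a` and `b`. -/
noncomputable def bivector (d : ℕ) :
    (Fin (d + 1) → ℝ) →ₗ[ℝ] (Fin (d + 1) → ℝ) →ₗ[ℝ] Ext d 2 :=
  LinearMap.mk₂ ℝ (fun a b s => a (Set.powersetCard.ofFinEmbEquiv.symm s 0) *
      b (Set.powersetCard.ofFinEmbEquiv.symm s 1) - a (Set.powersetCard.ofFinEmbEquiv.symm s 1) *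
      b (Set.powersetCard.ofFinEmbEquiv.symm s 0))
    (fun a a' b => by ext s; simp only [Pi.add_apply]; ring)
    (fun c a b => by ext s; simp only [Pi.smul_apply, smul_eq_mul]; ring)
    (fun a b b' => by ext s; simp only [Pi.add_apply]; ring)
    (fun c a b => by ext s; simp only [Pi.smul_apply, smul_eq_mul]; ring)

theorem bivector_apply (a b : Fin (d + 1) → ℝ) (s : Set.powersetCard (Fin (d + 1)) 2) :
    bivector d a b s = a (Set.powersetCard.ofFinEmbEquiv.symm s 0) *
      b (Set.powersetCard.ofFinEmbEquiv.symm s 1) - a (Set.powersetCard.ofFinEmbEquiv.symm s 1) *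
      b (Set.powersetCard.ofFinEmbEquiv.symm s 0) := rfl

theorem wedge_two (v : Fin 2 → Fin (d + 1) → ℝ) : wedge v = bivector d (v 0) (v 1) := by
  ext s
  rw [wedge, Matrix.det_fin_two, bivector_apply]
  rfl

theorem bivector_self (a : Fin (d + 1) → ℝ) : bivector d a a = 0 := by
  ext s
  rw [bivector_apply, Pi.zero_apply]
  ring

theorem bivector_swap (a b : Fin (d + 1) → ℝ) : bivector d b a = -bivector d a b := by
  ext s
  rw [Pi.neg_apply, bivector_apply, bivector_apply]
  ring

/-- The wedge product of standard basis vectors is a standard basis vector. -/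
theorem wedge_single {k : ℕ} (s : Set.powersetCard (Fin (d + 1)) k) :
    wedge (fun i => Pi.single (Set.powersetCard.ofFinEmbEquiv.symm s i) (1 : ℝ)) =
      Pi.single s 1 := by
  classical
  ext s'
  by_cases h : s' = s
  · subst h
    rw [Pi.single_eq_same, wedge]
    have h1 : (Matrix.of fun i j => (Pi.single (Set.powersetCard.ofFinEmbEquiv.symm s' i) (1 : ℝ) :
        Fin (d + 1) → ℝ) (Set.powersetCard.ofFinEmbEquiv.symm s' j)) = 1 := by
      ext i j
      rw [Matrix.of_apply, Matrix.one_apply, Pi.single_apply]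
      simp [eq_comm]
    rw [h1, Matrix.det_one]
  · rw [Pi.single_eq_of_ne h, wedge]
    have : ∃ i, Set.powersetCard.ofFinEmbEquiv.symm s i ∉ (s' : Finset (Fin (d + 1))) := by
      by_contra! hc
      apply h
      apply Subtype.ext
      symm
      apply Finset.eq_of_subset_of_card_le
      · intro x hx
        have hx' : x ∈ Set.range (Finset.orderEmbOfFin s.1 s.2) :=
          (Finset.range_orderEmbOfFin s.1 s.2).symm ▸ hx
        obtain ⟨i, rfl⟩ := hx'
        exact hc i
      · rw [s.2, s'.2]
    obtain ⟨i, hi⟩ := this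
    refine Matrix.det_eq_zero_of_row_eq_zero i (fun j => ?_)
    refine Pi.single_eq_of_ne ?_ _
    intro hj
    exact hi (hj ▸ Finset.orderEmbOfFin_mem _ _ _)

theorem exists_dotProduct_bivector_ne_zero {φ : Ext d 2} (h : φ ≠ 0) :
    ∃ i j, φ ⬝ᵥ bivector d (Pi.single i 1) (Pi.single j 1) ≠ 0 := by
  obtain ⟨s, hs⟩ := Function.ne_iff.1 h
  refine ⟨Set.powersetCard.ofFinEmbEquiv.symm s 0, Set.powersetCard.ofFinEmbEquiv.symm s 1, ?_⟩
  rw [← wedge_two (fun i => Pi.single (Set.powersetCard.ofFinEmbEquiv.symm s i) 1), wedge_single,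
    dotProduct_single, mul_one]
  exact hs

/-- The coefficient vector of the linear functional `pairing · r`. -/
def coform (d : ℕ) : Ext d (d - 1) →ₗ[ℝ] Ext d 2 where
  toFun r s := (-1) ^ (∑ i ∈ (s : Finset (Fin (d + 1))), (i : ℕ)) *
      r ⟨(s : Finset (Fin (d + 1)))ᶜ, by
        have h : (s : Finset (Fin (d + 1))).card = 2 := s.2
        change (s : Finset (Fin (d + 1)))ᶜ.card = d - 1
        rw [Finset.card_compl, h, Fintype.card_fin]
        omega⟩
  map_add' r r' := by ext s; simp only [Pi.add_apply]; ring
  map_smul' c r := by ext s; simp only [Pi.smul_apply, smul_eq_mul, RingHom.id_apply]; ring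

theorem pairing_eq_dotProduct (q : Ext d 2) (r : Ext d (d - 1)) :
    pairing q r = q ⬝ᵥ coform d r := by
  simp only [pairing, dotProduct, coform, LinearMap.coe_mk, AddHom.coe_mk]
  refine Finset.sum_congr rfl (fun s _ => ?_)
  ring

theorem coform_eq_zero_iff (hd : 1 ≤ d) {r : Ext d (d - 1)} : coform d r = 0 ↔ r = 0 := by
  refine ⟨fun h => ?_, fun h => by rw [h, map_zero]⟩
  ext s
  have hs : (s : Finset (Fin (d + 1)))ᶜ.card = 2 := by
    have h : (s : Finset (Fin (d + 1))).card = d - 1 := s.2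
    rw [Finset.card_compl, h, Fintype.card_fin]
    omega
  have h1 := congrFun h ⟨(s : Finset (Fin (d + 1)))ᶜ, hs⟩
  simp only [coform, LinearMap.coe_mk, AddHom.coe_mk, compl_compl, Pi.zero_apply] at h1
  exact (mul_eq_zero.1 h1).resolve_left (pow_ne_zero _ (by norm_num))

/-- Laplace expansion along the first two rows. The overall minus sign comes from the column indices
starting at `0`: the columns `0, 1` have odd index sum although their minor enters with a plus sign.
-/
theorem pairing_bivector_wedge {n : ℕ} (a b : Fin (n + 2) → ℝ) (v : Fin n → Fin (n + 2) → ℝ) :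
    pairing (d := n + 1) (bivector (n + 1) a b) (wedge v) =
      -(Matrix.of (vecCons a (vecCons b v))).det := by
  classical
  -- The term with column `i` from the first row and column `j` from the second. Deleting column `i`
  -- shifts the position of `j` when `i < j`, which is the source of the sign that depends on the
  -- order.
  let T : Fin (n + 2) → Fin (n + 2) → ℝ := fun i j => if hij : i = j then 0 else
    (if j < i then 1 else -1) * (-1) ^ (i + j : ℕ) * (a i * b j) *
      wedge (d := n + 1) v ⟨({i, j} : Finset _)ᶜ, by
        change ({i, j} : Finset (Fin (n + 2)))ᶜ.card = n
        rw [Finset.card_compl, Finset.card_pair hij, Fintype.card_fin]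
        omega⟩
  have hdet : (Matrix.of (vecCons a (vecCons b v))).det = ∑ i, ∑ j, T i j := by
    rw [Matrix.det_succ_row_zero]
    refine Finset.sum_congr rfl (fun i _ => ?_)
    rw [Matrix.det_succ_row_zero, Finset.mul_sum, Fin.sum_univ_succAbove _ i]
    have h0 : T i i = 0 := by simp [T]
    rw [h0, zero_add]
    refine Finset.sum_congr rfl (fun k _ => ?_)
    have hne : i ≠ i.succAbove k := (Fin.succAbove_ne i k).symm
    have hemb : ∀ h : ({i, i.succAbove k} : Finset (Fin (n + 2)))ᶜ.card = n,
        (fun l => i.succAbove (k.succAbove l)) =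
          ⇑(Finset.orderEmbOfFin ({i, i.succAbove k} : Finset (Fin (n + 2)))ᶜ h) := by
      intro h
      refine Finset.orderEmbOfFin_unique h ?_ ?_
      · intro l
        simp [Fin.succAbove_ne, Fin.succAbove_right_injective.eq_iff]
      · exact (Fin.strictMono_succAbove i).comp (Fin.strictMono_succAbove k)
    simp only [T, hne, dif_neg, not_false_eq_true]
    have hw : ∀ h, wedge (d := n + 1) v ⟨({i, i.succAbove k} : Finset _)ᶜ, h⟩ =
        (Matrix.of fun x y => v x (i.succAbove (k.succAbove y))).det := by
      intro h
      rw [wedge]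
      congr 1
      ext x y
      rw [Matrix.of_apply, Matrix.of_apply]
      exact congrArg (v x) (congrFun (hemb h) y).symm
    rw [hw]
    have hsign : (if i.succAbove k < i then (1 : ℝ) else -1) * (-1) ^ (i + i.succAbove k : ℕ) =
        (-1) ^ (i + k : ℕ) := by
      by_cases hk : k.castSucc < i
      · rw [Fin.succAbove_of_castSucc_lt _ _ hk, if_pos hk]
        simp
      · have hk' := not_lt.1 hk
        rw [Fin.succAbove_of_le_castSucc _ _ hk', if_neg]
        · simp only [Fin.val_succ]
          ring
        · intro hlt
          exact hk ((Fin.castSucc_lt_succ).trans hlt)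
    rw [hsign]
    simp only [Matrix.of_apply, Matrix.submatrix_apply, Matrix.cons_val_zero, Matrix.cons_val_succ,
      pow_add]
    have : ((Matrix.of (vecCons a (vecCons b v))).submatrix Fin.succ i.succAbove).submatrix
        Fin.succ k.succAbove = Matrix.of fun x y => v x (i.succAbove (k.succAbove y)) := by
      ext x y
      simp
    rw [this]
    ring
  rw [hdet, ← sum_powersetCard_two T (fun i => by simp [T]), pairing, ← Finset.sum_neg_distrib]
  refine Finset.sum_congr rfl (fun s _ => ?_)
  have hlt : Set.powersetCard.ofFinEmbEquiv.symm s 0 < Set.powersetCard.ofFinEmbEquiv.symm s 1 :=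
    (Set.powersetCard.ofFinEmbEquiv.symm s).strictMono (by simp)
  have hs : (s : Finset (Fin (n + 2))) = {Set.powersetCard.ofFinEmbEquiv.symm s 0,
      Set.powersetCard.ofFinEmbEquiv.symm s 1} := by
    symm
    apply Finset.eq_of_subset_of_card_le
    · intro i hi
      simp only [Finset.mem_insert, Finset.mem_singleton] at hi
      rcases hi with rfl | rfl <;> exact Finset.orderEmbOfFin_mem _ _ _
    · rw [s.2, Finset.card_pair hlt.ne]
  simp only [T, hlt.ne, hlt.ne', dif_neg, not_false_eq_true, bivector_apply]
  set i := Set.powersetCard.ofFinEmbEquiv.symm s 0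
  set j := Set.powersetCard.ofFinEmbEquiv.symm s 1
  have hsc : (s : Finset (Fin (n + 2)))ᶜ ∈ Set.powersetCard (Fin (n + 2)) n := by
    change (s : Finset (Fin (n + 2)))ᶜ.card = n
    rw [Finset.card_compl, s.2, Fintype.card_fin]
    omega
  have hw : ∀ (X : Finset (Fin (n + 2))) (_ : X = (s : Finset (Fin (n + 2))))
      (h : Xᶜ ∈ Set.powersetCard (Fin (n + 2)) n),
      wedge (d := n + 1) v ⟨Xᶜ, h⟩ = wedge (d := n + 1) v ⟨(s : Finset (Fin (n + 2)))ᶜ, hsc⟩ := by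
    rintro X rfl h
    rfl
  rw [hw {i, j} hs.symm, hw {j, i} (by rw [hs, Finset.pair_comm]), if_pos hlt, if_neg hlt.not_gt,
    add_comm (j : ℕ)]
  have hsum : ∑ x ∈ (s : Finset (Fin (n + 2))), (x : ℕ) = i + j := by
    rw [hs, Finset.sum_pair hlt.ne]
  rw [hsum]
  change (-1) ^ (i + j : ℕ) * _ * wedge (d := n + 1) v ⟨(s : Finset (Fin (n + 2)))ᶜ, _⟩ = _
  ring

/-! ### Radicals of alternating forms of rank at most two. -/

/-- The alternating form on `W` with coefficient vector `φ`. -/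
noncomputable def form (φ : Ext d 2) :
    (Fin (d + 1) → ℝ) →ₗ[ℝ] (Fin (d + 1) → ℝ) →ₗ[ℝ] ℝ :=
  LinearMap.mk₂ ℝ (fun a b => bivector d a b ⬝ᵥ φ)
    (fun a a' b => by rw [map_add, LinearMap.add_apply, add_dotProduct])
    (fun c a b => by rw [map_smul, LinearMap.smul_apply, smul_dotProduct])
    (fun a b b' => by rw [map_add, add_dotProduct])
    (fun c a b => by rw [map_smul, smul_dotProduct])

theorem form_apply (φ : Ext d 2) (a b : Fin (d + 1) → ℝ) : form φ a b = bivector d a b ⬝ᵥ φ := rfl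

theorem form_self (φ : Ext d 2) (a : Fin (d + 1) → ℝ) : form φ a a = 0 := by
  rw [form_apply, bivector_self, zero_dotProduct]

theorem form_swap (φ : Ext d 2) (a b : Fin (d + 1) → ℝ) : form φ b a = -form φ a b := by
  rw [form_apply, bivector_swap, neg_dotProduct, form_apply]

/-- The radical of the form of `φ`. -/
noncomputable def radical (φ : Ext d 2) : Submodule ℝ (Fin (d + 1) → ℝ) := LinearMap.ker (form φ)

theorem mem_radical {φ : Ext d 2} {a : Fin (d + 1) → ℝ} :
    a ∈ radical φ ↔ ∀ b, form φ a b = 0 := by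
  rw [radical, LinearMap.mem_ker, LinearMap.ext_iff]
  rfl

theorem form_left_of_mem_radical {φ : Ext d 2} {a : Fin (d + 1) → ℝ} (h : a ∈ radical φ)
    (b : Fin (d + 1) → ℝ) : form φ a b = 0 := mem_radical.1 h b

theorem form_right_of_mem_radical {φ : Ext d 2} {b : Fin (d + 1) → ℝ} (h : b ∈ radical φ)
    (a : Fin (d + 1) → ℝ) : form φ a b = 0 := by
  rw [form_swap, mem_radical.1 h, neg_zero]

theorem exists_form_single_ne_zero {φ : Ext d 2} (h : φ ≠ 0) :
    ∃ i j, form φ (Pi.single i 1) (Pi.single j 1) ≠ 0 := by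
  obtain ⟨i, j, hij⟩ := exists_dotProduct_bivector_ne_zero h
  exact ⟨i, j, by rwa [form_apply, dotProduct_comm]⟩

theorem radical_eq_top_iff {φ : Ext d 2} : radical φ = ⊤ ↔ φ = 0 := by
  constructor
  · intro h
    by_contra hne
    obtain ⟨i, j, hij⟩ := exists_form_single_ne_zero hne
    exact hij (form_left_of_mem_radical (h ▸ Submodule.mem_top) _)
  · rintro rfl
    rw [eq_top_iff]
    exact fun a _ => mem_radical.2 fun b => by rw [form_apply, dotProduct_zero]

/-- A vector that lies in the radical when the form has rank two. -/
noncomputable def kernelVector (φ : Ext d 2) (u v w : Fin (d + 1) → ℝ) : Fin (d + 1) → ℝ :=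
  form φ v w • u + form φ w u • v + form φ u v • w

/-- The form of `φ` has rank at most two. -/
def RankTwo (φ : Ext d 2) : Prop := ∀ u v w, kernelVector φ u v w ∈ radical φ

theorem rankTwo_zero : RankTwo (0 : Ext d 2) := fun _ _ _ => by
  rw [radical_eq_top_iff.2 rfl]
  exact Submodule.mem_top

theorem form_coform_wedge {n : ℕ} (v : Fin n → Fin (n + 2) → ℝ) (a b : Fin (n + 2) → ℝ) :
    form (coform (n + 1) (wedge v)) a b = -(Matrix.of (vecCons a (vecCons b v))).det := by
  rw [form_apply, ← pairing_bivector_wedge, pairing_eq_dotProduct]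

theorem form_coform_wedge_ne_zero_iff {n : ℕ} {v : Fin n → Fin (n + 2) → ℝ}
    {a b : Fin (n + 2) → ℝ} : form (coform (n + 1) (wedge v)) a b ≠ 0 ↔
      LinearIndependent ℝ (vecCons a (vecCons b v)) := by
  rw [form_coform_wedge, neg_ne_zero, ← isUnit_iff_ne_zero, ← Matrix.isUnit_iff_isUnit_det,
    ← Matrix.linearIndependent_rows_iff_isUnit]
  rfl

theorem mem_radical_coform_wedge (v : Fin (d - 1) → Fin (d + 1) → ℝ) (hd : 1 ≤ d)
    (i : Fin (d - 1)) : v i ∈ radical (coform d (wedge v)) := by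
  obtain ⟨n, rfl⟩ : ∃ n, d = n + 1 := ⟨d - 1, by omega⟩
  change Fin n → Fin (n + 2) → ℝ at v
  change Fin n at i
  refine mem_radical.2 (fun b => ?_)
  refine (form_coform_wedge v (v i) b).trans ?_
  rw [neg_eq_zero]
  exact Matrix.det_zero_of_row_eq (i := 0) (j := i.succ.succ) (by simp [Fin.ext_iff])
    (by ext x; simp)

/-- If the form is nonzero on two of the three vectors, these two and the vectors of the rod form a
basis of `W`. The third vector is then a combination of the two modulo the radical, and the three
terms cancel. The expression is cyclically symmetric, and it is zero when all three values of the
form vanish. -/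
theorem rankTwo_coform_wedge (v : Fin (d - 1) → Fin (d + 1) → ℝ) (hd : 1 ≤ d) :
    RankTwo (coform d (wedge v)) := by
  have hrad := mem_radical_coform_wedge v hd
  set φ := coform d (wedge v) with hφ
  have key : ∀ u v' w z, form φ v' w ≠ 0 → form φ (kernelVector φ u v' w) z = 0 := by
    intro u x w z hne
    obtain ⟨m, hm, c₁, c₂, hu⟩ : ∃ m ∈ radical φ, ∃ c₁ c₂ : ℝ, u = c₁ • x + (c₂ • w + m) := by
      obtain ⟨n, rfl⟩ : ∃ n, d = n + 1 := ⟨d - 1, by omega⟩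
      have hli := form_coform_wedge_ne_zero_iff.1 hne
      have htop := hli.span_eq_top_of_card_eq_finrank (by simp)
      have hu : u ∈ Submodule.span ℝ (Set.range (vecCons x (vecCons w v))) := by
        rw [htop]
        exact Submodule.mem_top
      rw [Matrix.range_cons, Matrix.range_cons, Set.singleton_union, Set.singleton_union,
        Submodule.mem_span_insert] at hu
      obtain ⟨c₁, y, hy, rfl⟩ := hu
      obtain ⟨c₂, m, hm, rfl⟩ := Submodule.mem_span_insert.1 hy
      refine ⟨m, Submodule.span_le.2 ?_ hm, c₁, c₂, rfl⟩
      rintro _ ⟨i, rfl⟩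
      exact hrad i
    subst hu
    simp only [kernelVector, map_add, map_smul, LinearMap.add_apply, LinearMap.smul_apply,
      smul_eq_mul, form_left_of_mem_radical hm, form_right_of_mem_radical hm, form_self]
    rw [form_swap φ x w]
    ring
  intro u v' w
  refine mem_radical.2 (fun z => ?_)
  by_cases h1 : form φ v' w = 0
  · by_cases h2 : form φ w u = 0
    · by_cases h3 : form φ u v' = 0
      · simp [kernelVector, h1, h2, h3]
      · have := key w u v' z h3
        rw [← this]
        simp only [kernelVector, map_add, LinearMap.add_apply]
        ring
    · have := key v' w u z h2
      rw [← this]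
      simp only [kernelVector, map_add, LinearMap.add_apply]
      ring
  · exact key u v' w z h1

/-- The vectors that span the radical of a form of rank two. -/
noncomputable def radicalGenerator (φ : Ext d 2) (i : Fin (d + 1) × Fin (d + 1) × Fin (d + 1)) :
    Fin (d + 1) → ℝ :=
  kernelVector φ (Pi.single i.1 1) (Pi.single i.2.1 1) (Pi.single i.2.2 1)

/-- If the form is nonzero on `e i, e j`, then `kernelVector φ a (e i) (e j)` is that value times
`a` for each `a` in the radical, and it is linear in `a`. Hence points of a rod are combinations of
vectors that are polynomial in the rod's coordinates. -/
theorem span_radicalGenerator {φ : Ext d 2} (h : RankTwo φ) (h0 : φ ≠ 0) :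
    Submodule.span ℝ (Set.range (radicalGenerator φ)) = radical φ := by
  refine le_antisymm (Submodule.span_le.2 ?_) (fun a ha => ?_)
  · rintro _ ⟨i, rfl⟩
    exact h _ _ _
  · obtain ⟨i, j, hij⟩ := exists_form_single_ne_zero h0
    have h1 : a = (form φ (Pi.single i 1) (Pi.single j 1))⁻¹ •
        kernelVector φ a (Pi.single i 1) (Pi.single j 1) := by
      rw [kernelVector, form_left_of_mem_radical ha, form_right_of_mem_radical ha, zero_smul,
        zero_smul, add_zero, add_zero, smul_smul, inv_mul_cancel₀ hij, one_smul]
    have h2 : kernelVector φ a (Pi.single i 1) (Pi.single j 1) =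
        ∑ k, a k • radicalGenerator φ (k, i, j) := by
      conv_lhs => rw [← Finset.univ_sum_single a]
      have hs : ∀ k, Pi.single k (a k) = a k • (Pi.single k 1 : Fin (d + 1) → ℝ) := fun k => by
        rw [← Pi.single_smul, smul_eq_mul, mul_one]
      simp only [radicalGenerator, kernelVector, hs, map_sum, map_smul, LinearMap.sum_apply,
        LinearMap.smul_apply, smul_add, Finset.sum_add_distrib, Finset.smul_sum, Finset.sum_smul,
        smul_smul, smul_eq_mul]
      congr 2
      refine Finset.sum_congr rfl (fun k _ => ?_)
      rw [mul_comm]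
    rw [h1, h2]
    exact Submodule.smul_mem _ _ (Submodule.sum_mem _ fun k _ =>
      Submodule.smul_mem _ _ (Submodule.subset_span ⟨_, rfl⟩))

/-- If the radical of two forms of rank two span `W`, a form that vanishes between the two
radicals is a combination of these forms. -/
theorem exists_eq_add_of_form_eq_zero {φ φ' ψ : Ext d 2} (h : RankTwo φ) (h' : RankTwo φ')
    (htop : radical φ ⊔ radical φ' = ⊤)
    (hψ : ∀ a ∈ radical φ, ∀ b ∈ radical φ', form ψ a b = 0) :
    ∃ α β : ℝ, ψ = α • φ + β • φ' := by
  have hdec : ∀ x, ∃ a ∈ radical φ, ∃ b ∈ radical φ', a + b = x := fun x =>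
    Submodule.mem_sup.1 (htop ▸ Submodule.mem_top)
  -- On the radical of `φ` the form `ψ` is proportional to the form of `φ'`. Applied with the roles
  -- exchanged, this yields both coefficients.
  have key : ∀ {φ φ' : Ext d 2}, RankTwo φ' → (∀ x, ∃ a ∈ radical φ, ∃ b ∈ radical φ', a + b = x) →
      (∀ a ∈ radical φ, ∀ b ∈ radical φ', form ψ a b = 0) →
      ∃ β : ℝ, ∀ a ∈ radical φ, ∀ b ∈ radical φ, form ψ a b = β * form φ' a b := by
    intro φ φ' h' hdec hψ
    by_cases hu : ∃ u ∈ radical φ, ∃ w ∈ radical φ, form φ' u w ≠ 0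
    · obtain ⟨u, hu, w, hw, hne⟩ := hu
      refine ⟨form ψ u w / form φ' u w, fun a ha b hb => ?_⟩
      -- The vector `kernelVector φ' x u w` lies in `radical φ'`, so `ψ` vanishes between it and
      -- `y`.
      have hz : ∀ x ∈ radical φ, ∀ y ∈ radical φ, form φ' u w * form ψ x y +
          form φ' w x * form ψ u y + form φ' x u * form ψ w y = 0 := by
        intro x _ y hy
        have h1 := hψ y hy _ (h' x u w)
        rw [form_swap, neg_eq_zero] at h1
        simpa [kernelVector] using h1
      have h1 := hz a ha b hb
      have h2 := hz b hb u hu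
      have h3 := hz b hb w hw
      rw [form_self] at h2 h3
      rw [form_swap ψ u w] at h2
      rw [form_swap ψ b u] at h1
      rw [form_swap ψ b w] at h1
      have e1 : form φ' u w * form ψ b u = form φ' b u * form ψ u w := by linarith
      have e2 : form φ' u w * form ψ b w = -(form φ' w b * form ψ u w) := by linarith
      rw [div_mul_eq_mul_div, eq_div_iff hne]
      have h4 := h' a u w
      have h5 := form_left_of_mem_radical h4 b
      simp only [kernelVector, map_add, map_smul, LinearMap.add_apply, LinearMap.smul_apply,
        smul_eq_mul] at h5
      rw [form_swap φ' b u, form_swap φ' b w] at h5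
      have h6 : form φ' w b = -form φ' b w := form_swap _ _ _
      have h7 : form φ' u w * (form ψ a b * form φ' u w) =
          form φ' u w * (form ψ u w * form φ' a b) := by
        rw [h6] at e2
        linear_combination (form φ' u w) * h1 + (form φ' w a) * e1 + (form φ' a u) * e2 -
          (form ψ u w) * h5
      exact mul_left_cancel₀ hne h7
    -- If `φ'` vanishes on `radical φ`, each `b` there splits as `x + y` with both parts in `radical
    -- φ'`, so `ψ` vanishes too and the coefficient `0` works.
    · push Not at hu
      refine ⟨0, fun a ha b hb => ?_⟩
      obtain ⟨x, hx, y, hy, rfl⟩ := hdec b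
      have hy' : y ∈ radical φ := by
        have := Submodule.sub_mem _ hb hx
        rwa [add_sub_cancel_left] at this
      have hxr : x ∈ radical φ' := by
        refine mem_radical.2 (fun z => ?_)
        obtain ⟨p, hp, r, hr, rfl⟩ := hdec z
        rw [map_add, hu x hx p hp, form_right_of_mem_radical hr, add_zero]
      rw [map_add, hψ a ha x hxr, hψ a ha y hy]
      ring
  obtain ⟨β, hβ⟩ := key h' hdec hψ
  obtain ⟨α, hα⟩ := key (φ := φ') h
    (fun x => by
      obtain ⟨a, ha, b, hb, hx⟩ := hdec x
      exact ⟨b, hb, a, ha, (add_comm b a).trans hx⟩)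
    (fun a ha b hb => by rw [form_swap, hψ b hb a ha, neg_zero])
  refine ⟨α, β, ?_⟩
  rw [← sub_eq_zero]
  by_contra hne
  obtain ⟨i, j, hij⟩ := exists_form_single_ne_zero hne
  apply hij
  obtain ⟨a, ha, b, hb, hi⟩ := hdec (Pi.single i 1)
  obtain ⟨a', ha', b', hb', hj⟩ := hdec (Pi.single j 1)
  rw [← hi, ← hj]
  have hlin : ∀ x y, form (ψ - (α • φ + β • φ')) x y =
      form ψ x y - (α * form φ x y + β * form φ' x y) := fun x y => by
    simp only [form_apply, dotProduct_sub, dotProduct_add, dotProduct_smul, smul_eq_mul]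
  simp only [hlin, map_add, LinearMap.add_apply, hψ a ha b' hb', hβ a ha a' ha', hα b hb b' hb',
    form_left_of_mem_radical ha, form_right_of_mem_radical ha', form_left_of_mem_radical hb,
    form_right_of_mem_radical hb']
  rw [form_swap ψ a' b, hψ a' ha' b hb]
  ring

/-- A line that meets two rods is spanned by points of these rods, or it is a limit of lines
spanned by points of these rods. -/
theorem mem_closure_bivector {φ φ' : Ext d 2} (h : RankTwo φ) (h' : RankTwo φ')
    (htop : radical φ ⊔ radical φ' = ⊤) {a b : Fin (d + 1) → ℝ} (hφ : form φ a b = 0)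
    (hφ' : form φ' a b = 0) :
    bivector d a b ∈ closure {q | ∃ x ∈ radical φ, ∃ y ∈ radical φ', q = bivector d x y} := by
  -- A line that meets a rod, spanned by `a` off the rod and `b`, contains a point `b - c • a` of
  -- the rod.
  have step : ∀ {φ : Ext d 2}, RankTwo φ → ∀ {a b : Fin (d + 1) → ℝ}, form φ a b = 0 →
      a ∉ radical φ → ∃ c : ℝ, b - c • a ∈ radical φ := by
    intro φ h a b hab ha
    obtain ⟨z, hz⟩ : ∃ z, form φ z a ≠ 0 := by
      by_contra! hc
      exact ha (mem_radical.2 fun z => by rw [form_swap, hc, neg_zero])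
    have h1 := h a b z
    refine ⟨-(form φ b z / form φ z a), ?_⟩
    have h2 := Submodule.smul_mem _ (form φ z a)⁻¹ h1
    convert h2 using 1
    rw [kernelVector, hab, zero_smul, add_zero, smul_add, smul_smul, smul_smul,
      inv_mul_cancel₀ hz, one_smul, neg_smul, sub_neg_eq_add, div_eq_inv_mul]
    exact add_comm _ _
  obtain ⟨x, y, hx, hxy⟩ : ∃ x y, x ∈ radical φ ∧ bivector d a b = bivector d x y := by
    by_cases ha : a ∈ radical φ
    · exact ⟨a, b, ha, rfl⟩
    · obtain ⟨c, hc⟩ := step h hφ ha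
      refine ⟨b - c • a, -a, hc, ?_⟩
      rw [map_neg, map_sub, LinearMap.sub_apply, map_smul, LinearMap.smul_apply, bivector_self,
        smul_zero, sub_zero, bivector_swap]
  rw [hxy]
  have hφ'' : form φ' x y = 0 := by rwa [form_apply, ← hxy, ← form_apply]
  by_cases hx' : x ∈ radical φ'
  -- The degenerate case of `x` on both rods. With `y = p + r` one has `x ∧ y + t (p ∧ r) = -t⁻¹ (x
  -- + t p) ∧ (x - t r)`, and the factors lie on the two rods.
  · obtain ⟨p, hp, r, hr, rfl⟩ := Submodule.mem_sup.1
      (show y ∈ radical φ ⊔ radical φ' from htop ▸ Submodule.mem_top)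
    have hcont : Filter.Tendsto (fun t : ℝ => bivector d x (p + r) + t • bivector d p r)
        (nhdsWithin 0 {0}ᶜ) (nhds (bivector d x (p + r))) := by
      have : Continuous fun t : ℝ => bivector d x (p + r) + t • bivector d p r :=
        continuous_const.add (continuous_id.smul continuous_const)
      simpa using (this.tendsto 0).mono_left nhdsWithin_le_nhds
    refine mem_closure_of_tendsto hcont ?_
    filter_upwards [self_mem_nhdsWithin] with t ht
    have ht' : t ≠ 0 := ht
    refine ⟨-t⁻¹ • (x + t • p), Submodule.smul_mem _ _
      (Submodule.add_mem _ hx (Submodule.smul_mem _ _ hp)), x - t • r,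
      Submodule.sub_mem _ hx' (Submodule.smul_mem _ _ hr), ?_⟩
    simp only [map_add, map_sub, map_smul, LinearMap.add_apply, LinearMap.smul_apply,
      bivector_self, bivector_swap x p]
    ext s
    simp only [Pi.add_apply, Pi.smul_apply, Pi.sub_apply, Pi.zero_apply, Pi.neg_apply, smul_eq_mul]
    field_simp
    ring
  · obtain ⟨c, hc⟩ := step h' hφ'' hx'
    refine subset_closure ⟨x, hx, y - c • x, hc, ?_⟩
    rw [map_sub, map_smul, bivector_self, smul_zero, sub_zero]

end Exterior

/-! ### Polynomial functions -/

section Polynomials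

open Topology

/-- The polynomial functions of the coordinates of a family of vectors. -/
noncomputable def polynomialFunctions (ι κ : Type*) : Subalgebra ℝ ((ι → κ → ℝ) → ℝ) :=
  (MvPolynomial.aeval (fun (a : ι × κ) (x : ι → κ → ℝ) => x a.1 a.2)).range

/-- The functions on a vector space that are polynomial along each line. -/
def lineFunctions (X : Type*) [AddCommGroup X] [Module ℝ X] : Subalgebra ℝ (X → ℝ) where
  carrier := {f | ∀ x y, ∃ P : Polynomial ℝ, ∀ t : ℝ, f (x + t • y) = P.eval t}
  mul_mem' := by
    intro f g hf hg x y
    obtain ⟨P, hP⟩ := hf x y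
    obtain ⟨Q, hQ⟩ := hg x y
    exact ⟨P * Q, fun t => by rw [Pi.mul_apply, hP, hQ, Polynomial.eval_mul]⟩
  add_mem' := by
    intro f g hf hg x y
    obtain ⟨P, hP⟩ := hf x y
    obtain ⟨Q, hQ⟩ := hg x y
    exact ⟨P + Q, fun t => by rw [Pi.add_apply, hP, hQ, Polynomial.eval_add]⟩
  algebraMap_mem' := fun c _ _ => ⟨Polynomial.C c, fun t => by simp⟩

section Subalgebras

variable {X : Type*} (S : Subalgebra ℝ (X → ℝ))

/-- For an arbitrary subalgebra of functions, so that one computation gives continuity,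
polynomiality, or polynomiality along lines. -/
theorem eval_mem_subalgebra {σ : Type*} {g : X → σ → ℝ} (hg : ∀ a, (fun x => g x a) ∈ S)
    (p : MvPolynomial σ ℝ) : (fun x => MvPolynomial.eval (g x) p) ∈ S := by
  induction p using MvPolynomial.induction_on with
  | C c =>
    simp only [MvPolynomial.eval_C]
    exact S.algebraMap_mem c
  | add p q hp hq =>
    simp only [map_add]
    exact S.add_mem hp hq
  | mul_X p a hp =>
    simp only [map_mul, MvPolynomial.eval_X]
    exact S.mul_mem hp (hg a)

theorem sum_mem_subalgebra {J : Type*} (s : Finset J) {f : J → X → ℝ} (hf : ∀ j ∈ s, f j ∈ S) :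
    (fun x => ∑ j ∈ s, f j x) ∈ S := by
  have := S.sum_mem hf
  convert this using 1
  ext x
  rw [Finset.sum_apply]

theorem prod_mem_subalgebra {J : Type*} (s : Finset J) {f : J → X → ℝ} (hf : ∀ j ∈ s, f j ∈ S) :
    (fun x => ∏ j ∈ s, f j x) ∈ S := by
  have := S.prod_mem hf
  convert this using 1
  ext x
  rw [Finset.prod_apply]

theorem dotProduct_mem_subalgebra {J : Type*} [Fintype J] {f g : X → J → ℝ}
    (hf : ∀ j, (fun x => f x j) ∈ S) (hg : ∀ j, (fun x => g x j) ∈ S) :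
    (fun x => f x ⬝ᵥ g x) ∈ S :=
  sum_mem_subalgebra S univ fun j _ => S.mul_mem (hf j) (hg j)

theorem det_mem_subalgebra {J : Type*} [Fintype J] [DecidableEq J] {A : X → Matrix J J ℝ}
    (hA : ∀ i j, (fun x => A x i j) ∈ S) : (fun x => (A x).det) ∈ S := by
  simp only [Matrix.det_apply']
  exact sum_mem_subalgebra S univ fun σ _ => S.mul_mem
    (S.algebraMap_mem ((Equiv.Perm.sign σ : ℤ) : ℝ)) (prod_mem_subalgebra S univ fun i _ => hA _ _)

end Subalgebras

theorem mem_polynomialFunctions {ι κ : Type*} {f : (ι → κ → ℝ) → ℝ} :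
    f ∈ polynomialFunctions ι κ ↔
      ∃ p : MvPolynomial (ι × κ) ℝ, ∀ x, MvPolynomial.eval (fun a => x a.1 a.2) p = f x := by
  have h : ∀ (p : MvPolynomial (ι × κ) ℝ) (x : ι → κ → ℝ),
      MvPolynomial.aeval (fun (a : ι × κ) (x : ι → κ → ℝ) => x a.1 a.2) p x =
        MvPolynomial.eval (fun a => x a.1 a.2) p := by
    intro p x
    induction p using MvPolynomial.induction_on with
    | C c => simp
    | add p q hp hq => simp [hp, hq]
    | mul_X p a hp => simp [hp]
  constructor
  · rintro ⟨p, rfl⟩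
    exact ⟨p, fun x => (h p x).symm⟩
  · rintro ⟨p, hp⟩
    exact ⟨p, funext fun x => (h p x).trans (hp x)⟩

theorem coordinate_mem_polynomialFunctions {ι κ : Type*} (i : ι) (k : κ) :
    (fun x : ι → κ → ℝ => x i k) ∈ polynomialFunctions ι κ :=
  mem_polynomialFunctions.2 ⟨MvPolynomial.X (i, k), fun x => by simp⟩

section Lines

variable {X : Type*} [AddCommGroup X] [Module ℝ X]

theorem linear_mem_lineFunctions (L : X →ₗ[ℝ] ℝ) : (fun x => L x) ∈ lineFunctions X :=
  fun x y => ⟨Polynomial.C (L x) + Polynomial.C (L y) * Polynomial.X, fun t => by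
    rw [show (fun x => L x) (x + t • y) = L x + t * L y by simp, Polynomial.eval_add,
      Polynomial.eval_mul,
      Polynomial.eval_C, Polynomial.eval_C, Polynomial.eval_X, mul_comm]⟩

/-- On the line joining a good point of one function to a good point for the product of the others,
both restrict to nonzero polynomials, whose product is nonzero somewhere. -/
theorem exists_forall_ne_zero {J : Type*} (s : Finset J) {f : J → X → ℝ}
    (hf : ∀ j ∈ s, f j ∈ lineFunctions X) (hne : ∀ j ∈ s, ∃ x, f j x ≠ 0) :
    ∃ x, ∀ j ∈ s, f j x ≠ 0 := by
  classical
  suffices h : ∃ x, ∏ j ∈ s, f j x ≠ 0 by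
    obtain ⟨x, hx⟩ := h
    exact ⟨x, Finset.prod_ne_zero_iff.1 hx⟩
  induction s using Finset.induction_on with
  | empty => exact ⟨0, by simp⟩
  | insert j s hj ih =>
    obtain ⟨y, hy⟩ := ih (fun i hi => hf i (Finset.mem_insert_of_mem hi))
      (fun i hi => hne i (Finset.mem_insert_of_mem hi))
    obtain ⟨x, hx⟩ := hne j (Finset.mem_insert_self j s)
    obtain ⟨P, hP⟩ := hf j (Finset.mem_insert_self j s) x (y - x)
    obtain ⟨Q, hQ⟩ := prod_mem_subalgebra (lineFunctions X) s
      (fun i hi => hf i (Finset.mem_insert_of_mem hi)) x (y - x)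
    have hP0 : P ≠ 0 := by
      rintro rfl
      have := hP 0
      rw [zero_smul, add_zero, Polynomial.eval_zero] at this
      exact hx this
    have hQ0 : Q ≠ 0 := by
      rintro rfl
      have := hQ 1
      rw [one_smul, add_sub_cancel, Polynomial.eval_zero] at this
      exact hy this
    obtain ⟨t, ht⟩ : ∃ t, (P * Q).eval t ≠ 0 := by
      by_contra! hc
      exact mul_ne_zero hP0 hQ0 (Polynomial.funext fun t => by rw [hc, Polynomial.eval_zero])
    refine ⟨x + t • (y - x), ?_⟩
    rw [Finset.prod_insert hj, hP, show ∏ i ∈ s, f i (x + t • (y - x)) = _ from hQ t,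
      ← Polynomial.eval_mul]
    exact ht

variable [TopologicalSpace X] [ContinuousAdd X] [ContinuousSMul ℝ X]

/-- On the line from `x` to `x₀` the function is a nonzero polynomial, so its finitely many roots
leave good points arbitrarily close to `x`. -/
theorem frequently_ne_zero {f : X → ℝ} (hf : f ∈ lineFunctions X) {x₀ : X} (h₀ : f x₀ ≠ 0)
    (x : X) : ∃ᶠ y in 𝓝 x, f y ≠ 0 := by
  obtain ⟨P, hP⟩ := hf x (x₀ - x)
  have hP0 : P ≠ 0 := by
    rintro rfl
    have := hP 1
    rw [one_smul, add_sub_cancel, Polynomial.eval_zero] at this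
    exact h₀ this
  have hcont : Filter.Tendsto (fun t : ℝ => x + t • (x₀ - x)) (𝓝[≠] 0) (𝓝 x) := by
    have : Continuous fun t : ℝ => x + t • (x₀ - x) :=
      continuous_const.add (continuous_id.smul continuous_const)
    simpa using (this.tendsto 0).mono_left nhdsWithin_le_nhds
  refine hcont.frequently (Filter.Eventually.frequently ?_)
  have hfin : {t : ℝ | P.IsRoot t}.Finite := by
    by_contra hc
    exact hP0 (Polynomial.eq_zero_of_infinite_isRoot P hc)
  filter_upwards [nhdsNE_le_cofinite _ hfin.compl_mem_cofinite] with t ht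
  rw [hP]
  exact ht

/-- The points of a polynomial family at which a given polynomial does not vanish are dense. -/
theorem mem_closure_of_eval_ne_zero {ι κ : Type*} {f : X → ι → κ → ℝ} (hc : Continuous f)
    (hf : ∀ i k, (fun x => f x i k) ∈ lineFunctions X) (p : MvPolynomial (ι × κ) ℝ)
    {C : Set (ι → κ → ℝ)}
    (hC : ∀ x, MvPolynomial.eval (fun a => f x a.1 a.2) p ≠ 0 → f x ∈ C) {x₀ : X}
    (h₀ : MvPolynomial.eval (fun a => f x₀ a.1 a.2) p ≠ 0) (x : X) :
    f x ∈ closure {q ∈ C | MvPolynomial.eval (fun a => q a.1 a.2) p ≠ 0} := by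
  have hp : (fun x => MvPolynomial.eval (fun a : ι × κ => f x a.1 a.2) p) ∈ lineFunctions X :=
    eval_mem_subalgebra (lineFunctions X) (g := fun x (a : ι × κ) => f x a.1 a.2)
      (fun a => hf a.1 a.2) p
  have hfr := frequently_ne_zero hp h₀ x
  exact mem_closure_iff_frequently.2 (hc.continuousAt.tendsto.frequently
    (hfr.mono fun y hy => ⟨hC y hy, hy⟩))

end Lines

/-! ### Gram determinants -/

/-- The Gram matrix `A Aᵀ` of a real matrix has the rank of `A`. Independence of a family thus
becomes one polynomial condition. -/
theorem gram_det_ne_zero_iff {I J : Type*} [Fintype I] [Fintype J] [DecidableEq I]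
    (x : I → J → ℝ) :
    (Matrix.of fun i i' => x i ⬝ᵥ x i').det ≠ 0 ↔ LinearIndependent ℝ x := by
  have h1 : (Matrix.of fun i i' => x i ⬝ᵥ x i') = Matrix.of x * (Matrix.of x)ᵀ := by
    ext i j
    simp [Matrix.mul_apply, dotProduct]
  rw [h1, ← isUnit_iff_ne_zero, ← Matrix.isUnit_iff_isUnit_det,
    ← Matrix.linearIndependent_rows_iff_isUnit, linearIndependent_iff_card_eq_finrank_span,
    linearIndependent_iff_card_eq_finrank_span, Set.finrank, Set.finrank,
    ← Matrix.rank_eq_finrank_span_row, Matrix.rank_self_mul_transpose,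
    Matrix.rank_eq_finrank_span_row]
  rfl

theorem span_range_eq_top_iff {I J : Type*} [Fintype I] [Fintype J] (x : J → I → ℝ) :
    Submodule.span ℝ (Set.range x) = ⊤ ↔ LinearIndependent ℝ fun i j => x j i := by
  rw [linearIndependent_iff_card_eq_finrank_span, Set.finrank]
  have h1 : Module.finrank ℝ (Submodule.span ℝ (Set.range fun i j => x j i)) =
      Module.finrank ℝ (Submodule.span ℝ (Set.range x)) := by
    have h := (Matrix.rank_eq_finrank_span_row (Matrix.of fun i j => x j i)).symm.trans
      (Matrix.rank_eq_finrank_span_cols (Matrix.of fun i j => x j i))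
    exact h
  rw [h1]
  constructor
  · intro h
    rw [h, finrank_top, Module.finrank_fintype_fun_eq_card]
  · intro h
    exact Submodule.eq_top_of_finrank_eq (by rw [← h, Module.finrank_fintype_fun_eq_card])

end Polynomials

/-! ### Generic rods carry independent bars -/

section Existence

open Topology

section Subalgebras

variable {X : Type*} (S : Subalgebra ℝ (X → ℝ)) {d : ℕ}

theorem wedge_mem_subalgebra {k : ℕ} {M : X → Fin k → Fin (d + 1) → ℝ}
    (hM : ∀ i j, (fun x => M x i j) ∈ S) (s : Set.powersetCard (Fin (d + 1)) k) :
    (fun x => wedge (M x) s) ∈ S :=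
  det_mem_subalgebra S fun _ _ => hM _ _

theorem coform_mem_subalgebra {r : X → Ext d (d - 1)} (hr : ∀ s, (fun x => r x s) ∈ S)
    (s : Set.powersetCard (Fin (d + 1)) 2) : (fun x => coform d (r x) s) ∈ S :=
  S.mul_mem (S.algebraMap_mem ((-1) ^ (∑ i ∈ (s : Finset (Fin (d + 1))), (i : ℕ)))) (hr _)

theorem bivector_mem_subalgebra {a b : X → Fin (d + 1) → ℝ} (ha : ∀ i, (fun x => a x i) ∈ S)
    (hb : ∀ i, (fun x => b x i) ∈ S) (s : Set.powersetCard (Fin (d + 1)) 2) :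
    (fun x => bivector d (a x) (b x) s) ∈ S :=
  S.sub_mem (S.mul_mem (ha _) (hb _)) (S.mul_mem (ha _) (hb _))

theorem radicalGenerator_mem_subalgebra {φ : X → Ext d 2} (hφ : ∀ s, (fun x => φ x s) ∈ S)
    (i : Fin (d + 1) × Fin (d + 1) × Fin (d + 1)) (j : Fin (d + 1)) :
    (fun x => radicalGenerator (φ x) i j) ∈ S := by
  have h : ∀ a b : Fin (d + 1) → ℝ, (fun x => form (φ x) a b) ∈ S := fun a b =>
    dotProduct_mem_subalgebra S (fun s => S.algebraMap_mem (bivector d a b s)) hφ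
  exact S.add_mem (S.add_mem (S.mul_mem (h _ _) (S.algebraMap_mem _))
    (S.mul_mem (h _ _) (S.algebraMap_mem _))) (S.mul_mem (h _ _) (S.algebraMap_mem _))

end Subalgebras

variable {V : Type*} {d : ℕ}

/-- The generators of the radicals of two forms. -/
noncomputable def radicalGenerators (φ φ' : Ext d 2) :
    (Fin (d + 1) × Fin (d + 1) × Fin (d + 1)) ⊕ (Fin (d + 1) × Fin (d + 1) × Fin (d + 1)) →
      Fin (d + 1) → ℝ :=
  Sum.elim (radicalGenerator φ) (radicalGenerator φ')

/-- A Gram determinant that vanishes unless the radicals of two forms of rank two span `W`. -/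
noncomputable def radicalDet (φ φ' : Ext d 2) : ℝ :=
  (Matrix.of fun i i' => (fun j => radicalGenerators φ φ' j i) ⬝ᵥ
    fun j => radicalGenerators φ φ' j i').det

theorem radicalDet_mem_subalgebra {X : Type*} (S : Subalgebra ℝ (X → ℝ)) {φ φ' : X → Ext d 2}
    (hφ : ∀ s, (fun x => φ x s) ∈ S) (hφ' : ∀ s, (fun x => φ' x s) ∈ S) :
    (fun x => radicalDet (φ x) (φ' x)) ∈ S := by
  have h : ∀ j i, (fun x => radicalGenerators (φ x) (φ' x) j i) ∈ S := by
    rintro (j | j) i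
    · exact radicalGenerator_mem_subalgebra S hφ j i
    · exact radicalGenerator_mem_subalgebra S hφ' j i
  exact det_mem_subalgebra S fun i i' => dotProduct_mem_subalgebra S (fun j => h j i)
    (fun j => h j i')

/-- The Gram matrix is that of the coordinate rows of the generators; row rank equals column rank,
so it detects spanning rather than independence. -/
theorem radicalDet_ne_zero_iff {φ φ' : Ext d 2} : radicalDet φ φ' ≠ 0 ↔
    Submodule.span ℝ (Set.range (radicalGenerator φ)) ⊔
      Submodule.span ℝ (Set.range (radicalGenerator φ')) = ⊤ := by
  rw [radicalDet, gram_det_ne_zero_iff, ← span_range_eq_top_iff, radicalGenerators,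
    Set.Sum.elim_range, Submodule.span_union]

theorem radical_sup_eq_top {φ φ' : Ext d 2} (h : RankTwo φ) (h' : RankTwo φ')
    (hdet : radicalDet φ φ' ≠ 0) : radical φ ⊔ radical φ' = ⊤ := by
  rw [radicalDet_ne_zero_iff] at hdet
  rw [eq_top_iff, ← hdet]
  refine sup_le_sup (Submodule.span_le.2 ?_) (Submodule.span_le.2 ?_)
  · rintro _ ⟨i, rfl⟩
    exact h _ _ _
  · rintro _ ⟨i, rfl⟩
    exact h' _ _ _

/-! Points on the moment curve -/

theorem linearIndependent_moments {k : ℕ} {τ : Fin k → ℝ} (hτ : Function.Injective τ) :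
    LinearIndependent ℝ fun (i : Fin k) (j : Fin k) => τ i ^ (j : ℕ) := by
  have h : IsUnit (Matrix.vandermonde τ) := by
    rw [Matrix.isUnit_iff_isUnit_det, isUnit_iff_ne_zero]
    exact Matrix.det_vandermonde_ne_zero_iff.2 hτ
  exact Matrix.linearIndependent_rows_iff_isUnit.2 h

/-- The parameters `-1` and `-2` differ from all `τ i ≥ 0`, so together they give an invertible
Vandermonde matrix, and the form is nonzero on the two added points. -/
theorem coform_wedge_moments_ne_zero (hd : 1 ≤ d) {τ : Fin (d - 1) → ℝ}
    (hτ : Function.Injective τ) (hpos : ∀ i, 0 ≤ τ i) :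
    coform d (wedge fun i j => τ i ^ (j : ℕ)) ≠ 0 := by
  obtain ⟨n, rfl⟩ : ∃ n, d = n + 1 := ⟨d - 1, by omega⟩
  change Fin n → ℝ at τ
  change ∀ i : Fin n, 0 ≤ τ i at hpos
  intro h0
  have hinj : Function.Injective (vecCons (-1) (vecCons (-2) τ) : Fin (n + 2) → ℝ) := by
    have hneg : ∀ c : ℝ, c < 0 → c ∉ Set.range τ := by
      rintro c hc ⟨i, rfl⟩
      exact absurd (hpos i) (by linarith)
    refine Fin.cons_injective_iff.2 ⟨?_, Fin.cons_injective_iff.2 ⟨hneg _ (by norm_num), hτ⟩⟩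
    change _ ∉ Set.range (vecCons (-2) τ)
    rw [Matrix.range_cons, Set.singleton_union, Set.mem_insert_iff, not_or]
    exact ⟨by norm_num, hneg _ (by norm_num)⟩
  have hli := linearIndependent_moments hinj
  have h1 : (form (coform (n + 1) (wedge (d := n + 1) (k := n) fun i j => τ i ^ (j : ℕ))))
      (fun j => (-1) ^ (j : ℕ)) (fun j => (-2) ^ (j : ℕ)) ≠ 0 := by
    rw [form_coform_wedge_ne_zero_iff]
    convert hli using 1
    ext i j
    refine Fin.cases ?_ (fun i => ?_) i
    · simp
    · refine Fin.cases ?_ (fun i => ?_) i <;> simp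
  apply h1
  have h2 : coform (n + 1) (wedge (d := n + 1) (k := n) fun i j => τ i ^ (j : ℕ)) = 0 := h0
  rw [h2, form_apply, dotProduct_zero]

/-- The forms of the rods `wedge (M v)`, for `v ∈ R`, and the zero form for the bodies. -/
noncomputable def rodForm (R : Set V) (v : V) (M : Fin (d - 1) → Fin (d + 1) → ℝ) : Ext d 2 :=
  open Classical in if v ∈ R then coform d (wedge M) else 0

theorem rodForm_of_mem {R : Set V} {v : V} (h : v ∈ R) (M : Fin (d - 1) → Fin (d + 1) → ℝ) :
    rodForm R v M = coform d (wedge M) := if_pos h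

theorem rodForm_of_notMem {R : Set V} {v : V} (h : v ∉ R) (M : Fin (d - 1) → Fin (d + 1) → ℝ) :
    rodForm R v M = 0 := if_neg h

theorem rankTwo_rodForm (hd : 1 ≤ d) (R : Set V) (v : V) (M : Fin (d - 1) → Fin (d + 1) → ℝ) :
    RankTwo (rodForm R v M) := by
  by_cases h : v ∈ R
  · rw [rodForm_of_mem h]
    exact rankTwo_coform_wedge M hd
  · rw [rodForm_of_notMem h]
    exact rankTwo_zero

theorem rodForm_mem_subalgebra {X : Type*} (S : Subalgebra ℝ (X → ℝ)) (R : Set V) (v : V)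
    {M : X → Fin (d - 1) → Fin (d + 1) → ℝ} (hM : ∀ i j, (fun x => M x i j) ∈ S)
    (s : Set.powersetCard (Fin (d + 1)) 2) : (fun x => rodForm R v (M x) s) ∈ S := by
  by_cases h : v ∈ R
  · simp only [rodForm_of_mem h]
    exact coform_mem_subalgebra S (wedge_mem_subalgebra S hM) s
  · simp only [rodForm_of_notMem h]
    exact S.zero_mem

/-- Rods spanned by points of the moment curve are in general position. -/
theorem exists_rods_in_general_position [Finite V] (hd : 3 ≤ d) (R : Set V) :
    ∃ M : V → Fin (d - 1) → Fin (d + 1) → ℝ, (∀ v ∈ R, rodForm R v (M v) ≠ 0) ∧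
      ∀ u ∈ R, ∀ v ∈ R, u ≠ v → radicalDet (rodForm R u (M u)) (rodForm R v (M v)) ≠ 0 := by
  have := Fintype.ofFinite V
  -- Distinct nonnegative parameters for all points of all rods together.
  let τ : V × Fin (d - 1) → ℝ := fun p => ((Fintype.equivFin (V × Fin (d - 1)) p : ℕ) : ℝ)
  have hτ : Function.Injective τ := fun p q h =>
    (Fintype.equivFin (V × Fin (d - 1))).injective (Fin.ext (Nat.cast_injective h))
  have hne : ∀ v ∈ R, rodForm R v (fun i j => τ (v, i) ^ (j : ℕ)) ≠ 0 := fun v hv => by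
    rw [rodForm_of_mem hv]
    exact coform_wedge_moments_ne_zero (by omega) (fun i j h => (Prod.mk.inj (hτ h)).2)
      (fun i => Nat.cast_nonneg _)
  refine ⟨fun v i j => τ (v, i) ^ (j : ℕ), hne, fun u hu v hv huv => ?_⟩
  rw [radicalDet_ne_zero_iff, span_radicalGenerator (rankTwo_rodForm (by omega) _ _ _) (hne u hu),
    span_radicalGenerator (rankTwo_rodForm (by omega) _ _ _) (hne v hv), rodForm_of_mem hu,
    rodForm_of_mem hv, eq_top_iff]
  -- Two rods carry `2(d - 1)` points, which is at least `d + 1` because `d ≥ 3`; any `d + 1` of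
  -- them form a basis.
  obtain ⟨g⟩ : Nonempty (Fin (d + 1) ↪ Fin (d - 1) ⊕ Fin (d - 1)) :=
    Function.Embedding.nonempty_of_card_le (by
      simp only [Fintype.card_fin, Fintype.card_sum]
      omega)
  let f : Fin (d - 1) ⊕ Fin (d - 1) → V × Fin (d - 1) := Sum.elim (fun i => (u, i)) (fun i => (v, i))
  have hf : Function.Injective f := by
    rintro (i | i) (j | j) h <;> simp only [f, Sum.elim_inl, Sum.elim_inr, Prod.mk.injEq] at h
    · rw [h.2]
    · exact absurd h.1 huv
    · exact absurd h.1.symm huv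
    · rw [h.2]
  have hli := linearIndependent_moments (hτ.comp (hf.comp g.injective))
  rw [← hli.span_eq_top_of_card_eq_finrank (by simp), Submodule.span_le]
  rintro _ ⟨k, rfl⟩
  simp only [Function.comp_apply]
  rcases g k with i | i
  · exact Submodule.mem_sup_left (mem_radical_coform_wedge (fun i j => τ (u, i) ^ (j : ℕ))
      (by omega) i)
  · exact Submodule.mem_sup_right (mem_radical_coform_wedge (fun i j => τ (v, i) ^ (j : ℕ))
      (by omega) i)

/-- At the coordinate rod complementary to an index `s` with `q s ≠ 0` the value is `± q s`, so this
polynomial in `M'` is not identically zero. -/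
theorem frequently_dotProduct_coform_wedge_ne_zero (hd : 1 ≤ d)
    (M : Fin (d - 1) → Fin (d + 1) → ℝ) {q : Ext d 2} (hq : q ≠ 0) :
    ∃ᶠ M' in 𝓝 M, q ⬝ᵥ coform d (wedge M') ≠ 0 := by
  obtain ⟨s, hs⟩ := Function.ne_iff.1 hq
  have hsc : (s : Finset (Fin (d + 1)))ᶜ ∈ Set.powersetCard (Fin (d + 1)) (d - 1) := by
    change (s : Finset (Fin (d + 1)))ᶜ.card = d - 1
    rw [Finset.card_compl, s.2, Fintype.card_fin]
    omega
  refine frequently_ne_zero (x₀ := fun i => Pi.single (Set.powersetCard.ofFinEmbEquiv.symm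
    (⟨_, hsc⟩ : Set.powersetCard (Fin (d + 1)) (d - 1)) i) 1) ?_ ?_ M
  · refine dotProduct_mem_subalgebra _ (fun s => Subalgebra.algebraMap_mem _ (q s))
      (coform_mem_subalgebra _ (wedge_mem_subalgebra _ fun i j => ?_))
    exact linear_mem_lineFunctions ((LinearMap.proj j : (Fin (d + 1) → ℝ) →ₗ[ℝ] ℝ) ∘ₗ
      (LinearMap.proj i : (Fin (d - 1) → Fin (d + 1) → ℝ) →ₗ[ℝ] _))
  · rw [wedge_single, dotProduct, Finset.sum_eq_single s]
    · refine mul_ne_zero hs ?_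
      simp only [coform, LinearMap.coe_mk, AddHom.coe_mk, Pi.single_eq_same, mul_one]
      exact pow_ne_zero _ (by norm_num)
    · intro s' _ hs'
      simp only [coform, LinearMap.coe_mk, AddHom.coe_mk]
      rw [Pi.single_eq_of_ne, mul_zero, mul_zero]
      intro h
      exact hs' (Subtype.ext (compl_injective (congrArg Subtype.val h)))
    · simp

theorem card_ext (d : ℕ) : Fintype.card (Set.powersetCard (Fin (d + 1)) 2) = (d + 1).choose 2 := by
  rw [← Nat.card_eq_fintype_card, Set.powersetCard.card, Nat.card_eq_fintype_card,
    Fintype.card_fin]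

/-! ### Rows of the rigidity matrix and witnesses for sparse edge sets. -/

variable [Fintype V] {E : Type*} (t h : E → V)

/-- The row of the rigidity matrix of an edge with bar `q`. -/
noncomputable def edgeRow (q : E → Ext d 2) (e : E) : V → Ext d 2 :=
  open Classical in Pi.single (t e) (q e) - Pi.single (h e) (q e)

theorem sum_edgeRow_dotProduct (q : E → Ext d 2) (e : E) (m : V → Ext d 2) :
    ∑ v, edgeRow t h q e v ⬝ᵥ m v = q e ⬝ᵥ (m (t e) - m (h e)) := by
  classical
  have hs : ∀ w, ∑ v, (Pi.single w (q e) : V → Ext d 2) v ⬝ᵥ m v = q e ⬝ᵥ m w := fun w => by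
    rw [Finset.sum_eq_single w]
    · rw [Pi.single_eq_same]
    · intro v _ hv
      rw [Pi.single_eq_of_ne hv, zero_dotProduct]
    · simp
  rw [dotProduct_sub, ← hs, ← hs, ← Finset.sum_sub_distrib]
  refine Finset.sum_congr rfl fun v _ => ?_
  rw [edgeRow, Pi.sub_apply, sub_dotProduct]

/-- There are rods for which each sparse set of edges has independent bars. -/
theorem exists_rods_with_independent_bars [Finite E] (hd : 3 ≤ d) (R : Set V) (hth : ∀ e, t e ≠ h e) :
    ∃ M : V → Fin (d - 1) → Fin (d + 1) → ℝ, (∀ v ∈ R, rodForm R v (M v) ≠ 0) ∧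
      (∀ u ∈ R, ∀ v ∈ R, u ≠ v → radicalDet (rodForm R u (M u)) (rodForm R v (M v)) ≠ 0) ∧
      ∀ I : Set E, (∀ F ⊆ I, F.Nonempty → F.ncard + (d + 1).choose 2 + (endSet t h F ∩ R).ncard ≤
        (d + 1).choose 2 * (endSet t h F).ncard) →
        ∃ a b : E → Fin (d + 1) → ℝ, (∀ e, a e ∈ radical (rodForm R (t e) (M (t e)))) ∧
          (∀ e, b e ∈ radical (rodForm R (h e) (M (h e)))) ∧
          LinearIndepOn ℝ (edgeRow t h fun e => bivector d (a e) (b e)) I := by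
  classical
  have := Fintype.ofFinite E
  let O : Set (V → Fin (d - 1) → Fin (d + 1) → ℝ) := {M | (∀ v ∈ R, rodForm R v (M v) ≠ 0) ∧
      ∀ u ∈ R, ∀ v ∈ R, u ≠ v → radicalDet (rodForm R u (M u)) (rodForm R v (M v)) ≠ 0}
  let C := continuousSubalgebra (α := V → Fin (d - 1) → Fin (d + 1) → ℝ) (R := ℝ) (A := ℝ)
  have hC : ∀ v s, (fun M : V → Fin (d - 1) → Fin (d + 1) → ℝ => rodForm R v (M v) s) ∈ C :=
    fun v => rodForm_mem_subalgebra C R v fun i j =>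
      show Continuous fun M : V → Fin (d - 1) → Fin (d + 1) → ℝ => M v i j by fun_prop
  have hO : IsOpen O := by
    have h1 : O = (⋂ v ∈ R, {M | rodForm R v (M v) ≠ 0}) ∩ ⋂ u ∈ R, ⋂ v ∈ R, ⋂ (_ : u ≠ v),
        {M | radicalDet (rodForm R u (M u)) (rodForm R v (M v)) ≠ 0} := by
      ext M
      simp [O]
    rw [h1]
    refine IsOpen.inter ?_ ?_
    · refine (Set.toFinite _).isOpen_biInter fun v _ => ?_
      refine isOpen_ne_fun (continuous_pi fun s => hC v s) continuous_const
    · refine (Set.toFinite _).isOpen_biInter fun u _ => (Set.toFinite _).isOpen_biInter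
        fun v _ => isOpen_iInter_of_finite fun _ => ?_
      exact isOpen_ne_fun (radicalDet_mem_subalgebra C (hC u) (hC v)) continuous_const
  obtain ⟨M, hM, hgen⟩ := exists_rodsGeneric t h R (fun v M => rodForm (d := d) R v M)
    (fun v => continuous_pi fun s => rodForm_mem_subalgebra (continuousSubalgebra
      (α := Fin (d - 1) → Fin (d + 1) → ℝ) (R := ℝ) (A := ℝ)) R v (fun i j =>
      show Continuous fun M : Fin (d - 1) → Fin (d + 1) → ℝ => M i j by fun_prop) s)
    (fun v hv M => rodForm_of_notMem hv M)
    (fun v hv M q hq => by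
      simp only [rodForm_of_mem hv]
      exact frequently_dotProduct_coform_wedge_ne_zero (by omega) M hq)
    hO (exists_rods_in_general_position hd R) (fun p hp => hp.1)
  refine ⟨M, hM.1, hM.2, fun I hI => ?_⟩
  set φ : V → Ext d 2 := fun v => rodForm R v (M v) with hφ
  have hrank : ∀ v, RankTwo (φ v) := fun v => rankTwo_rodForm (by omega) _ _ _
  have hsup : ∀ u v, u ≠ v → radical (φ u) ⊔ radical (φ v) = ⊤ := by
    intro u v huv
    by_cases hu : u ∈ R
    · by_cases hv : v ∈ R
      · exact radical_sup_eq_top (hrank u) (hrank v) (hM.2 u hu v hv huv)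
      · rw [radical_eq_top_iff.2 (show φ v = 0 from rodForm_of_notMem hv _), sup_top_eq]
    · rw [radical_eq_top_iff.2 (show φ u = 0 from rodForm_of_notMem hu _), top_sup_eq]
  have hφR : {v | φ v ≠ 0} = R := by
    ext v
    exact ⟨fun hv => by_contra fun hc => hv (rodForm_of_notMem hc _), fun hv => hM.1 v hv⟩
  let Z : E → Set (V → Ext d 2) := fun e => {z | ∃ a ∈ radical (φ (t e)), ∃ b ∈ radical (φ (h e)),
    z = edgeRow t h (fun _ => bivector d a b) e}
  -- Rado's condition for each `F ⊆ I` is the rank bound for generic rods, applied to the span of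
  -- the rows available to `F`.
  obtain ⟨z, hz, hli⟩ := exists_linearIndepOn_of_card_le_finrank Z I (by
    intro F hF
    refine card_le_finrank_of_rodsGeneric t h ?_ F φ _ ?_ (hgen F) ?_
    · rw [card_ext]
      calc 4 ≤ (3 + 1).choose 2 := by decide
        _ ≤ (d + 1).choose 2 := Nat.choose_le_choose 2 (by omega)
    · intro m hm e he
      obtain ⟨α, β, hαβ⟩ := exists_eq_add_of_form_eq_zero (hrank (t e)) (hrank (h e))
        (hsup _ _ (hth e)) (ψ := m (t e) - m (h e)) (fun a ha b hb => by
          rw [form_apply, ← sum_edgeRow_dotProduct t h (fun _ => bivector d a b) e m]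
          exact hm _ (Submodule.subset_span (Set.mem_biUnion he ⟨a, ha, b, hb, rfl⟩)))
      exact ⟨α, β, hαβ⟩
    · intro F' hF' hne
      rw [card_ext, hφR]
      exact hI F' (hF'.trans hF) hne)
  have hz' : ∀ e, ∃ a b, a ∈ radical (φ (t e)) ∧ b ∈ radical (φ (h e)) ∧
      (e ∈ I → z e = edgeRow t h (fun _ => bivector d a b) e) := by
    intro e
    by_cases he : e ∈ I
    · obtain ⟨a, ha, b, hb, hzab⟩ := hz e he
      exact ⟨a, b, ha, hb, fun _ => hzab⟩
    -- Edges outside `I` play no role; zero points are a harmless default.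
    · exact ⟨0, 0, Submodule.zero_mem _, Submodule.zero_mem _, fun h => absurd h he⟩
  choose a b ha hb hzab using hz'
  refine ⟨a, b, ha, hb, ?_⟩
  exact hli.congr fun e he => hzab e he

end Existence

/-! ### Independent sets are sparse -/

section Necessity

variable {V E : Type*} {d : ℕ} (t h : E → V)

/-- The count condition for an independent set of edges. -/
def Sparse (d : ℕ) (R : Set V) (I : Set E) : Prop :=
  ∀ F ⊆ I, F.Nonempty → F.ncard + (d + 1).choose 2 + (endSet t h F ∩ R).ncard ≤
    (d + 1).choose 2 * (endSet t h F).ncard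

open Classical in
/-- The trivial motions of the vertices in `A`: a common motion, and a rotation about each rod. -/
noncomputable def trivialMotions (φ : V → Ext d 2) (A R : Set V) :
    (Ext d 2 × ((A ∩ R : Set V) → ℝ) × ((Aᶜ : Set V) → Ext d 2)) →ₗ[ℝ] (V → Ext d 2) where
  toFun x v := (x.1 + if hv : v ∈ A ∩ R then x.2.1 ⟨v, hv⟩ • φ v else 0) +
    if hv : v ∈ Aᶜ then x.2.2 ⟨v, hv⟩ else 0
  map_add' x y := by
    ext v s
    simp only [Prod.fst_add, Prod.snd_add, Pi.add_apply]
    split_ifs <;> simp only [Pi.add_apply, Pi.smul_apply, Pi.zero_apply, smul_eq_mul] <;> ring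
  map_smul' c x := by
    ext v s
    simp only [Prod.smul_fst, Prod.smul_snd, Pi.smul_apply, RingHom.id_apply]
    split_ifs <;> simp only [Pi.add_apply, Pi.smul_apply, Pi.zero_apply, smul_eq_mul] <;> ring

theorem exists_trivialMotions_eq (φ : V → Ext d 2) {A R : Set V} {v : V} (hv : v ∈ A)
    (x : Ext d 2 × ((A ∩ R : Set V) → ℝ) × ((Aᶜ : Set V) → Ext d 2)) :
    ∃ c : ℝ, trivialMotions φ A R x v = x.1 + c • φ v := by
  have hv' : v ∉ Aᶜ := fun h => h hv
  by_cases hR : v ∈ A ∩ R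
  · exact ⟨x.2.1 ⟨v, hR⟩, by simp [trivialMotions, hR, hv]⟩
  · exact ⟨0, by simp only [trivialMotions, LinearMap.coe_mk, AddHom.coe_mk, hR, hv', dite_false,
      zero_smul, add_zero]⟩

variable {t h}

/-- At `u` and `w` the common motion is a multiple of `φ u` and of `φ w`. As these are not
proportional unless `φ u = 0`, it vanishes, and then so do the remaining components one vertex at a
time. -/
theorem ker_trivialMotions {φ : V → Ext d 2} {A R : Set V} (hR : ∀ v ∈ R, φ v ≠ 0)
    {u w : V} (hu : u ∈ A) (hw : w ∈ A) (hne : ∀ c : ℝ, φ u = c • φ w → φ u = 0) :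
    LinearMap.ker (trivialMotions φ A R) = ⊥ := by
  rw [LinearMap.ker_eq_bot']
  rintro x hx
  have hx1 : x.1 = 0 := by
    obtain ⟨a, ha⟩ := exists_trivialMotions_eq φ hu x
    obtain ⟨b, hb⟩ := exists_trivialMotions_eq φ hw x
    rw [hx, Pi.zero_apply] at ha hb
    have hab : a • φ u = b • φ w := by
      have := ha.symm.trans hb
      exact add_left_cancel this
    by_cases ha0 : a = 0
    · rw [ha0, zero_smul, add_zero] at ha
      exact ha.symm
    · have h0 := hne (a⁻¹ * b) (by rw [mul_smul, ← hab, smul_smul, inv_mul_cancel₀ ha0, one_smul])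
      rw [h0, smul_zero, add_zero] at ha
      exact ha.symm
  refine Prod.ext hx1 (Prod.ext ?_ ?_)
  · funext ⟨v, hv⟩
    have h1 := congrFun hx v
    have hv' : v ∉ Aᶜ := fun h => h hv.1
    simp only [trivialMotions, LinearMap.coe_mk, AddHom.coe_mk, hx1, hv, hv', dite_true, dite_false,
      zero_add, add_zero, Pi.zero_apply] at h1
    exact (smul_eq_zero.1 h1).resolve_right (hR v hv.2)
  · funext ⟨v, hv⟩
    have h1 := congrFun hx v
    have hv' : v ∉ A ∩ R := fun h => hv h.1
    simp only [trivialMotions, LinearMap.coe_mk, AddHom.coe_mk, hx1, hv, hv', dite_true,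
      dite_false, zero_add, add_zero, Pi.zero_apply] at h1
    exact h1

/-- The trivial motions form a space of dimension `D + |A ∩ R| + D |Aᶜ|` orthogonal to the
`|F|`-dimensional row space; together the two dimensions are at most `D |V|`. -/
theorem card_le_of_linearIndepOn_edgeRow [Fintype V] [Finite E] {φ : V → Ext d 2} {R : Set V}
    (hR : ∀ v, v ∈ R ↔ φ v ≠ 0) (hne : ∀ u v, u ≠ v → ∀ c : ℝ, φ u = c • φ v → φ u = 0)
    (hth : ∀ e, t e ≠ h e) {q : E → Ext d 2} (hqt : ∀ e, q e ⬝ᵥ φ (t e) = 0)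
    (hqh : ∀ e, q e ⬝ᵥ φ (h e) = 0) {F : Set E} (hF : F.Nonempty)
    (hli : LinearIndepOn ℝ (edgeRow t h q) F) :
    F.ncard + (d + 1).choose 2 + (endSet t h F ∩ R).ncard ≤
      (d + 1).choose 2 * (endSet t h F).ncard := by
  classical
  set A := endSet t h F with hA
  obtain ⟨e₀, he₀⟩ := hF
  have hker := ker_trivialMotions (φ := φ) (A := A) (R := R) (fun v hv => (hR v).1 hv)
    (show t e₀ ∈ A from ⟨e₀, he₀, Or.inl rfl⟩) (show h e₀ ∈ A from ⟨e₀, he₀, Or.inr rfl⟩)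
    (hne _ _ (hth e₀))
  have hN := LinearMap.finrank_range_of_inj (LinearMap.ker_eq_bot.1 hker)
  have hX : Module.finrank ℝ (Submodule.span ℝ (edgeRow t h q '' F)) = F.ncard := by
    have : Fintype F := Fintype.ofFinite F
    have h1 := finrank_span_eq_card (R := ℝ) (b := fun e : F => edgeRow t h q e) hli
    rw [← Nat.card_eq_fintype_card, Nat.card_coe_set_eq] at h1
    rw [← h1, Set.image_eq_range]
  have horth : ∀ x ∈ Submodule.span ℝ (edgeRow t h q '' F),
      ∀ m ∈ LinearMap.range (trivialMotions φ A R), ∑ v, x v ⬝ᵥ m v = 0 := by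
    rintro x hx _ ⟨y, rfl⟩
    induction hx using Submodule.span_induction with
    | mem x hx =>
      obtain ⟨e, he, rfl⟩ := hx
      obtain ⟨a, ha⟩ := exists_trivialMotions_eq φ (show t e ∈ A from ⟨e, he, Or.inl rfl⟩) y
      obtain ⟨b, hb⟩ := exists_trivialMotions_eq φ (show h e ∈ A from ⟨e, he, Or.inr rfl⟩) y
      rw [sum_edgeRow_dotProduct, ha, hb, add_sub_add_left_eq_sub, dotProduct_sub, dotProduct_smul,
        dotProduct_smul, hqt, hqh, smul_zero, smul_zero, sub_zero]
    | zero => simp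
    | add x x' _ _ hx hx' =>
      simp only [Pi.add_apply, add_dotProduct, Finset.sum_add_distrib]
      rw [hx, hx', add_zero]
    | smul c x _ hx =>
      simp only [Pi.smul_apply, smul_dotProduct, ← Finset.smul_sum]
      rw [hx, smul_zero]
  have hdisj : Disjoint (Submodule.span ℝ (edgeRow t h q '' F))
      (LinearMap.range (trivialMotions φ A R)) := by
    rw [Submodule.disjoint_def]
    intro x hx hx'
    have h1 := horth x hx x hx'
    have hnn : ∀ v ∈ univ, 0 ≤ x v ⬝ᵥ x v := fun v _ =>
      Finset.sum_nonneg fun s _ => mul_self_nonneg _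
    funext v
    exact dotProduct_self_eq_zero.1 ((Finset.sum_eq_zero_iff_of_nonneg hnn).1 h1 v (mem_univ v))
  have hle := Submodule.finrank_add_finrank_le_of_disjoint hdisj
  have hext : Module.finrank ℝ (Ext d 2) = (d + 1).choose 2 := by
    rw [Module.finrank_pi, card_ext]
  have hpi : ∀ (U : Type _) [Fintype U], Module.finrank ℝ (U → Ext d 2) =
      Fintype.card U * (d + 1).choose 2 := fun U _ => by
    rw [Module.finrank_pi_fintype, hext, Finset.sum_const, Finset.card_univ, smul_eq_mul]
  rw [hX, hN, Module.finrank_prod, Module.finrank_prod, hext, Module.finrank_pi, hpi, hpi] at hle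
  have hc : (A ∩ R).ncard = Fintype.card (A ∩ R : Set V) := by
    rw [← Nat.card_coe_set_eq, Nat.card_eq_fintype_card]
  have hc' : Fintype.card (Aᶜ : Set V) + A.ncard = Fintype.card V := by
    rw [← Nat.card_eq_fintype_card, Nat.card_coe_set_eq, add_comm, Set.ncard_add_ncard_compl,
      Nat.card_eq_fintype_card]
  rw [← hc, ← hc', add_mul] at hle
  rw [mul_comm ((d + 1).choose 2)]
  omega

end Necessity

/-! ### Bar configurations -/

section Bars

open Topology

variable {V E : Type*} {d : ℕ} (t h : E → V)

/-- The Gram determinant of the rows of the edges in `I`. -/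
noncomputable def edgeGram [Fintype V] (q : E → Ext d 2) (I : Set E) [Fintype I] : ℝ :=
  open Classical in (Matrix.of fun i i' : I =>
    (fun p : V × Set.powersetCard (Fin (d + 1)) 2 => edgeRow t h q i p.1 p.2) ⬝ᵥ
      fun p => edgeRow t h q i' p.1 p.2).det

theorem edgeGram_ne_zero_iff [Fintype V] (q : E → Ext d 2) (I : Set E) [Fintype I] :
    edgeGram t h q I ≠ 0 ↔ LinearIndepOn ℝ (edgeRow t h q) I := by
  classical
  rw [edgeGram, gram_det_ne_zero_iff, LinearIndepOn]
  exact LinearMap.linearIndependent_iff (v := fun e : I => edgeRow t h q e)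
    (LinearEquiv.curry ℝ ℝ V (Set.powersetCard (Fin (d + 1)) 2)).symm.toLinearMap
    (LinearEquiv.ker _)

theorem edgeGram_mem_subalgebra [Fintype V] {X : Type*} (S : Subalgebra ℝ (X → ℝ)) {q : X → E → Ext d 2}
    (hq : ∀ e s, (fun x => q x e s) ∈ S) (I : Set E) [Fintype I] :
    (fun x => edgeGram t h (q x) I) ∈ S := by
  classical
  have h1 : ∀ (e : E) (w v : V) (s : Set.powersetCard (Fin (d + 1)) 2),
      (fun x => (Pi.single w (q x e) : V → Ext d 2) v s) ∈ S := by
    intro e w v s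
    by_cases hv : v = w
    · subst hv
      simp only [Pi.single_eq_same]
      exact hq e s
    · simp only [Pi.single_eq_of_ne hv]
      exact S.zero_mem
  have h2 : ∀ e v s, (fun x => edgeRow t h (q x) e v s) ∈ S := by
    intro e v s
    have := S.sub_mem (h1 e (t e) v s) (h1 e (h e) v s)
    convert this using 1
    ext x
    rw [edgeRow]
    simp only [Pi.sub_apply]
  exact det_mem_subalgebra S fun i i' => dotProduct_mem_subalgebra S (fun p => h2 i p.1 p.2)
    (fun p => h2 i' p.1 p.2)

/-- The bars that meet the rods at the ends of their edges. -/
def compatibleBars (φ : V → Ext d 2) : Set (E → Ext d 2) :=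
  {q | (∀ e, q e ∈ Gr d 2) ∧ ∀ e, q e ⬝ᵥ φ (t e) = 0 ∧ q e ⬝ᵥ φ (h e) = 0}

/-- A choice of points on the rods at the ends of each edge. -/
abbrev BarParameters (φ : V → Ext d 2) : Type _ :=
  (∀ e, radical (φ (t e))) × (∀ e, radical (φ (h e)))

/-- The bars that are spanned by points of the rods at the ends of their edges. -/
noncomputable def barMap (φ : V → Ext d 2) (x : BarParameters t h φ) (e : E) : Ext d 2 :=
  bivector d (x.1 e) (x.2 e)

theorem continuous_barMap (φ : V → Ext d 2) : Continuous (barMap t h φ) := by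
  refine continuous_pi fun e => continuous_pi fun s => ?_
  refine bivector_mem_subalgebra (continuousSubalgebra (α := BarParameters t h φ) (R := ℝ) (A := ℝ))
    (a := fun x => x.1 e) (b := fun x => x.2 e) (fun i => ?_) (fun i => ?_) s
  · exact (continuous_apply i).comp
      (continuous_subtype_val.comp ((continuous_apply e).comp continuous_fst))
  · exact (continuous_apply i).comp
      (continuous_subtype_val.comp ((continuous_apply e).comp continuous_snd))

theorem barMap_mem_lineFunctions (φ : V → Ext d 2) (e : E)
    (s : Set.powersetCard (Fin (d + 1)) 2) :
    (fun x => barMap t h φ x e s) ∈ lineFunctions (BarParameters t h φ) := by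
  refine bivector_mem_subalgebra (lineFunctions (BarParameters t h φ))
    (a := fun x => x.1 e) (b := fun x => x.2 e) (fun i => ?_) (fun i => ?_) s
  · exact linear_mem_lineFunctions
      { toFun := fun x : BarParameters t h φ => (x.1 e).1 i
        map_add' := fun _ _ => rfl
        map_smul' := fun _ _ => rfl }
  · exact linear_mem_lineFunctions
      { toFun := fun x : BarParameters t h φ => (x.2 e).1 i
        map_add' := fun _ _ => rfl
        map_smul' := fun _ _ => rfl }

theorem range_barMap (φ : V → Ext d 2) :
    Set.range (barMap t h φ) = Set.pi Set.univ fun e => {q | ∃ x ∈ radical (φ (t e)),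
      ∃ y ∈ radical (φ (h e)), q = bivector d x y} := by
  ext q
  constructor
  · rintro ⟨x, rfl⟩ e _
    exact ⟨_, (x.1 e).2, _, (x.2 e).2, rfl⟩
  · intro hq
    choose a ha b hb hab using fun e => hq e (Set.mem_univ e)
    exact ⟨(fun e => ⟨a e, ha e⟩, fun e => ⟨b e, hb e⟩), funext fun e => (hab e).symm⟩

variable {t h}

theorem barMap_mem_compatibleBars {φ : V → Ext d 2} (x : BarParameters t h φ)
    (hx : ∀ e, barMap t h φ x e ≠ 0) : barMap t h φ x ∈ compatibleBars t h φ := by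
  refine ⟨fun e => ⟨hx e, ![x.1 e, x.2 e], by rw [wedge_two]; rfl⟩, fun e => ⟨?_, ?_⟩⟩
  · exact form_left_of_mem_radical (x.1 e).2 _
  · exact form_right_of_mem_radical (x.2 e).2 _

/-- The closure of a product is the product of the closures, so each bar may be approximated
separately. -/
theorem mem_closure_range_barMap {φ : V → Ext d 2} (hrank : ∀ v, RankTwo (φ v))
    (hsup : ∀ u v, u ≠ v → radical (φ u) ⊔ radical (φ v) = ⊤) (hth : ∀ e, t e ≠ h e)
    {q : E → Ext d 2} (hq : q ∈ compatibleBars t h φ) :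
    q ∈ closure (Set.range (barMap t h φ)) := by
  rw [range_barMap, closure_pi_set]
  intro e _
  obtain ⟨v, hv⟩ := (hq.1 e).2
  rw [wedge_two] at hv
  have h1 := hq.2 e
  rw [hv] at h1 ⊢
  exact mem_closure_bivector (hrank _) (hrank _) (hsup _ _ (hth e)) h1.1 h1.2

/-- The count `1 + D + 2 ≤ 2D` has room to spare. Independence of single edges is what makes the
bars of a generic parameter nonzero. -/
theorem sparse_singleton [Finite V] (hd : 3 ≤ d) (R : Set V) (hth : ∀ e, t e ≠ h e) (e : E) :
    Sparse t h d R {e} := by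
  intro F hF hne
  obtain rfl := (Set.subset_singleton_iff_eq.1 hF).resolve_left hne.ne_empty
  have h1 : endSet t h {e} = {t e, h e} := by
    ext v
    simp [endSet]
  have h2 : (endSet t h {e}).ncard = 2 := by
    rw [h1, Set.ncard_pair (hth e)]
  have h3 : (endSet t h {e} ∩ R).ncard ≤ 2 :=
    h2 ▸ Set.ncard_le_ncard Set.inter_subset_left (Set.toFinite _)
  have h4 : 6 ≤ (d + 1).choose 2 :=
    calc 6 = (3 + 1).choose 2 := by decide
      _ ≤ (d + 1).choose 2 := Nat.choose_le_choose 2 (by omega)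
  rw [h2, Set.ncard_singleton]
  omega

/-- The polynomial is the product of the Gram determinants of all sparse sets. Each factor is
nonzero for some points on the rods by `hwit`, and the parameters form a vector space, so the
product is nonzero on a dense set of them; every compatible bar-configuration is a limit of
parametrized ones. -/
theorem almostAll_bars [Fintype V] [Finite E] (hd : 3 ≤ d) {φ : V → Ext d 2} {R : Set V}
    (hR : ∀ v, v ∈ R ↔ φ v ≠ 0) (hne : ∀ u v, u ≠ v → ∀ c : ℝ, φ u = c • φ v → φ u = 0)
    (hrank : ∀ v, RankTwo (φ v)) (hsup : ∀ u v, u ≠ v → radical (φ u) ⊔ radical (φ v) = ⊤)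
    (hth : ∀ e, t e ≠ h e)
    (hwit : ∀ I, Sparse t h d R I → ∃ a b : E → Fin (d + 1) → ℝ,
      (∀ e, a e ∈ radical (φ (t e))) ∧ (∀ e, b e ∈ radical (φ (h e))) ∧
      LinearIndepOn ℝ (edgeRow t h fun e => bivector d (a e) (b e)) I) :
    AlmostAll (compatibleBars t h φ) fun q =>
      ∀ I, LinearIndepOn ℝ (edgeRow t h q) I ↔ Sparse t h d R I := by
  classical
  have := Fintype.ofFinite E
  let 𝒮 : Finset (Set E) := univ.filter fun I => Sparse t h d R I
  have h𝒮 : ∀ I, I ∈ 𝒮 ↔ Sparse t h d R I := fun I => by simp [𝒮]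
  obtain ⟨p, hp⟩ := mem_polynomialFunctions.1 (prod_mem_subalgebra
    (polynomialFunctions E (Set.powersetCard (Fin (d + 1)) 2)) 𝒮
    (f := fun I q => edgeGram t h q I) fun I _ => edgeGram_mem_subalgebra t h _ (fun e s =>
      coordinate_mem_polynomialFunctions e s) I)
  have hp0 : ∀ q : E → Ext d 2, MvPolynomial.eval (fun a => q a.1 a.2) p ≠ 0 ↔
      ∀ I, Sparse t h d R I → LinearIndepOn ℝ (edgeRow t h q) I := by
    intro q
    rw [hp, Finset.prod_ne_zero_iff]
    refine forall_congr' fun I => ?_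
    rw [h𝒮, edgeGram_ne_zero_iff]
  refine ⟨p, ?_, ?_⟩
  · have hfL := barMap_mem_lineFunctions t h φ
    obtain ⟨x₀, hx₀⟩ := exists_forall_ne_zero 𝒮 (f := fun I x => edgeGram t h (barMap t h φ x) I)
      (fun I _ => edgeGram_mem_subalgebra t h _ hfL I) (fun I hI => by
        obtain ⟨a, b, ha, hb, hli⟩ := hwit I ((h𝒮 I).1 hI)
        refine ⟨(fun e => ⟨a e, ha e⟩, fun e => ⟨b e, hb e⟩), ?_⟩
        rw [edgeGram_ne_zero_iff]
        exact hli)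
    have hx₀' : MvPolynomial.eval (fun a => barMap t h φ x₀ a.1 a.2) p ≠ 0 := by
      rw [hp]
      exact Finset.prod_ne_zero_iff.2 hx₀
    intro q hq
    refine closure_minimal (t := closure _) ?_ isClosed_closure
      (mem_closure_range_barMap hrank hsup hth hq)
    rintro _ ⟨x, rfl⟩
    refine mem_closure_of_eval_ne_zero (continuous_barMap t h φ) hfL p (fun y hy => ?_) hx₀' x
    refine barMap_mem_compatibleBars y fun e h0 => ?_
    -- A zero bar would have a zero row, against the independence of the sparse set `{e}`.
    have h1 := (hp0 _).1 hy {e} (sparse_singleton hd R hth e)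
    refine h1.ne_zero (Set.mem_singleton e) ?_
    rw [edgeRow, show barMap t h φ y e = 0 from h0, Pi.single_zero, Pi.single_zero, sub_zero]
  · intro q hq hqp I
    refine ⟨fun hli F hF hFne => ?_, (hp0 q).1 hqp I⟩
    exact card_le_of_linearIndepOn_edgeRow hR hne hth (fun e => (hq.2 e).1) (fun e => (hq.2 e).2)
      hFne (hli.mono hF)

end Bars

/-! ### Rod configurations -/

section Rods

variable {V₀ V E : Type*} {d : ℕ} {R : Set V₀}

theorem AlmostAll.mono {ι κ : Type*} {C : Set (ι → κ → ℝ)} {P Q : (ι → κ → ℝ) → Prop}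
    (hP : AlmostAll C P) (h : ∀ x ∈ C, P x → Q x) : AlmostAll C Q := by
  obtain ⟨p, hp, hp'⟩ := hP
  exact ⟨p, hp, fun x hx hx' => h x hx (hp' x hx hx')⟩

/-- The forms of the rods, and the zero form for the bodies. -/
noncomputable def rodForms (i : R → V) (r : R → Ext d (d - 1)) : V → Ext d 2 :=
  Function.extend i (fun p => coform d (r p)) 0

theorem rodForms_apply {i : R → V} (hi : Function.Injective i) (r : R → Ext d (d - 1)) (p : R) :
    rodForms i r (i p) = coform d (r p) :=
  hi.extend_apply _ _ p

theorem rodForms_of_notMem {i : R → V} (r : R → Ext d (d - 1)) {v : V} (hv : v ∉ Set.range i) :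
    rodForms i r v = 0 :=
  Function.extend_apply' _ _ _ fun ⟨p, hp⟩ => hv ⟨p, hp⟩

theorem rodForms_mem_subalgebra {X : Type*} (S : Subalgebra ℝ (X → ℝ)) {i : R → V}
    (hi : Function.Injective i) {r : X → R → Ext d (d - 1)} (hr : ∀ p s, (fun x => r x p s) ∈ S)
    (v : V) (s : Set.powersetCard (Fin (d + 1)) 2) : (fun x => rodForms i (r x) v s) ∈ S := by
  by_cases hv : v ∈ Set.range i
  · obtain ⟨p, rfl⟩ := hv
    simp only [rodForms_apply hi]
    exact coform_mem_subalgebra S (hr p) s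
  · simp only [rodForms_of_notMem _ hv]
    exact S.zero_mem

theorem rankTwo_coform (hd : 1 ≤ d) {r : Ext d (d - 1)} (hr : r ∈ Gr d (d - 1)) :
    RankTwo (coform d r) := by
  obtain ⟨M, rfl⟩ := hr.2
  exact rankTwo_coform_wedge M hd

/-- If one rod's vector were a multiple of another's, their radicals would be nested. As they span
`W`, one radical would be all of `W`, and its form zero. -/
theorem mem_rodConfigurations (hd : 1 ≤ d) {r : R → Ext d (d - 1)}
    (hr : ∀ p, r p ∈ Gr d (d - 1))
    (hdet : ∀ p p', p ≠ p' → radicalDet (coform d (r p)) (coform d (r p')) ≠ 0) :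
    r ∈ rodConfigurations d R := by
  refine ⟨hr, fun p p' hne c hc => ?_⟩
  have hsup := radical_sup_eq_top (rankTwo_coform hd (hr p)) (rankTwo_coform hd (hr p'))
    (hdet p p' hne)
  have hle : radical (coform d (r p')) ≤ radical (coform d (r p)) := fun a ha =>
    mem_radical.2 fun b => by
      rw [hc, map_smul, form_apply, dotProduct_smul, ← form_apply, form_left_of_mem_radical ha,
        smul_zero]
  rw [sup_eq_left.2 hle, radical_eq_top_iff, coform_eq_zero_iff hd] at hsup
  exact (hr p).1 hsup

section Configuration

variable {i : R → V} {r : R → Ext d (d - 1)}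

theorem mem_range_iff_rodForms_ne_zero (hi : Function.Injective i) (hd : 1 ≤ d)
    (hr : r ∈ rodConfigurations d R) (v : V) : v ∈ Set.range i ↔ rodForms i r v ≠ 0 := by
  constructor
  · rintro ⟨p, rfl⟩
    rw [rodForms_apply hi, Ne, coform_eq_zero_iff hd]
    exact (hr.1 p).1
  · intro h
    by_contra hv
    exact h (rodForms_of_notMem r hv)

theorem rankTwo_rodForms (hi : Function.Injective i) (hd : 1 ≤ d)
    (hr : r ∈ rodConfigurations d R) (v : V) : RankTwo (rodForms i r v) := by
  by_cases hv : v ∈ Set.range i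
  · obtain ⟨p, rfl⟩ := hv
    rw [rodForms_apply hi]
    exact rankTwo_coform hd (hr.1 p)
  · rw [rodForms_of_notMem r hv]
    exact rankTwo_zero

theorem rodForms_eq_zero_of_eq_smul (hi : Function.Injective i) (hd : 1 ≤ d)
    (hr : r ∈ rodConfigurations d R) {u v : V} (huv : u ≠ v) {c : ℝ}
    (h : rodForms i r u = c • rodForms i r v) : rodForms i r u = 0 := by
  by_cases hu : u ∈ Set.range i
  · by_cases hv : v ∈ Set.range i
    · obtain ⟨p, rfl⟩ := hu
      obtain ⟨p', rfl⟩ := hv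
      rw [rodForms_apply hi, rodForms_apply hi, ← map_smul, ← sub_eq_zero, ← map_sub,
        coform_eq_zero_iff hd, sub_eq_zero] at h
      exact absurd h (hr.2 p p' (fun hp => huv (congrArg i hp)) c)
    · rw [h, rodForms_of_notMem r hv, smul_zero]
  · exact rodForms_of_notMem r hu

/-- A point on a rod can be moved polynomially with the rods. -/
theorem exists_polynomial_point (hi : Function.Injective i) (hd : 1 ≤ d)
    (hr : r ∈ rodConfigurations d R) {v : V} {a : Fin (d + 1) → ℝ}
    (ha : a ∈ radical (rodForms i r v)) :
    ∃ A : (R → Ext d (d - 1)) → Fin (d + 1) → ℝ,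
      (∀ j, (fun r => A r j) ∈ polynomialFunctions R (Set.powersetCard (Fin (d + 1)) (d - 1))) ∧
      A r = a ∧ ∀ r' ∈ rodConfigurations d R, A r' ∈ radical (rodForms i r' v) := by
  by_cases hv : v ∈ Set.range i
  · have h0 := (mem_range_iff_rodForms_ne_zero hi hd hr v).1 hv
    rw [← span_radicalGenerator (rankTwo_rodForms hi hd hr v) h0,
      Submodule.mem_span_range_iff_exists_fun] at ha
    obtain ⟨c, hc⟩ := ha
    -- The coefficients are frozen at `r` while the generators of the radical move with the rods.
    refine ⟨fun r' => ∑ k, c k • radicalGenerator (rodForms i r' v) k, fun j => ?_, hc,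
      fun r' hr' => Submodule.sum_mem _ fun k _ => Submodule.smul_mem _ _
        (rankTwo_rodForms hi hd hr' v _ _ _)⟩
    simp only [Finset.sum_apply, Pi.smul_apply, smul_eq_mul]
    exact sum_mem_subalgebra _ univ fun k _ => Subalgebra.mul_mem _
      (Subalgebra.algebraMap_mem _ (c k)) (radicalGenerator_mem_subalgebra _
        (rodForms_mem_subalgebra _ hi (fun p s => coordinate_mem_polynomialFunctions p s) v) k j)
  · refine ⟨fun _ => a, fun j => Subalgebra.algebraMap_mem _ (a j), rfl, fun r' _ => ?_⟩
    rw [radical_eq_top_iff.2 (rodForms_of_notMem r' hv)]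
    exact Submodule.mem_top

end Configuration

/-- Bars spanned by points on the rods can be moved polynomially with the rods. -/
theorem exists_polynomial_bars {i : R → V} (hi : Function.Injective i) (hd : 1 ≤ d) {t h : E → V}
    {r : R → Ext d (d - 1)} (hr : r ∈ rodConfigurations d R) {a b : E → Fin (d + 1) → ℝ}
    (ha : ∀ e, a e ∈ radical (rodForms i r (t e))) (hb : ∀ e, b e ∈ radical (rodForms i r (h e))) :
    ∃ Q : (R → Ext d (d - 1)) → E → Ext d 2,
      (∀ e s, (fun r => Q r e s) ∈
        polynomialFunctions R (Set.powersetCard (Fin (d + 1)) (d - 1))) ∧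
      (Q r = fun e => bivector d (a e) (b e)) ∧
      ∀ r' ∈ rodConfigurations d R, ∃ a' b' : E → Fin (d + 1) → ℝ,
        (∀ e, a' e ∈ radical (rodForms i r' (t e))) ∧
        (∀ e, b' e ∈ radical (rodForms i r' (h e))) ∧
        Q r' = fun e => bivector d (a' e) (b' e) := by
  choose A hA hA₀ hAC using fun e => exists_polynomial_point hi hd hr (ha e)
  choose B hB hB₀ hBC using fun e => exists_polynomial_point hi hd hr (hb e)
  refine ⟨fun r e => bivector d (A e r) (B e r), fun e s => bivector_mem_subalgebra _ (hA e) (hB e) s,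
    ?_, fun r' hr' => ⟨fun e => A e r', fun e => B e r', fun e => hAC e r' hr',
      fun e => hBC e r' hr', rfl⟩⟩
  simp only [hA₀, hB₀]

theorem exists_rodForms_with_independent_bars [Fintype V] [Finite E] {i : R → V}
    (hi : Function.Injective i) (hd : 3 ≤ d) (t h : E → V) (hth : ∀ e, t e ≠ h e) :
    ∃ M : R → Fin (d - 1) → Fin (d + 1) → ℝ, (∀ p, coform d (wedge (M p)) ≠ 0) ∧
      (∀ p p', p ≠ p' → radicalDet (coform d (wedge (M p))) (coform d (wedge (M p'))) ≠ 0) ∧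
      ∀ I, Sparse t h d (Set.range i) I → ∃ a b : E → Fin (d + 1) → ℝ,
        (∀ e, a e ∈ radical (rodForms i (fun p => wedge (M p)) (t e))) ∧
        (∀ e, b e ∈ radical (rodForms i (fun p => wedge (M p)) (h e))) ∧
        LinearIndepOn ℝ (edgeRow t h fun e => bivector d (a e) (b e)) I := by
  obtain ⟨M, hM0, hMdet, hMI⟩ := exists_rods_with_independent_bars t h hd (Set.range i) hth
  have hform : ∀ p, rodForm (Set.range i) (i p) (M (i p)) = coform d (wedge (M (i p))) := fun p =>
    rodForm_of_mem (Set.mem_range_self p) _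
  have hform' : ∀ v, rodForms i (fun p => wedge (M (i p))) v =
      rodForm (Set.range i) v (M v) := by
    intro v
    by_cases hv : v ∈ Set.range i
    · obtain ⟨p, rfl⟩ := hv
      rw [hform, rodForms_apply hi]
    · rw [rodForm_of_notMem hv, rodForms_of_notMem _ hv]
  refine ⟨fun p => M (i p), fun p => ?_, fun p p' hne => ?_, fun I hI => ?_⟩
  · rw [← hform]
    exact hM0 _ ⟨p, rfl⟩
  · rw [← hform, ← hform]
    exact hMdet _ ⟨p, rfl⟩ _ ⟨p', rfl⟩ fun h => hne (hi h)
  · simp only [hform']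
    exact hMI I hI

/-- General position of the rods and independence of polynomially moving bars are the nonvanishing
of a polynomial. -/
theorem exists_polynomial_ne_zero_iff [Fintype V] [Finite E] [Finite R] (t h : E → V)
    {Q : Set E → (R → Ext d (d - 1)) → E → Ext d 2}
    (hQ : ∀ I e s, (fun r => Q I r e s) ∈
      polynomialFunctions R (Set.powersetCard (Fin (d + 1)) (d - 1))) (𝒮 : Set (Set E)) :
    ∃ p : MvPolynomial (R × Set.powersetCard (Fin (d + 1)) (d - 1)) ℝ,
      ∀ r : R → Ext d (d - 1), MvPolynomial.eval (fun a => r a.1 a.2) p ≠ 0 ↔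
        ((∀ p, coform d (r p) ≠ 0) ∧
          ∀ p p', p ≠ p' → radicalDet (coform d (r p)) (coform d (r p')) ≠ 0) ∧
        ∀ I ∈ 𝒮, LinearIndepOn ℝ (edgeRow t h (Q I r)) I := by
  classical
  have := Fintype.ofFinite E
  have := Fintype.ofFinite R
  have hco : ∀ p s, (fun r : R → Ext d (d - 1) => coform d (r p) s) ∈
      polynomialFunctions R (Set.powersetCard (Fin (d + 1)) (d - 1)) := fun p =>
    coform_mem_subalgebra _ fun s => coordinate_mem_polynomialFunctions p s
  -- Over `ℝ` the self dot product is a polynomial test for a vector to be nonzero.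
  obtain ⟨p₁, hp₁⟩ := mem_polynomialFunctions.1 (prod_mem_subalgebra _ univ
    (f := fun p r => coform d (r p) ⬝ᵥ coform d (r p)) fun p _ =>
      dotProduct_mem_subalgebra _ (hco p) (hco p))
  obtain ⟨p₂, hp₂⟩ := mem_polynomialFunctions.1 (prod_mem_subalgebra _ (univ : Finset R).offDiag
    (f := fun x r => radicalDet (coform d (r x.1)) (coform d (r x.2)))
      fun x _ => radicalDet_mem_subalgebra _ (hco x.1) (hco x.2))
  obtain ⟨p₃, hp₃⟩ := mem_polynomialFunctions.1 (prod_mem_subalgebra _ (Set.toFinite 𝒮).toFinset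
    (f := fun I r => edgeGram t h (Q I r) I) fun I _ => edgeGram_mem_subalgebra t h _ (hQ I) I)
  refine ⟨p₁ * p₂ * p₃, fun r => ?_⟩
  rw [map_mul, map_mul, hp₁, hp₂, hp₃, mul_ne_zero_iff, mul_ne_zero_iff, Finset.prod_ne_zero_iff,
    Finset.prod_ne_zero_iff, Finset.prod_ne_zero_iff]
  refine and_congr (and_congr ?_ ?_) ?_
  · simp only [mem_univ, true_imp_iff, Ne, dotProduct_self_eq_zero]
  · simp only [mem_offDiag, mem_univ, true_and, Prod.forall]
  · refine forall_congr' fun I => ?_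
    rw [Set.Finite.mem_toFinset, edgeGram_ne_zero_iff]

theorem continuous_wedge {k : ℕ} :
    Continuous fun (m : R → Fin k → Fin (d + 1) → ℝ) (p : R) => (wedge (m p) : Ext d k) := by
  refine continuous_pi fun p => continuous_pi fun s => ?_
  exact wedge_mem_subalgebra (continuousSubalgebra
    (α := R → Fin k → Fin (d + 1) → ℝ) (R := ℝ) (A := ℝ)) (M := fun m => m p)
    (fun i j => show Continuous fun m : R → Fin k → Fin (d + 1) → ℝ => m p i j by fun_prop) s

theorem wedge_mem_lineFunctions {k : ℕ} (p : R) (s : Set.powersetCard (Fin (d + 1)) k) :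
    (fun m : R → Fin k → Fin (d + 1) → ℝ => wedge (m p) s) ∈
      lineFunctions (R → Fin k → Fin (d + 1) → ℝ) := by
  refine wedge_mem_subalgebra _ (M := fun m : R → Fin k → Fin (d + 1) → ℝ => m p)
    (fun i j => ?_) s
  exact linear_mem_lineFunctions
    { toFun := fun m : R → Fin k → Fin (d + 1) → ℝ => m p i j
      map_add' := fun _ _ => rfl
      map_smul' := fun _ _ => rfl }

/-- Almost all rods are in general position and admit independent bars for each sparse set. -/
theorem almostAll_rods [Fintype V] [Finite E] {i : R → V} (hi : Function.Injective i) (hd : 3 ≤ d)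
    (t h : E → V) (hth : ∀ e, t e ≠ h e) :
    AlmostAll (rodConfigurations d R) fun r =>
      (∀ u v, u ≠ v → radical (rodForms i r u) ⊔ radical (rodForms i r v) = ⊤) ∧
      ∀ I, Sparse t h d (Set.range i) I → ∃ a b : E → Fin (d + 1) → ℝ,
        (∀ e, a e ∈ radical (rodForms i r (t e))) ∧ (∀ e, b e ∈ radical (rodForms i r (h e))) ∧
        LinearIndepOn ℝ (edgeRow t h fun e => bivector d (a e) (b e)) I := by
  have : Finite R := Finite.of_injective i hi
  have hd1 : 1 ≤ d := by omega
  obtain ⟨M, hne₀, hdet₀, hMI⟩ := exists_rodForms_with_independent_bars hi hd t h hth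
  have hr₀ : (fun p => wedge (M p)) ∈ rodConfigurations d R := mem_rodConfigurations hd1
    (fun p => ⟨fun h0 => hne₀ p (by rw [h0, map_zero]), _, rfl⟩) hdet₀
  have hwit : ∀ I : Set E, ∃ Q : (R → Ext d (d - 1)) → E → Ext d 2,
      (∀ e s, (fun r => Q r e s) ∈
        polynomialFunctions R (Set.powersetCard (Fin (d + 1)) (d - 1))) ∧
      (Sparse t h d (Set.range i) I →
        LinearIndepOn ℝ (edgeRow t h (Q fun p => wedge (M p))) I ∧
        ∀ r' ∈ rodConfigurations d R, ∃ a' b' : E → Fin (d + 1) → ℝ,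
        (∀ e, a' e ∈ radical (rodForms i r' (t e))) ∧
        (∀ e, b' e ∈ radical (rodForms i r' (h e))) ∧
        Q r' = fun e => bivector d (a' e) (b' e)) := by
    intro I
    by_cases hI : Sparse t h d (Set.range i) I
    · obtain ⟨a, b, ha, hb, hli⟩ := hMI I hI
      obtain ⟨Q, hQ, hQ₀, hQC⟩ := exists_polynomial_bars hi hd1 hr₀ ha hb
      exact ⟨Q, hQ, fun _ => ⟨by rw [hQ₀]; exact hli, hQC⟩⟩
    -- For a set that is not sparse nothing is required; zero bars keep `Q` total.
    · exact ⟨fun _ _ => 0, fun e s => Subalgebra.zero_mem _, fun h => absurd h hI⟩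
  choose Q hQ hQI using hwit
  obtain ⟨p, hp⟩ := exists_polynomial_ne_zero_iff t h hQ {I | Sparse t h d (Set.range i) I}
  refine ⟨p, fun r hr => ?_, fun r hr hrp => ⟨fun u v huv => ?_, fun I hI => ?_⟩⟩
  -- Density is checked upstairs: rods are images of matrices, and matrices form a vector space on
  -- which the polynomial is nonzero at the witness `M`.
  · choose m hm using fun p => (hr.1 p).2
    rw [show r = fun p => wedge (m p) from funext hm]
    have h0 := (hp fun p => wedge (M p)).2 ⟨⟨hne₀, hdet₀⟩, fun I hI => (hQI I hI).1⟩
    refine mem_closure_of_eval_ne_zero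
      (f := fun (m : R → Fin (d - 1) → Fin (d + 1) → ℝ) (p : R) => (wedge (m p) : Ext d (d - 1)))
      continuous_wedge wedge_mem_lineFunctions p (fun m' hm' => ?_) h0 m
    have h4 := ((hp fun p => wedge (m' p)).1 hm').1
    exact mem_rodConfigurations hd1
      (fun p => ⟨fun h0 => h4.1 p (by rw [h0, map_zero]), _, rfl⟩) h4.2
  · by_cases hu : u ∈ Set.range i
    · by_cases hv : v ∈ Set.range i
      · refine radical_sup_eq_top (rankTwo_rodForms hi hd1 hr u) (rankTwo_rodForms hi hd1 hr v) ?_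
        obtain ⟨p, rfl⟩ := hu
        obtain ⟨p', rfl⟩ := hv
        rw [rodForms_apply hi, rodForms_apply hi]
        exact ((hp r).1 hrp).1.2 p p' fun h => huv (congrArg i h)
      · rw [radical_eq_top_iff.2 (rodForms_of_notMem r hv), sup_top_eq]
    · rw [radical_eq_top_iff.2 (rodForms_of_notMem r hu), top_sup_eq]
  · obtain ⟨a, b, ha, hb, hab⟩ := (hQI I hI).2 r hr
    exact ⟨a, b, ha, hb, hab ▸ ((hp r).1 hrp).2 I hI⟩

end Rods

/-! ### Body-rod-bar frameworks of graphs -/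

section Graphs

variable {V E : Type*} (G : Graph V E)

theorem isLink_tail_head (e : G.edgeSet) : G.IsLink e (tail G e) (head G e) :=
  (G.exists_isLink_of_mem_edgeSet e.2).choose_spec.choose_spec

/-- The tail of an edge as an element of the vertex set. -/
noncomputable def tailVertex (e : G.edgeSet) : G.vertexSet :=
  ⟨tail G e, (isLink_tail_head G e).left_mem⟩

/-- The head of an edge as an element of the vertex set. -/
noncomputable def headVertex (e : G.edgeSet) : G.vertexSet :=
  ⟨head G e, (isLink_tail_head G e).right_mem⟩

theorem inc_iff (e : G.edgeSet) (v : V) : G.Inc e v ↔ v = tail G e ∨ v = head G e := by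
  constructor
  · intro h
    exact h.eq_or_eq_of_isLink (isLink_tail_head G e)
  · rintro (rfl | rfl)
    · exact (isLink_tail_head G e).inc_left
    · exact (isLink_tail_head G e).inc_right

theorem spanned_eq_image (F : Set G.edgeSet) :
    spanned G F = Subtype.val '' endSet (tailVertex G) (headVertex G) F := by
  ext v
  constructor
  · rintro ⟨e, he, hv⟩
    rcases (inc_iff G e v).1 hv with rfl | rfl
    · exact ⟨tailVertex G e, ⟨e, he, Or.inl rfl⟩, rfl⟩
    · exact ⟨headVertex G e, ⟨e, he, Or.inr rfl⟩, rfl⟩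
  · rintro ⟨v, ⟨e, he, rfl | rfl⟩, rfl⟩
    · exact ⟨e, he, (isLink_tail_head G e).inc_left⟩
    · exact ⟨e, he, (isLink_tail_head G e).inc_right⟩

/-- Extension by zero from `G.vertexSet` to `V` is injective and linear and carries rows to rows.
This allows `V` to be infinite while dimensions are counted on the finite vertex set. -/
theorem linearIndepOn_edgeVector_iff {d : ℕ} (q : G.edgeSet → Ext d 2) (I : Set G.edgeSet) :
    LinearIndepOn ℝ (edgeVector G q) I ↔
      LinearIndepOn ℝ (edgeRow (tailVertex G) (headVertex G) q) I := by
  classical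
  let L : (G.vertexSet → Ext d 2) →ₗ[ℝ] (V → Ext d 2) :=
    { toFun := fun x => Function.extend Subtype.val x 0
      map_add' := fun x y => by
        have := Function.extend_add (Subtype.val : G.vertexSet → V) x y 0 0
        rwa [add_zero] at this
      map_smul' := fun c x => by
        have := Function.extend_smul c (Subtype.val : G.vertexSet → V) x 0
        rwa [smul_zero] at this }
  have hval : ∀ x (v : G.vertexSet), L x v = x v := fun x v =>
    Subtype.val_injective.extend_apply _ _ v
  have hval' : ∀ x v, v ∉ G.vertexSet → L x v = 0 := fun x v hv =>
    Function.extend_apply' _ _ _ fun ⟨w, hw⟩ => hv (hw ▸ w.2)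
  have hL : LinearMap.ker L = ⊥ := by
    rw [LinearMap.ker_eq_bot']
    intro x hx
    funext v
    rw [← hval x v, hx]
    rfl
  have hsingle : ∀ (w : G.vertexSet) (y : Ext d 2), L (Pi.single w y) = Pi.single (w : V) y := by
    intro w y
    funext v
    by_cases hv : v ∈ G.vertexSet
    · rw [hval _ ⟨v, hv⟩]
      by_cases hvw : v = w
      · subst hvw
        simp
      · rw [Pi.single_eq_of_ne hvw, Pi.single_eq_of_ne fun h => hvw (congrArg Subtype.val h)]
    · rw [hval' _ _ hv, Pi.single_eq_of_ne fun h => hv (by rw [h]; exact w.2)]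
  have hrow : edgeVector G q = L ∘ edgeRow (tailVertex G) (headVertex G) q := by
    funext e
    rw [Function.comp_apply, edgeRow, edgeVector, map_sub]
    have h1 := hsingle (tailVertex G e) (q e)
    have h2 := hsingle (headVertex G e) (q e)
    have h3 := h1.symm
    have h4 := h2.symm
    convert congrArg₂ (fun x y => x - y) h3 h4 <;> rfl
  rw [hrow, LinearIndepOn, LinearIndepOn]
  exact LinearMap.linearIndependent_iff (v := fun e : I => edgeRow (tailVertex G) (headVertex G) q e)
    L hL

/-- The zero form at a body imposes no condition, so orthogonality at both ends of an edge is
exactly incidence with the rods among them. -/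
theorem barConfigurations_eq_compatibleBars {d : ℕ} {R : Set V} (hR : R ⊆ G.vertexSet)
    (r : R → Ext d (d - 1)) : barConfigurations G r =
      compatibleBars (tailVertex G) (headVertex G) (rodForms (Set.inclusion hR) r) := by
  have key : ∀ (q : Ext d 2) (w : G.vertexSet), q ⬝ᵥ rodForms (Set.inclusion hR) r w = 0 ↔
      ∀ v : R, (v : V) = w → pairing q (r v) = 0 := by
    intro q w
    by_cases hw : (w : V) ∈ R
    · have h1 : w = Set.inclusion hR ⟨w, hw⟩ := rfl
      rw [h1, rodForms_apply (Set.inclusion_injective hR), ← pairing_eq_dotProduct]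
      constructor
      · rintro h ⟨v, hv⟩ rfl
        exact h
      · intro h
        exact h _ rfl
    · rw [rodForms_of_notMem]
      · simp only [dotProduct_zero, true_iff]
        intro v hv
        exact absurd (hv ▸ v.2) hw
      · rintro ⟨v, rfl⟩
        exact hw v.2
  ext q
  refine and_congr Iff.rfl (forall_congr' fun e => ?_)
  rw [key, key]
  constructor
  · intro h
    exact ⟨fun v hv => h v ((inc_iff G e v).2 (Or.inl hv)),
      fun v hv => h v ((inc_iff G e v).2 (Or.inr hv))⟩
  · intro h v hv
    exact ((inc_iff G e v).1 hv).elim (h.1 v) (h.2 v)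

/-- `Sparse` moves the subtracted terms to the left, which keeps the count in `ℕ`. -/
theorem sparse_iff {d : ℕ} {R : Set V} (hR : R ⊆ G.vertexSet) (I : Set G.edgeSet) :
    Sparse (tailVertex G) (headVertex G) d (Set.range (Set.inclusion hR)) I ↔
      ∀ F ⊆ I, F.Nonempty → (F.ncard : ℤ) ≤ countFun G d R F := by
  refine forall_congr' fun F => forall_congr' fun _ => forall_congr' fun _ => ?_
  have h1 : (spanned G F).ncard = (endSet (tailVertex G) (headVertex G) F).ncard := by
    rw [spanned_eq_image, Set.ncard_image_of_injective _ Subtype.val_injective]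
  have h2 : (spanned G F ∩ R).ncard = (endSet (tailVertex G) (headVertex G) F ∩
      Set.range (Set.inclusion hR)).ncard := by
    rw [← Set.ncard_image_of_injective _ Subtype.val_injective, spanned_eq_image]
    congr 1
    ext v
    constructor
    · rintro ⟨⟨w, hw, rfl⟩, hv⟩
      exact ⟨w, ⟨hw, ⟨⟨w, hv⟩, rfl⟩⟩, rfl⟩
    · rintro ⟨w, ⟨hw, ⟨v, rfl⟩⟩, rfl⟩
      exact ⟨⟨_, hw, rfl⟩, v.2⟩
  rw [countFun, h1, h2, mul_sub, mul_one]
  zify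
  constructor <;> intro h <;> linarith

theorem bodyRodBarMatroid_indep [Finite G.edgeSet] {d : ℕ} (q : G.edgeSet → Ext d 2)
    (I : Set G.edgeSet) : (bodyRodBarMatroid G q).Indep I ↔ LinearIndepOn ℝ (edgeVector G q) I :=
  Iff.rfl

theorem countMatroid_indep [Finite G.edgeSet] {d : ℕ} (hd : 3 ≤ d) (R : Set V)
    (I : Set G.edgeSet) : (countMatroid G hd R).Indep I ↔
      ∀ F ⊆ I, F.Nonempty → (F.ncard : ℤ) ≤ countFun G d R F :=
  Iff.rfl

end Graphs

end BodyRodBar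

theorem mainTheorem1 {V E : Type*} (G : Graph V E) [G.Loopless]
    [Finite G.vertexSet] [Finite G.edgeSet]
    (B R : Set V) (hBR : B ∪ R = G.vertexSet) (hdisj : Disjoint B R)
    (d : ℕ) (hd : 3 ≤ d) :
    BodyRodBar.AlmostAll (BodyRodBar.rodConfigurations d R) fun r =>
      BodyRodBar.AlmostAll (BodyRodBar.barConfigurations G r) fun q =>
        BodyRodBar.bodyRodBarMatroid G q = BodyRodBar.countMatroid G hd R ∧
        ∀ I : Set G.edgeSet, (BodyRodBar.bodyRodBarMatroid G q).Indep I ↔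
          ∀ F ⊆ I, F.Nonempty →
            (F.ncard : ℤ) ≤ ((d + 1).choose 2 : ℤ) * ((BodyRodBar.spanned G F).ncard : ℤ)
              - ((d + 1).choose 2 : ℤ) - ((BodyRodBar.spanned G F ∩ R).ncard : ℤ) := by
  have := Fintype.ofFinite G.vertexSet
  have hR : R ⊆ G.vertexSet := hBR ▸ Set.subset_union_right
  have hi := Set.inclusion_injective hR
  have hth : ∀ e, BodyRodBar.tailVertex G e ≠ BodyRodBar.headVertex G e := fun e he =>
    (BodyRodBar.isLink_tail_head G e).ne (congrArg Subtype.val he)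
  have hd1 : 1 ≤ d := by omega
  -- Generic rods supply both inputs for the bars: radicals that pairwise span `W`, and a witness
  -- for each sparse set at this very rod-configuration.
  refine (BodyRodBar.almostAll_rods hi hd (BodyRodBar.tailVertex G) (BodyRodBar.headVertex G)
    hth).mono fun r hr hgood => ?_
  rw [BodyRodBar.barConfigurations_eq_compatibleBars G hR]
  refine (BodyRodBar.almostAll_bars hd (BodyRodBar.mem_range_iff_rodForms_ne_zero hi hd1 hr)
    (fun u v huv c => BodyRodBar.rodForms_eq_zero_of_eq_smul hi hd1 hr huv)
    (BodyRodBar.rankTwo_rodForms hi hd1 hr) hgood.1 hth hgood.2).mono fun q _ hq => ?_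
  have hindep : ∀ I, (BodyRodBar.bodyRodBarMatroid G q).Indep I ↔
      ∀ F ⊆ I, F.Nonempty → (F.ncard : ℤ) ≤ BodyRodBar.countFun G d R F := fun I => by
    rw [BodyRodBar.bodyRodBarMatroid_indep, BodyRodBar.linearIndepOn_edgeVector_iff, hq,
      BodyRodBar.sparse_iff G hR]
  refine ⟨Matroid.ext_indep rfl fun I _ => ?_, fun I => ?_⟩
  · rw [hindep, BodyRodBar.countMatroid_indep]
  · rw [hindep]
    simp only [BodyRodBar.countFun, mul_sub, mul_one]
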